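/- Fix $\tau\in\mathbb{C}$ with $\operatorname{Im}\tau<0$. For $\theta\in\mathbb{R}$ let $A_\theta$ be the algebra of series $\sum a_{n_1,n_2}U_1^{n_1}U_2^{n_2}$ with rapidly decreasing complex coefficients and $U_1U_2=e^{2\pi i\theta}U_2U_1$, and let $\delta_\tau$ be its derivation $\delta_\tau\big(\sum a_{n_1,n_2}U_1^{n_1}U_2^{n_2}\big)=2\pi i\sum(n_1\tau+n_2)a_{n_1,n_2}U_1^{n_1}U_2^{n_2}$. For $g=\begin{pmatrix}a&b\\c&d\end{pmatrix}\in \mathrm{SL}_2(\mathbb{Z})$ put $\operatorname{rk}(g,\theta)=c\theta+d$. If $\operatorname{rk}(g,\theta)\neq0$ and $z\in\mathbb{C}$, the standard holomorphic bundle $E_g^z(\theta)$ is the following right $A_\theta$-module with operator $\overline\nabla_z$. If $c\ne0$, it is the Schwartz space $\mathcal{S}(\mathbb{R}\times\mathbb{Z}/c\mathbb{Z})$ with $$fU_1(x,\alpha)=f\Big(x-\frac{d+c\theta}{c},\alpha-1\Big),\quad fU_2(x,\alpha)=e^{2\pi i(x-\alpha d/c)}f(x,\alpha),\quad \overline\nabla_z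 f=\frac{\partial f}{\partial x}+2\pi i\Big(\frac{\tau c}{d+c\theta}x+z\Big)f;$$ if $c=0$, it is $A_\theta$ with $\overline\nabla_z(a)=2\pi i z\,a+\delta_\tau(a)$. Let $H^*\mathcal{C}^{st}(\theta,\tau)$ be the $\mathbb{C}$-linear graded category with objects $E_g^z(\theta)[n]$, where $g\in \mathrm{SL}_2(\mathbb{Z})$, $\operatorname{rk}(g,\theta)>0$, $z\in\mathbb{C}$, $n\in\mathbb{Z}$, in which the graded space of morphisms from $E[n]$ to $E'[n']$ is the cohomology of the two-term complex $$\operatorname{Hom}_{A_\theta}(E,E')\to\operatorname{Hom}_{A_\theta}(E,E'),\qquad \varphi\mapsto\overline\nabla\varphi-\varphi\overline\nabla,$$ placed in degrees $n-n'$ and $n-n'+1$, and composition is induced by composition of $A_\theta$-linear maps. For $\theta'\in\mathbb{R}$ let $H^*\mathcal{C}^{st}(\theta,\tau)_{\theta'}$ be its full subcategory of objects $E_g^z(\theta)[n]$ with $\operatorname{rk}(g,\theta')\neq0$. **Theorem.** For all $\theta,\theta'\in\mathbb{R}$ the graded categories $H^*\mathcal{C}^{st}(\theta,\tau)_{\theta'}$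 and $H^*\mathcal{C}^{st}(\theta',\tau)_{\theta}$ are equivalent. More precisely, with $\lambda(g)=\operatorname{rk}(g,\theta)/\operatorname{rk}(g,\theta')$, there is a $\mathbb{C}$-linear degree-preserving equivalence $F$ from the first to the second, with unit and counit of degree $0$, given on objects by $$F(E_g^z(\theta)[n])=\begin{cases}E_g^{\lambda(g)z}(\theta')[n],&\operatorname{rk}(g,\theta')>0,\\ E_{-g}^{\lambda(g)z}(\theta')[n-1],&\operatorname{rk}(g,\theta')<0,\ \theta<\theta',\\ E_{-g}^{\lambda(g)z}(\theta')[n+1],&\operatorname{rk}(g,\theta')<0,\ \theta'<\theta.\end{cases}$$ -/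

import Mathlib

open scoped SchwartzMap
open CategoryTheory

noncomputable section

namespace NCTorus

/-- `e(t) = exp(2πit)` for real `t`. -/
def e (t : ℝ) : ℂ := Complex.exp (2 * Real.pi * Complex.I * t)

lemma e_add (s t : ℝ) : e (s + t) = e s * e t := by
  unfold e; rw [← Complex.exp_add]; congr 1; push_cast; ring

lemma e_eq (t : ℝ) : e t = Complex.exp ((2 * Real.pi * t : ℝ) * Complex.I) := by
  unfold e; congr 1; push_cast; ring

@[simp] lemma norm_e (t : ℝ) : ‖e t‖ = 1 := by
  rw [e_eq, Complex.norm_exp_ofReal_mul_I]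

@[simp] lemma e_zero : e 0 = 1 := by simp [e]

lemma e_int (n : ℤ) : e n = 1 := by
  unfold e; rw [Complex.exp_eq_one_iff]; exact ⟨n, by push_cast; ring⟩

/-- The weight `1 + |n₁| + |n₂|` on `ℤ²`. -/
def weight (n : ℤ × ℤ) : ℝ := 1 + |(n.1 : ℝ)| + |(n.2 : ℝ)|

lemma one_le_weight (n : ℤ × ℤ) : 1 ≤ weight n := by
  unfold weight; nlinarith [abs_nonneg (n.1 : ℝ), abs_nonneg (n.2 : ℝ)]

lemma weight_pos (n : ℤ × ℤ) : 0 < weight n := lt_of_lt_of_le one_pos (one_le_weight n)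

lemma weight_add_le (m n : ℤ × ℤ) : weight (m + n) ≤ weight m * weight n := by
  unfold weight
  have h1 := abs_add_le (m.1 : ℝ) n.1
  have h2 := abs_add_le (m.2 : ℝ) n.2
  simp only [Prod.fst_add, Prod.snd_add, Int.cast_add]
  have := abs_nonneg (m.1 : ℝ)
  have := abs_nonneg (m.2 : ℝ)
  have := abs_nonneg (n.1 : ℝ)
  have := abs_nonneg (n.2 : ℝ)
  nlinarith [mul_nonneg (abs_nonneg (m.1 : ℝ)) (abs_nonneg (n.1 : ℝ)),
    mul_nonneg (abs_nonneg (m.1 : ℝ)) (abs_nonneg (n.2 : ℝ)),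
    mul_nonneg (abs_nonneg (m.2 : ℝ)) (abs_nonneg (n.1 : ℝ)),
    mul_nonneg (abs_nonneg (m.2 : ℝ)) (abs_nonneg (n.2 : ℝ))]

lemma summable_weight : Summable fun n : ℤ × ℤ => (weight n ^ 4)⁻¹ := by
  have h1 : Summable fun n : ℤ => ((1 + |(n : ℝ)|) ^ 2)⁻¹ := by
    have h0 : Summable fun n : ℤ => 1 / (n : ℝ) ^ 2 :=
      Real.summable_one_div_int_pow.mpr one_lt_two
    refine Summable.of_norm_bounded_eventually h0 ?_
    filter_upwards [(Set.finite_singleton (0 : ℤ)).compl_mem_cofinite] with n hn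
    have hn' : (n : ℝ) ≠ 0 := by simpa using hn
    have h : 0 < |(n : ℝ)| := abs_pos.mpr hn'
    rw [Real.norm_of_nonneg (by positivity), one_div, ← sq_abs (n : ℝ)]
    gcongr
    linarith
  refine Summable.of_nonneg_of_le (fun n => by have := weight_pos n; positivity) (fun n => ?_)
    (h1.mul_of_nonneg h1 (fun _ => by positivity) (fun _ => by positivity))
  rw [← mul_inv]
  have h2 := abs_nonneg (n.1 : ℝ)
  have h3 := abs_nonneg (n.2 : ℝ)
  gcongr
  unfold weight
  have : (1 + |(n.1 : ℝ)| + |(n.2 : ℝ)|) ^ 4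
      = (1 + |(n.1 : ℝ)| + |(n.2 : ℝ)|) ^ 2 * (1 + |(n.1 : ℝ)| + |(n.2 : ℝ)|) ^ 2 := by ring
  rw [this]
  have h4 : 1 + |(n.1 : ℝ)| ≤ 1 + |(n.1 : ℝ)| + |(n.2 : ℝ)| := by linarith
  have h5 : 1 + |(n.2 : ℝ)| ≤ 1 + |(n.1 : ℝ)| + |(n.2 : ℝ)| := by linarith
  exact mul_le_mul (pow_le_pow_left₀ (by positivity) h4 2)
    (pow_le_pow_left₀ (by positivity) h5 2) (by positivity) (by positivity)

/-- The algebra `A_θ` of smooth functions on the noncommutative torus: an element stands for the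
formal series `∑ a(n₁,n₂) U₁^n₁ U₂^n₂` with rapidly decreasing coefficients. -/
@[ext] structure A (θ : ℝ) where
  coeff : ℤ × ℤ → ℂ
  decay : ∀ N : ℕ, ∃ C : ℝ, ∀ n, weight n ^ N * ‖coeff n‖ ≤ C

variable {θ : ℝ}

lemma A.summable (a : A θ) (N : ℕ) : Summable fun n => weight n ^ N * ‖a.coeff n‖ := by
  obtain ⟨C, hC⟩ := a.decay (N + 4)
  refine Summable.of_nonneg_of_le (fun n => by have := weight_pos n; positivity) (fun n => ?_)
    (summable_weight.mul_left C)
  have hw := weight_pos n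
  rw [← div_eq_mul_inv, le_div_iff₀ (by positivity)]
  calc _ = weight n ^ (N + 4) * ‖a.coeff n‖ := by ring
    _ ≤ C := hC n

lemma A.summable_norm (a : A θ) : Summable fun n => ‖a.coeff n‖ := by
  simpa using a.summable 0

namespace A

instance : Zero (A θ) := ⟨⟨0, fun _ => ⟨0, by simp⟩⟩⟩

instance : Add (A θ) := ⟨fun a b => ⟨a.coeff + b.coeff, fun N => by
  obtain ⟨C, hC⟩ := a.decay N
  obtain ⟨D, hD⟩ := b.decay N
  refine ⟨C + D, fun n => ?_⟩
  have hw := weight_pos n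
  calc _ ≤ weight n ^ N * (‖a.coeff n‖ + ‖b.coeff n‖) := by gcongr; exact norm_add_le _ _
    _ ≤ C + D := by rw [mul_add]; exact add_le_add (hC n) (hD n)⟩⟩

instance : SMul ℂ (A θ) := ⟨fun c a => ⟨c • a.coeff, fun N => by
  obtain ⟨C, hC⟩ := a.decay N
  refine ⟨‖c‖ * C, fun n => ?_⟩
  calc _ = ‖c‖ * (weight n ^ N * ‖a.coeff n‖) := by simp; ring
    _ ≤ _ := by gcongr; exact hC n⟩⟩

instance : Neg (A θ) := ⟨fun a => ⟨-a.coeff, fun N => by simpa using a.decay N⟩⟩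

@[simp] lemma coeff_zero (n : ℤ × ℤ) : (0 : A θ).coeff n = 0 := rfl
@[simp] lemma coeff_add (a b : A θ) (n : ℤ × ℤ) : (a + b).coeff n = a.coeff n + b.coeff n := rfl
@[simp] lemma coeff_neg (a : A θ) (n : ℤ × ℤ) : (-a).coeff n = -a.coeff n := rfl
@[simp] lemma coeff_smul (c : ℂ) (a : A θ) (n : ℤ × ℤ) : (c • a).coeff n = c * a.coeff n := rfl

/-- The monomial `U₁^n₁ U₂^n₂`. -/
def mono (θ : ℝ) (n : ℤ × ℤ) : A θ := ⟨Pi.single n 1, fun N => ⟨weight n ^ N, fun m => by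
  by_cases h : m = n
  · subst h; simp
  · have := weight_pos n; simp [h]; positivity⟩⟩

instance : One (A θ) := ⟨mono θ 0⟩

lemma coeff_one (n : ℤ × ℤ) : (1 : A θ).coeff n = if n = 0 then 1 else 0 := by
  show (Pi.single 0 1 : ℤ × ℤ → ℂ) n = _
  rw [Pi.single_apply]

/-- The phase in `U₁^m₁ U₂^m₂ · U₁^k₁ U₂^k₂ = phase θ m k · U₁^(m₁+k₁) U₂^(m₂+k₂)`, which is
forced by `U₁ U₂ = exp(2πiθ) U₂ U₁`. -/
def phase (θ : ℝ) (m k : ℤ × ℤ) : ℂ := e (-(θ * m.2 * k.1))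

@[simp] lemma norm_phase (m k : ℤ × ℤ) : ‖phase θ m k‖ = 1 := norm_e _

lemma phase_add_left (m m' k : ℤ × ℤ) : phase θ (m + m') k = phase θ m k * phase θ m' k := by
  unfold phase; rw [← e_add]; congr 1; simp; ring

lemma phase_add_right (m k k' : ℤ × ℤ) : phase θ m (k + k') = phase θ m k * phase θ m k' := by
  unfold phase; rw [← e_add]; congr 1; simp; ring

/-- The `(m, n - m)` term of the product. -/
def mulTerm (a b : A θ) (n m : ℤ × ℤ) : ℂ := a.coeff m * b.coeff (n - m) * phase θ m (n - m)

lemma norm_mulTerm_le (a b : A θ) (N : ℕ) : ∃ C : ℝ, ∀ n m,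
    weight n ^ N * ‖mulTerm a b n m‖ ≤ C * (weight m ^ N * ‖a.coeff m‖) := by
  obtain ⟨C, hC⟩ := b.decay N
  refine ⟨C, fun n m => ?_⟩
  have h1 := weight_pos m
  have h2 := weight_pos (n - m)
  have h3 := weight_pos n
  have h : weight n ≤ weight m * weight (n - m) := by
    simpa using weight_add_le m (n - m)
  calc weight n ^ N * ‖mulTerm a b n m‖
      ≤ (weight m * weight (n - m)) ^ N * (‖a.coeff m‖ * ‖b.coeff (n - m)‖) := by
        simp only [mulTerm, norm_mul, norm_phase, mul_one]; gcongr
    _ = (weight (n - m) ^ N * ‖b.coeff (n - m)‖) * (weight m ^ N * ‖a.coeff m‖) := by ring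
    _ ≤ _ := by gcongr; exact hC _

lemma summable_mulTerm (a b : A θ) (n : ℤ × ℤ) : Summable fun m => ‖mulTerm a b n m‖ := by
  obtain ⟨C, hC⟩ := norm_mulTerm_le a b 0
  refine Summable.of_nonneg_of_le (fun _ => norm_nonneg _) (fun m => ?_)
    (a.summable_norm.mul_left C)
  simpa using hC n m

instance : Mul (A θ) := ⟨fun a b => ⟨fun n => ∑' m, mulTerm a b n m, fun N => by
  obtain ⟨C, hC⟩ := norm_mulTerm_le a b N
  refine ⟨∑' m, C * (weight m ^ N * ‖a.coeff m‖), fun n => ?_⟩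
  have h3 := weight_pos n
  calc _ ≤ weight n ^ N * ∑' m, ‖mulTerm a b n m‖ := by
        gcongr; exact norm_tsum_le_tsum_norm (summable_mulTerm a b n)
    _ = ∑' m, weight n ^ N * ‖mulTerm a b n m‖ := tsum_mul_left.symm
    _ ≤ _ := ((summable_mulTerm a b n).mul_left _).tsum_le_tsum (hC n)
        ((a.summable N).mul_left C)⟩⟩

lemma coeff_mul (a b : A θ) (n : ℤ × ℤ) : (a * b).coeff n = ∑' m, mulTerm a b n m := rfl

/-- Rearrangement behind the associativity of the product and of the module structures. -/
lemma summable_pair (a b : A θ) {F : ℤ × ℤ → ℂ} {C : ℝ} (hF : ∀ n, ‖F n‖ ≤ C) :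
    Summable fun p : (ℤ × ℤ) × (ℤ × ℤ) =>
      a.coeff p.1 * b.coeff p.2 * phase θ p.1 p.2 * F (p.1 + p.2) := by
  have h := (a.summable_norm.mul_of_nonneg b.summable_norm (fun _ => norm_nonneg _)
    (fun _ => norm_nonneg _)).mul_right C
  refine Summable.of_norm_bounded h fun p => ?_
  simp only [norm_mul, norm_phase, mul_one]
  gcongr
  exact hF _

lemma tsum_mul_coeff (a b : A θ) {F : ℤ × ℤ → ℂ} {C : ℝ} (hF : ∀ n, ‖F n‖ ≤ C) :
    ∑' n, (a * b).coeff n * F n = ∑' p : (ℤ × ℤ) × (ℤ × ℤ),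
      a.coeff p.1 * b.coeff p.2 * phase θ p.1 p.2 * F (p.1 + p.2) := by
  have hs := summable_pair a b hF
  let φ : (ℤ × ℤ) × (ℤ × ℤ) ≃ (ℤ × ℤ) × (ℤ × ℤ) :=
    { toFun := fun p => (p.2, p.1 - p.2)
      invFun := fun p => (p.1 + p.2, p.1)
      left_inv := fun p => by simp
      right_inv := fun p => by simp }
  rw [← φ.tsum_eq]
  have hs' := (φ.summable_iff).mpr hs
  refine Eq.trans ?_ hs'.tsum_prod.symm
  refine tsum_congr fun n => ?_
  rw [coeff_mul, ← tsum_mul_right]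
  refine tsum_congr fun m => ?_
  simp [φ, mulTerm]

lemma tsum_mul_coeff_left (a b : A θ) {F : ℤ × ℤ → ℂ} {C : ℝ} (hF : ∀ n, ‖F n‖ ≤ C) :
    ∑' n, (a * b).coeff n * F n =
      ∑' m, a.coeff m * ∑' k, b.coeff k * phase θ m k * F (m + k) := by
  rw [tsum_mul_coeff a b hF, (summable_pair a b hF).tsum_prod]
  refine tsum_congr fun m => ?_
  rw [← tsum_mul_left]
  refine tsum_congr fun k => by ring

lemma tsum_mul_coeff_right (a b : A θ) {F : ℤ × ℤ → ℂ} {C : ℝ} (hF : ∀ n, ‖F n‖ ≤ C) :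
    ∑' n, (a * b).coeff n * F n =
      ∑' k, b.coeff k * ∑' m, a.coeff m * (phase θ m k * F (m + k)) := by
  have hs := summable_pair a b hF
  rw [tsum_mul_coeff a b hF, ← (Equiv.prodComm _ _).tsum_eq]
  refine ((Equiv.prodComm (ℤ × ℤ) (ℤ × ℤ)).summable_iff.mpr hs).tsum_prod.trans ?_
  refine tsum_congr fun k => ?_
  rw [← tsum_mul_left]
  refine tsum_congr fun m => by simp; ring

protected lemma mul_assoc' (a b c : A θ) : a * b * c = a * (b * c) := by
  ext n
  obtain ⟨C, hC⟩ := c.decay 0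
  have hF : ∀ k, ‖c.coeff (n - k) * phase θ k (n - k)‖ ≤ C := fun k => by
    simpa using hC (n - k)
  have h := tsum_mul_coeff_left a b hF
  rw [coeff_mul, coeff_mul]
  calc ∑' k, mulTerm (a * b) c n k
      = ∑' k, (a * b).coeff k * (c.coeff (n - k) * phase θ k (n - k)) :=
        tsum_congr fun k => by simp [mulTerm, mul_assoc]
    _ = _ := h
    _ = _ := tsum_congr fun m => by
      rw [mulTerm, coeff_mul, mul_assoc, ← tsum_mul_right]
      congr 1
      refine tsum_congr fun k => ?_
      have e1 : n - m = k + (n - (m + k)) := by abel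
      have e2 : n - m - k = n - (m + k) := by abel
      rw [mulTerm, e2, e1, phase_add_right, phase_add_left]
      ring

lemma tsum_single_left (F : ℤ × ℤ → ℂ) : ∑' n, (1 : A θ).coeff n * F n = F 0 := by
  rw [tsum_eq_single 0]
  · simp [coeff_one]
  · intro m hm; simp [coeff_one, hm]

protected lemma one_mul' (a : A θ) : 1 * a = a := by
  ext n
  rw [coeff_mul]
  simp only [mulTerm, mul_assoc]
  rw [tsum_single_left]
  simp [phase]

protected lemma mul_one' (a : A θ) : a * 1 = a := by
  ext n
  rw [coeff_mul, tsum_eq_single n]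
  · simp [mulTerm, coeff_one, phase]
  · intro m hm
    have : n - m ≠ 0 := fun h => hm (sub_eq_zero.mp h).symm
    simp [mulTerm, coeff_one, this]

protected lemma left_distrib' (a b c : A θ) : a * (b + c) = a * b + a * c := by
  ext n
  rw [coeff_add, coeff_mul, coeff_mul, coeff_mul, ← Summable.tsum_add
    (summable_mulTerm a b n).of_norm (summable_mulTerm a c n).of_norm]
  exact tsum_congr fun m => by simp [mulTerm]; ring

protected lemma right_distrib' (a b c : A θ) : (a + b) * c = a * c + b * c := by
  ext n
  rw [coeff_add, coeff_mul, coeff_mul, coeff_mul, ← Summable.tsum_add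
    (summable_mulTerm a c n).of_norm (summable_mulTerm b c n).of_norm]
  exact tsum_congr fun m => by simp [mulTerm]; ring

instance : AddCommGroup (A θ) where
  add_assoc a b c := by ext n; simp [add_assoc]
  zero_add a := by ext n; simp
  add_zero a := by ext n; simp
  nsmul := nsmulRec
  zsmul := zsmulRec
  neg_add_cancel a := by ext n; simp
  add_comm a b := by ext n; simp [add_comm]

instance : Ring (A θ) where
  __ := (inferInstance : AddCommGroup (A θ))
  left_distrib := A.left_distrib'
  right_distrib := A.right_distrib'
  zero_mul a := by ext n; simp [coeff_mul, mulTerm]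
  mul_zero a := by ext n; simp [coeff_mul, mulTerm]
  mul_assoc := A.mul_assoc'
  one_mul := A.one_mul'
  mul_one := A.mul_one'

instance : Module ℂ (A θ) where
  one_smul a := by ext n; simp
  mul_smul c d a := by ext n; simp [mul_assoc]
  smul_zero c := by ext n; simp
  smul_add c a b := by ext n; simp [mul_add]
  add_smul c d a := by ext n; simp [add_mul]
  zero_smul a := by ext n; simp

protected lemma smul_mul (c : ℂ) (a b : A θ) : c • a * b = c • (a * b) := by
  ext n
  rw [coeff_smul, coeff_mul, coeff_mul, ← tsum_mul_left]
  exact tsum_congr fun m => by simp [mulTerm, mul_assoc]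

protected lemma mul_smul' (c : ℂ) (a b : A θ) : a * c • b = c • (a * b) := by
  ext n
  rw [coeff_smul, coeff_mul, coeff_mul, ← tsum_mul_left]
  exact tsum_congr fun m => by simp [mulTerm]; ring

instance : Algebra ℂ (A θ) := Algebra.ofModule A.smul_mul A.mul_smul'

/-- The derivation `δ_τ(∑ a(n₁,n₂) U₁^n₁ U₂^n₂) = 2πi ∑ (n₁τ + n₂) a(n₁,n₂) U₁^n₁ U₂^n₂`. -/
def delta (τ : ℂ) : A θ →ₗ[ℂ] A θ where
  toFun a := ⟨fun n => 2 * Real.pi * Complex.I * (n.1 * τ + n.2) * a.coeff n, fun N => by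
    obtain ⟨C, hC⟩ := a.decay (N + 1)
    refine ⟨2 * Real.pi * (‖τ‖ + 1) * C, fun n => ?_⟩
    have hw := weight_pos n
    have h1 : ‖(n.1 * τ + n.2 : ℂ)‖ ≤ weight n * (‖τ‖ + 1) := by
      calc _ ≤ ‖(n.1 * τ : ℂ)‖ + ‖(n.2 : ℂ)‖ := norm_add_le _ _
        _ = |(n.1 : ℝ)| * ‖τ‖ + |(n.2 : ℝ)| := by simp
        _ ≤ _ := by
          unfold weight
          nlinarith [abs_nonneg (n.1 : ℝ), abs_nonneg (n.2 : ℝ), norm_nonneg τ,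
            mul_nonneg (abs_nonneg (n.2 : ℝ)) (norm_nonneg τ)]
    have h2 : ‖(2 * Real.pi * Complex.I : ℂ)‖ = 2 * Real.pi := by
      simp [abs_of_pos Real.pi_pos]
    rw [norm_mul, norm_mul, h2]
    have hp := Real.pi_pos
    calc weight n ^ N * (2 * Real.pi * ‖(n.1 * τ + n.2 : ℂ)‖ * ‖a.coeff n‖)
        ≤ weight n ^ N * (2 * Real.pi * (weight n * (‖τ‖ + 1)) * ‖a.coeff n‖) := by gcongr
      _ = 2 * Real.pi * (‖τ‖ + 1) * (weight n ^ (N + 1) * ‖a.coeff n‖) := by ring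
      _ ≤ _ := by gcongr; exact hC n⟩
  map_add' a b := by ext n; simp; ring
  map_smul' c a := by ext n; simp; ring

lemma coeff_delta (τ : ℂ) (a : A θ) (n : ℤ × ℤ) :
    (delta τ a).coeff n = 2 * Real.pi * Complex.I * (n.1 * τ + n.2) * a.coeff n := rfl

lemma delta_mul (τ : ℂ) (a b : A θ) : delta τ (a * b) = delta τ a * b + a * delta τ b := by
  ext n
  rw [coeff_delta, coeff_add, coeff_mul, coeff_mul, coeff_mul, ← Summable.tsum_add
    (summable_mulTerm _ _ n).of_norm (summable_mulTerm _ _ n).of_norm, ← tsum_mul_left]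
  exact tsum_congr fun m => by simp [mulTerm, coeff_delta]; ring

/-- The defining relation `U₁ U₂ = exp(2πiθ) U₂ U₁`. -/
lemma mono_mul (m k : ℤ × ℤ) : mono θ m * mono θ k = phase θ m k • mono θ (m + k) := by
  ext n
  rw [coeff_mul, coeff_smul, tsum_eq_single m]
  · by_cases h : n = m + k
    · subst h; simp [mulTerm, mono]
    · have : n - m ≠ k := fun h' => h (by rw [← h']; abel)
      simp [mulTerm, mono, h, this]
  · intro j hj; simp [mulTerm, mono, hj]

lemma U_relation : mono θ (1, 0) * mono θ (0, 1) = e θ • (mono θ (0, 1) * mono θ (1, 0)) := by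
  rw [mono_mul, mono_mul, smul_smul]
  simp [phase, ← e_add]

end A

/-! ### Series of Schwartz functions -/

section Series

variable {ι : Type*}

/-- The sum of a family of Schwartz functions which is absolutely summable in each seminorm. -/
def schwartzSum (u : ι → 𝓢(ℝ, ℂ))
    (h : ∀ k l : ℕ, Summable fun i => SchwartzMap.seminorm ℂ k l (u i)) : 𝓢(ℝ, ℂ) where
  toFun x := ∑' i, u i x
  smooth' := by
    refine contDiff_tsum (N := (⊤ : ℕ∞)) (v := fun k i => SchwartzMap.seminorm ℂ 0 k (u i))
      (fun i => (u i).smooth ⊤) (fun k _ => h 0 k) (fun k i x _ => ?_)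
    exact SchwartzMap.norm_iteratedFDeriv_le_seminorm ℂ (u i) k x
  decay' k l := by
    refine ⟨∑' i, SchwartzMap.seminorm ℂ k l (u i), fun x => ?_⟩
    have h1 := iteratedFDeriv_tsum_apply (N := (⊤ : ℕ∞)) (𝕜 := ℝ) (f := fun i x => u i x)
      (v := fun k i => SchwartzMap.seminorm ℂ 0 k (u i))
      (fun i => (u i).smooth ⊤) (fun k _ => h 0 k)
      (fun k i x _ => SchwartzMap.norm_iteratedFDeriv_le_seminorm ℂ (u i) k x)
      (k := l) le_top x
    rw [h1]
    have h2 : Summable fun i => ‖iteratedFDeriv ℝ l (u i) x‖ :=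
      Summable.of_nonneg_of_le (fun _ => norm_nonneg _)
        (fun i => SchwartzMap.norm_iteratedFDeriv_le_seminorm ℂ (u i) l x) (h 0 l)
    calc _ ≤ ‖x‖ ^ k * ∑' i, ‖iteratedFDeriv ℝ l (u i) x‖ := by
          gcongr; exact norm_tsum_le_tsum_norm h2
      _ = ∑' i, ‖x‖ ^ k * ‖iteratedFDeriv ℝ l (u i) x‖ := tsum_mul_left.symm
      _ ≤ _ := (h2.mul_left _).tsum_le_tsum
          (fun i => SchwartzMap.le_seminorm ℂ k l (u i) x) (h k l)

lemma schwartzSum_apply (u : ι → 𝓢(ℝ, ℂ))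
    (h : ∀ k l : ℕ, Summable fun i => SchwartzMap.seminorm ℂ k l (u i)) (x : ℝ) :
    schwartzSum u h x = ∑' i, u i x := rfl

lemma summable_apply {u : ι → 𝓢(ℝ, ℂ)}
    (h : ∀ k l : ℕ, Summable fun i => SchwartzMap.seminorm ℂ k l (u i)) (x : ℝ) :
    Summable fun i => u i x :=
  Summable.of_norm_bounded (h 0 0) fun i => SchwartzMap.norm_le_seminorm ℂ (u i) x

lemma seminorm_deriv (k l : ℕ) (f : 𝓢(ℝ, ℂ)) :
    SchwartzMap.seminorm ℂ k l (SchwartzMap.derivCLM ℂ ℂ f) = SchwartzMap.seminorm ℂ k (l + 1) f := by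
  have h : ∀ x, iteratedDeriv l (SchwartzMap.derivCLM ℂ ℂ f) x = iteratedDeriv (l + 1) f x := by
    intro x; rw [iteratedDeriv_succ']; rfl
  apply le_antisymm
  · refine SchwartzMap.seminorm_le_bound' ℂ _ _ _ (apply_nonneg _ _) fun x => ?_
    rw [h]; exact SchwartzMap.le_seminorm' ℂ _ _ _ _
  · refine SchwartzMap.seminorm_le_bound' ℂ _ _ _ (apply_nonneg _ _) fun x => ?_
    rw [← h]; exact SchwartzMap.le_seminorm' ℂ _ _ _ _

lemma deriv_schwartzSum (u : ι → 𝓢(ℝ, ℂ))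
    (h : ∀ k l : ℕ, Summable fun i => SchwartzMap.seminorm ℂ k l (u i)) (x : ℝ) :
    deriv (schwartzSum u h) x = ∑' i, deriv (u i) x := by
  refine (hasDerivAt_tsum (h 0 1) (fun i y => (u i).hasDerivAt y) (fun i y => ?_)
    (summable_apply h 0) x).deriv
  rw [← zero_add 1, ← seminorm_deriv]
  exact SchwartzMap.norm_le_seminorm ℂ (SchwartzMap.derivCLM ℂ ℂ (u i)) y

end Series

/-! ### The basic modules of nonzero degree -/

/-- The function `x ↦ e(l (x - b))`. -/
def char (l : ℤ) (b : ℝ) (x : ℝ) : ℂ := e (l * (x - b))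

lemma hasDerivAt_char (l : ℤ) (b x : ℝ) :
    HasDerivAt (char l b) (2 * Real.pi * Complex.I * l * char l b x) x := by
  have h1 : HasDerivAt (fun x : ℝ => 2 * Real.pi * Complex.I * ((l * (x - b) : ℝ) : ℂ))
      (2 * Real.pi * Complex.I * (l : ℂ)) x := by
    have h2 : HasDerivAt (fun x : ℝ => (l : ℝ) * (x - b)) (l : ℝ) x := by
      simpa using ((hasDerivAt_id x).sub_const b).const_mul (l : ℝ)
    simpa using h2.ofReal_comp.const_mul (2 * Real.pi * Complex.I)
  have h3 := h1.cexp
  rw [mul_comm (Complex.exp _)] at h3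
  exact h3

lemma iteratedDeriv_char (l : ℤ) (b : ℝ) (n : ℕ) :
    iteratedDeriv n (char l b) = fun x => (2 * Real.pi * Complex.I * l) ^ n * char l b x := by
  induction n with
  | zero => simp
  | succ n ih =>
    rw [iteratedDeriv_succ, ih]
    ext x
    rw [((hasDerivAt_char l b x).const_mul _).deriv]
    ring

lemma char_hasTemperateGrowth (l : ℤ) (b : ℝ) : (char l b).HasTemperateGrowth := by
  refine ⟨?_, fun n => ⟨0, ‖(2 * Real.pi * Complex.I * l : ℂ)‖ ^ n, fun x => ?_⟩⟩
  · unfold char e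
    have : ContDiff ℝ (⊤ : ℕ∞) fun x : ℝ => ((l * (x - b) : ℝ) : ℂ) :=
      Complex.ofRealCLM.contDiff.comp (contDiff_const.mul (contDiff_id.sub contDiff_const))
    exact (contDiff_const.mul this).cexp
  · rw [norm_iteratedFDeriv_eq_norm_iteratedDeriv, iteratedDeriv_char]
    simp [char]

/-- The operator `f ↦ (x ↦ e(l (x - b)) f(x - s))` on Schwartz functions. -/
def shiftMul (l : ℤ) (s b : ℝ) : 𝓢(ℝ, ℂ) →L[ℂ] 𝓢(ℝ, ℂ) :=
  SchwartzMap.smulLeftCLM ℂ (char l b) ∘L SchwartzMap.compSubConstCLM ℂ s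

@[simp] lemma shiftMul_apply (l : ℤ) (s b : ℝ) (f : 𝓢(ℝ, ℂ)) (x : ℝ) :
    shiftMul l s b f x = e (l * (x - b)) * f (x - s) := by
  simp [shiftMul, SchwartzMap.smulLeftCLM_apply_apply (char_hasTemperateGrowth l b), char]

lemma deriv_shiftMul (l : ℤ) (s b : ℝ) (f : 𝓢(ℝ, ℂ)) (x : ℝ) :
    deriv (shiftMul l s b f) x =
      shiftMul l s b (SchwartzMap.derivCLM ℂ ℂ f) x
        + 2 * Real.pi * Complex.I * l * shiftMul l s b f x := by
  have h : (shiftMul l s b f : ℝ → ℂ) = char l b * fun x => f (x - s) := by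
    ext x; simp [char]
  rw [h, ((hasDerivAt_char l b x).mul ((f.hasDerivAt (x - s)).comp_sub_const x s)).deriv]
  simp [char]
  ring

lemma derivCLM_shiftMul (l : ℤ) (s b : ℝ) (f : 𝓢(ℝ, ℂ)) :
    SchwartzMap.derivCLM ℂ ℂ (shiftMul l s b f) =
      shiftMul l s b (SchwartzMap.derivCLM ℂ ℂ f)
        + (2 * Real.pi * Complex.I * l : ℂ) • shiftMul l s b f := by
  ext x
  rw [SchwartzMap.derivCLM_apply, deriv_shiftMul]
  simp

lemma seminorm_shiftMul_le (k j : ℕ) : ∀ f : 𝓢(ℝ, ℂ), ∃ C : ℝ, 0 ≤ C ∧ ∃ N : ℕ, ∀ l s b,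
    SchwartzMap.seminorm ℂ k j (shiftMul l s b f) ≤ C * (1 + |(l : ℝ)| + |s|) ^ N := by
  induction j with
  | zero =>
    intro f
    set P := SchwartzMap.seminorm ℂ k 0 f
    set Q := SchwartzMap.seminorm ℂ 0 0 f
    have hP : 0 ≤ P := apply_nonneg _ _
    have hQ : 0 ≤ Q := apply_nonneg _ _
    refine ⟨2 ^ (k - 1) * (P + Q), by positivity, k, fun l s b => ?_⟩
    refine SchwartzMap.seminorm_le_bound' ℂ _ _ _ (by positivity) fun x => ?_
    have h1 : |x| ≤ |x - s| + |s| := by simpa using abs_add_le (x - s) s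
    have h2 : |x - s| ^ k * ‖f (x - s)‖ ≤ P := by
      simpa using SchwartzMap.norm_pow_mul_le_seminorm ℂ f k (x - s)
    have h3 : ‖f (x - s)‖ ≤ Q := SchwartzMap.norm_le_seminorm ℂ f _
    have h4 : (1 : ℝ) ≤ (1 + |(l : ℝ)| + |s|) ^ k :=
      one_le_pow₀ (by linarith [abs_nonneg (l : ℝ), abs_nonneg s])
    have h5 : |s| ^ k ≤ (1 + |(l : ℝ)| + |s|) ^ k :=
      pow_le_pow_left₀ (abs_nonneg s) (by linarith [abs_nonneg (l : ℝ)]) k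
    rw [iteratedDeriv_zero, shiftMul_apply, norm_mul, norm_e, one_mul]
    calc |x| ^ k * ‖f (x - s)‖ ≤ (|x - s| + |s|) ^ k * ‖f (x - s)‖ := by gcongr
      _ ≤ (2 ^ (k - 1) * (|x - s| ^ k + |s| ^ k)) * ‖f (x - s)‖ := by
          gcongr; exact add_pow_le (abs_nonneg _) (abs_nonneg _) k
      _ = 2 ^ (k - 1) * (|x - s| ^ k * ‖f (x - s)‖ + |s| ^ k * ‖f (x - s)‖) := by ring
      _ ≤ 2 ^ (k - 1) * (P * (1 + |(l : ℝ)| + |s|) ^ k + (1 + |(l : ℝ)| + |s|) ^ k * Q) := by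
          have h6 := h2.trans (le_mul_of_one_le_right hP h4)
          have h7 := mul_le_mul h5 h3 (norm_nonneg _) (by positivity)
          gcongr
      _ = _ := by ring
  | succ j ih =>
    intro f
    obtain ⟨C, hC, N, h⟩ := ih f
    obtain ⟨D, hD, M, h'⟩ := ih (SchwartzMap.derivCLM ℂ ℂ f)
    have hp := Real.pi_pos
    refine ⟨D + 2 * Real.pi * C, by positivity, M + N + 1, fun l s b => ?_⟩
    rw [← seminorm_deriv, derivCLM_shiftMul]
    set w := 1 + |(l : ℝ)| + |s| with hw
    have hw1 : 1 ≤ w := by linarith [abs_nonneg (l : ℝ), abs_nonneg s]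
    have hl : |(l : ℝ)| ≤ w := by linarith [abs_nonneg s]
    have h2 : ‖(2 * Real.pi * Complex.I * l : ℂ)‖ = 2 * Real.pi * |(l : ℝ)| := by
      simp [abs_of_pos Real.pi_pos]
    calc _ ≤ SchwartzMap.seminorm ℂ k j (shiftMul l s b (SchwartzMap.derivCLM ℂ ℂ f))
            + SchwartzMap.seminorm ℂ k j ((2 * Real.pi * Complex.I * l : ℂ) • shiftMul l s b f) :=
          map_add_le_add _ _ _
      _ ≤ D * w ^ M + 2 * Real.pi * w * (C * w ^ N) := by
          rw [map_smul_eq_mul, h2]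
          gcongr
          · exact h' l s b
          · exact h l s b
      _ = D * w ^ M + 2 * Real.pi * C * w ^ (N + 1) := by ring
      _ ≤ D * w ^ (M + N + 1) + 2 * Real.pi * C * w ^ (M + N + 1) := by
          gcongr <;> first | exact hw1 | omega
      _ = _ := by ring

/-- The underlying space `𝓢(ℝ × ℤ/cℤ)` of the module `E_{d,c}(θ)`, for `c ≠ 0`. -/
def SchwartzModule (_θ : ℝ) (c _d : ℤ) : Type := ZMod c.natAbs → 𝓢(ℝ, ℂ)

namespace SchwartzModule

variable {c d : ℤ}

instance : AddCommGroup (SchwartzModule θ c d) :=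
  inferInstanceAs (AddCommGroup (ZMod c.natAbs → 𝓢(ℝ, ℂ)))

instance : Module ℂ (SchwartzModule θ c d) :=
  inferInstanceAs (Module ℂ (ZMod c.natAbs → 𝓢(ℝ, ℂ)))

@[ext] lemma ext {f g : SchwartzModule θ c d} (h : ∀ α x, f α x = g α x) : f = g :=
  funext fun α => SchwartzMap.ext (h α)

@[simp] lemma add_apply (f g : SchwartzModule θ c d) (α : ZMod c.natAbs) (x : ℝ) :
    (f + g) α x = f α x + g α x := rfl
@[simp] lemma smul_apply (k : ℂ) (f : SchwartzModule θ c d) (α : ZMod c.natAbs) (x : ℝ) :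
    (k • f) α x = k * f α x := rfl
@[simp] lemma zero_apply (α : ZMod c.natAbs) (x : ℝ) :
    (0 : SchwartzModule θ c d) α x = 0 := rfl

/-- The operator `f ↦ f U₁^n₁ U₂^n₂`, where
`(f U₁)(x, α) = f(x - (d + cθ)/c, α - 1)` and `(f U₂)(x, α) = e(x - αd/c) f(x, α)`. -/
def actMono (n : ℤ × ℤ) (f : SchwartzModule θ c d) : SchwartzModule θ c d := fun α =>
  shiftMul n.2 (n.1 * ((d + c * θ) / c)) (α.val * d / c) (f (α - n.1))

lemma actMono_apply (n : ℤ × ℤ) (f : SchwartzModule θ c d) (α : ZMod c.natAbs) (x : ℝ) :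
    actMono n f α x =
      e (n.2 * (x - α.val * d / c)) * f (α - n.1) (x - n.1 * ((d + c * θ) / c)) := by
  simp [actMono]

lemma actMono_add (n : ℤ × ℤ) (f g : SchwartzModule θ c d) :
    actMono n (f + g) = actMono n f + actMono n g := by
  ext α x; simp [actMono_apply, mul_add]

lemma actMono_smul (n : ℤ × ℤ) (k : ℂ) (f : SchwartzModule θ c d) :
    actMono n (k • f) = k • actMono n f := by
  ext α x; simp [actMono_apply]; ring

lemma actMono_zero (f : SchwartzModule θ c d) : actMono 0 f = f := by
  ext α x; simp [actMono_apply]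

section

variable [NeZero c]

instance : NeZero c.natAbs := ⟨Int.natAbs_ne_zero.mpr (NeZero.ne c)⟩

lemma actMono_actMono (m k : ℤ × ℤ) (f : SchwartzModule θ c d) :
    actMono k (actMono m f) = A.phase θ m k • actMono (m + k) f := by
  ext α x
  have hc : (c : ℝ) ≠ 0 := by exact_mod_cast NeZero.ne c
  rw [actMono_apply, actMono_apply, smul_apply, actMono_apply]
  obtain ⟨j, hj⟩ : ∃ j : ℤ, ((α - (k.1 : ZMod c.natAbs)).val : ℤ) = α.val - k.1 + c * j := by
    have h : (((α - (k.1 : ZMod c.natAbs)).val - (α.val - k.1) : ℤ) : ZMod c.natAbs) = 0 := by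
      push_cast
      simp
    rw [ZMod.intCast_zmod_eq_zero_iff_dvd] at h
    obtain ⟨j, hj⟩ := Int.natAbs_dvd.mp h
    exact ⟨j, by linarith⟩
  have hj' : ((α - (k.1 : ZMod c.natAbs)).val : ℝ) = α.val - k.1 + c * j := by exact_mod_cast hj
  have e1 : α - (k.1 : ZMod c.natAbs) - (m.1 : ZMod c.natAbs)
      = α - (((m + k).1 : ℤ) : ZMod c.natAbs) := by
    push_cast [Prod.fst_add]; ring
  have e2 : x - k.1 * ((d + c * θ) / c) - m.1 * ((d + c * θ) / c)
      = x - ((m + k).1 : ℤ) * ((d + c * θ) / c) := by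
    push_cast [Prod.fst_add]; ring
  rw [e1, e2, ← mul_assoc, ← mul_assoc]
  congr 1
  rw [A.phase, ← e_add, ← e_add, hj']
  have e3 : (k.2 : ℝ) * (x - α.val * d / c)
      + m.2 * (x - k.1 * ((d + c * θ) / c) - (α.val - k.1 + c * j) * d / c)
      = -(θ * m.2 * k.1) + ((m + k).2 : ℤ) * (x - α.val * d / c) + ((-(m.2 * j * d) : ℤ) : ℝ) := by
    push_cast [Prod.snd_add]
    field_simp
    ring
  rw [e3, e_add _ ((_ : ℤ) : ℝ), e_int, mul_one]

lemma summable_act (f : SchwartzModule θ c d) (a : A θ) (α : ZMod c.natAbs) (k l : ℕ) :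
    Summable fun n => SchwartzMap.seminorm ℂ k l (a.coeff n • actMono n f α) := by
  choose C hC N h using fun β => seminorm_shiftMul_le k l (f β)
  set R := 1 + |(d + c * θ) / c|
  have hR : 1 ≤ R := by simp [R]
  refine Summable.of_nonneg_of_le (fun _ => apply_nonneg _ _) (fun n => ?_)
    ((a.summable (∑ β, N β)).mul_left ((∑ β, C β) * R ^ (∑ β, N β)))
  have hw := one_le_weight n
  rw [map_smul_eq_mul]
  have h1 : 1 + |(n.2 : ℝ)| + |n.1 * ((d + c * θ) / c)| ≤ R * weight n := by
    rw [abs_mul]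
    unfold weight
    simp only [R]
    nlinarith [abs_nonneg (n.1 : ℝ), abs_nonneg (n.2 : ℝ), abs_nonneg ((d + c * θ) / c),
      mul_nonneg (abs_nonneg (n.2 : ℝ)) (abs_nonneg ((d + c * θ) / c))]
  set β := α - (n.1 : ZMod c.natAbs)
  have hN : N β ≤ ∑ β, N β := Finset.single_le_sum (fun _ _ => Nat.zero_le _) (Finset.mem_univ β)
  have hCs : C β ≤ ∑ β, C β := Finset.single_le_sum (fun i _ => hC i) (Finset.mem_univ β)
  have hC0 := hC β
  have hRw : 1 ≤ R * weight n := one_le_mul_of_one_le_of_one_le hR hw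
  calc ‖a.coeff n‖ * SchwartzMap.seminorm ℂ k l (actMono n f α)
      ≤ ‖a.coeff n‖ * (C β * (1 + |(n.2 : ℝ)| + |n.1 * ((d + c * θ) / c)|) ^ N β) := by
        gcongr; exact h β _ _ _
    _ ≤ ‖a.coeff n‖ * ((∑ β, C β) * (R * weight n) ^ (∑ β, N β)) := by
        have hS : 0 ≤ ∑ β, C β := hC0.trans hCs
        gcongr ?_ * (?_ * ?_)
        exact (pow_le_pow_left₀ (by positivity) h1 _).trans (pow_le_pow_right₀ hRw hN)
    _ = _ := by rw [mul_pow]; ring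

/-- The right action `f ↦ f·a = ∑ a(n₁,n₂) f U₁^n₁ U₂^n₂`. -/
def act (f : SchwartzModule θ c d) (a : A θ) : SchwartzModule θ c d := fun α =>
  schwartzSum (fun n => a.coeff n • actMono n f α) (summable_act f a α)

lemma act_apply (f : SchwartzModule θ c d) (a : A θ) (α : ZMod c.natAbs) (x : ℝ) :
    act f a α x = ∑' n, a.coeff n * actMono n f α x := rfl

lemma summable_act_apply (f : SchwartzModule θ c d) (a : A θ) (α : ZMod c.natAbs) (x : ℝ) :
    Summable fun n => a.coeff n * actMono n f α x := summable_apply (summable_act f a α) x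

lemma norm_actMono_le (f : SchwartzModule θ c d) (n : ℤ × ℤ) (α : ZMod c.natAbs) (x : ℝ) :
    ‖actMono n f α x‖ ≤ ∑ β, SchwartzMap.seminorm ℂ 0 0 (f β) := by
  rw [actMono_apply, norm_mul, norm_e, one_mul]
  exact (SchwartzMap.norm_le_seminorm ℂ _ _).trans (Finset.single_le_sum
    (f := fun β => SchwartzMap.seminorm ℂ 0 0 (f β))
    (fun _ _ => apply_nonneg _ _) (Finset.mem_univ (α - (n.1 : ZMod c.natAbs))))

lemma actMono_act (f : SchwartzModule θ c d) (a : A θ) (k : ℤ × ℤ) (α : ZMod c.natAbs) (x : ℝ) :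
    actMono k (act f a) α x = ∑' m, a.coeff m * (A.phase θ m k * actMono (m + k) f α x) := by
  rw [actMono_apply, act_apply, ← tsum_mul_left]
  refine tsum_congr fun m => ?_
  have h := congrArg (fun g : SchwartzModule θ c d => g α x) (actMono_actMono m k f)
  simp only [smul_apply] at h
  rw [← h, actMono_apply k]
  ring

lemma act_mul (f : SchwartzModule θ c d) (a b : A θ) : act f (a * b) = act (act f a) b := by
  ext α x
  rw [act_apply, A.tsum_mul_coeff_right a b (F := fun n => actMono n f α x)
    (norm_actMono_le f · α x), act_apply]
  exact tsum_congr fun k => by rw [actMono_act]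

instance : Module (A θ)ᵐᵒᵖ (SchwartzModule θ c d) where
  smul a f := act f a.unop
  one_smul f := by
    ext α x
    refine (A.tsum_single_left (θ := θ) fun n => actMono n f α x).trans ?_
    rw [actMono_zero]
  mul_smul a b f := act_mul f b.unop a.unop
  smul_zero a := by
    ext α x
    exact (tsum_congr fun n => by simp [actMono_apply]).trans tsum_zero
  smul_add a f g := by
    ext α x
    refine Eq.trans ?_ (Summable.tsum_add (summable_act_apply f a.unop α x)
      (summable_act_apply g a.unop α x))
    exact tsum_congr fun n => by simp [actMono_add, mul_add]
  add_smul a b f := by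
    ext α x
    refine Eq.trans ?_ (Summable.tsum_add (summable_act_apply f a.unop α x)
      (summable_act_apply f b.unop α x))
    exact tsum_congr fun n => by simp [add_mul]
  zero_smul f := by
    ext α x
    exact (tsum_congr fun n => by simp).trans tsum_zero

lemma op_smul_apply (f : SchwartzModule θ c d) (a : A θ) (α : ZMod c.natAbs) (x : ℝ) :
    (MulOpposite.op a • f) α x = ∑' n, a.coeff n * actMono n f α x := rfl

instance : IsScalarTower ℂ (A θ)ᵐᵒᵖ (SchwartzModule θ c d) := ⟨fun k a f => by
  ext α x
  refine Eq.trans ?_ (tsum_mul_left (a := k)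
    (f := fun n => a.unop.coeff n * actMono n f α x))
  exact tsum_congr fun n => by simp [mul_assoc]⟩

end

lemma affine_hasTemperateGrowth (p q : ℂ) :
    (fun x : ℝ => p * x + q).HasTemperateGrowth :=
  ((Function.HasTemperateGrowth.const p).mul Function.Complex.hasTemperateGrowth_ofReal).add
    (Function.HasTemperateGrowth.const q)

/-- The operator `∇_z f = ∂f/∂x + 2πi (τ μ x + z) f`, where `μ = c / (d + cθ)`. -/
def nabla (τ z : ℂ) : SchwartzModule θ c d →ₗ[ℂ] SchwartzModule θ c d where
  toFun f α := SchwartzMap.derivCLM ℂ ℂ (f α) + (2 * Real.pi * Complex.I : ℂ) •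
    SchwartzMap.smulLeftCLM ℂ (fun x : ℝ => τ * (c / (d + c * θ) : ℝ) * x + z) (f α)
  map_add' f g := by
    funext α
    show SchwartzMap.derivCLM ℂ ℂ (f α + g α) + _ • SchwartzMap.smulLeftCLM ℂ _ (f α + g α) = 
      (_ + _) + (_ + _)
    simp only [map_add, smul_add]
    abel
  map_smul' k f := by
    funext α
    show SchwartzMap.derivCLM ℂ ℂ (k • f α) + _ • SchwartzMap.smulLeftCLM ℂ _ (k • f α) = k • (_ + _)
    simp only [map_smul, smul_add, smul_comm k]

lemma nabla_apply (τ z : ℂ) (f : SchwartzModule θ c d) (α : ZMod c.natAbs) (x : ℝ) :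
    nabla τ z f α x = deriv (f α) x +
      2 * Real.pi * Complex.I * (τ * (c / (d + c * θ) : ℝ) * x + z) * f α x := by
  show deriv (f α) x + (2 * Real.pi * Complex.I : ℂ) * 
    SchwartzMap.smulLeftCLM ℂ (fun x : ℝ => τ * (c / (d + c * θ) : ℝ) * x + z) (f α) x = _
  rw [SchwartzMap.smulLeftCLM_apply_apply (affine_hasTemperateGrowth _ z), smul_eq_mul]
  ring

lemma nabla_actMono [NeZero c] (hr : (d + c * θ : ℝ) ≠ 0) (τ z : ℂ) (n : ℤ × ℤ)
    (f : SchwartzModule θ c d) (α : ZMod c.natAbs) (x : ℝ) :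
    nabla τ z (actMono n f) α x = actMono n (nabla τ z f) α x
      + 2 * Real.pi * Complex.I * (n.1 * τ + n.2) * actMono n f α x := by
  have hc : (c : ℝ) ≠ 0 := by exact_mod_cast NeZero.ne c
  rw [nabla_apply, actMono, deriv_shiftMul, actMono_apply, nabla_apply, shiftMul_apply,
    shiftMul_apply, SchwartzMap.derivCLM_apply]
  have h : ((c / (d + c * θ) : ℝ) : ℂ) * ((x - n.1 * ((d + c * θ) / c) : ℝ) : ℂ)
      = ((c / (d + c * θ) : ℝ) : ℂ) * x - n.1 := by
    rw [← Complex.ofReal_mul]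
    have : (c / (d + c * θ)) * (x - n.1 * ((d + c * θ) / c)) = (c / (d + c * θ)) * x - n.1 := by
      field_simp
    rw [this]; push_cast; ring
  rw [mul_assoc τ _ ((x - n.1 * ((d + c * θ) / c) : ℝ) : ℂ), h]
  ring

/-- The Leibniz rule. -/
lemma nabla_smul [NeZero c] (hr : (d + c * θ : ℝ) ≠ 0) (τ z : ℂ)
    (f : SchwartzModule θ c d) (a : A θ) :
    nabla τ z (MulOpposite.op a • f) =
      MulOpposite.op a • nabla τ z f + MulOpposite.op (A.delta τ a) • f := by
  ext α x
  rw [nabla_apply, add_apply, op_smul_apply, op_smul_apply, op_smul_apply, ← Summable.tsum_add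
    (summable_act_apply _ a α x) (summable_act_apply _ _ α x), ← tsum_mul_left]
  rw [show deriv ((MulOpposite.op a • f) α) x = ∑' n, deriv (a.coeff n • actMono n f α) x from
    deriv_schwartzSum _ (summable_act f a α) x]
  have hs : Summable fun n => deriv (a.coeff n • actMono n f α) x := by
    refine Summable.of_norm_bounded (summable_act f a α 0 1) fun n => ?_
    rw [← zero_add 1, ← seminorm_deriv]
    exact SchwartzMap.norm_le_seminorm ℂ
      (SchwartzMap.derivCLM ℂ ℂ (a.coeff n • actMono n f α)) x
  rw [← Summable.tsum_add hs ((summable_act_apply f a α x).mul_left _)]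
  refine tsum_congr fun n => ?_
  have h := nabla_actMono hr τ z n f α x
  rw [nabla_apply] at h
  have h' : deriv (a.coeff n • actMono n f α) x = a.coeff n * deriv (actMono n f α) x := by
    rw [← SchwartzMap.derivCLM_apply ℂ, map_smul]; rfl
  rw [h', A.coeff_delta]
  linear_combination a.coeff n * h

end SchwartzModule

/-! ### Holomorphic structures and the cohomology of the dg-category of holomorphic modules -/

/-- A right `A_θ`-module with a holomorphic structure compatible with `δ_τ`. -/
structure HolModule (θ : ℝ) (τ : ℂ) where
  carrier : Type
  [addCommGroup : AddCommGroup carrier]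
  [moduleComplex : Module ℂ carrier]
  [moduleRight : Module (A θ)ᵐᵒᵖ carrier]
  [isScalarTower : IsScalarTower ℂ (A θ)ᵐᵒᵖ carrier]
  nabla : carrier →ₗ[ℂ] carrier
  leibniz : ∀ (f : carrier) (a : A θ), nabla (MulOpposite.op a • f) =
    MulOpposite.op a • nabla f + MulOpposite.op (A.delta τ a) • f

namespace HolModule

attribute [instance] addCommGroup moduleComplex moduleRight isScalarTower

variable {τ : ℂ}

/-- The space `Hom_{A_θ}(E, E')`. -/
abbrev Mor (E E' : HolModule θ τ) : Type := E.carrier →ₗ[(A θ)ᵐᵒᵖ] E'.carrier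

/-- The differential `φ ↦ ∇' ∘ φ - φ ∘ ∇` of the two-term complex
`Hom_{A_θ}(E, E') → Hom_{A_θ}(E, E')`. -/
def d (E E' : HolModule θ τ) : Mor E E' →ₗ[ℂ] Mor E E' where
  toFun φ :=
    { toFun := fun f => E'.nabla (φ f) - φ (E.nabla f)
      map_add' := fun f g => by simp only [map_add]; abel
      map_smul' := fun a f => by
        have h1 := E.leibniz f a.unop
        have h2 := E'.leibniz (φ f) a.unop
        rw [MulOpposite.op_unop] at h1 h2
        rw [map_smul, h1, h2, map_add, map_smul, map_smul, RingHom.id_apply, smul_sub]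
        abel }
  map_add' φ ψ := by ext f; simp; abel
  map_smul' k φ := by ext f; simp [smul_sub]

lemma d_apply {E E' : HolModule θ τ} (φ : Mor E E') (f : E.carrier) :
    d E E' φ f = E'.nabla (φ f) - φ (E.nabla f) := rfl

/-- `H⁰` of the complex `Hom_{A_θ}(E, E') → Hom_{A_θ}(E, E')`: the holomorphic morphisms. -/
abbrev H0 (E E' : HolModule θ τ) : Submodule ℂ (Mor E E') := LinearMap.ker (d E E')

/-- `H¹` of the complex `Hom_{A_θ}(E, E') → Hom_{A_θ}(E, E')`. -/
abbrev H1 (E E' : HolModule θ τ) : Type := Mor E E' ⧸ LinearMap.range (d E E')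

lemma mem_H0 {E E' : HolModule θ τ} {φ : Mor E E'} :
    φ ∈ H0 E E' ↔ ∀ f, E'.nabla (φ f) = φ (E.nabla f) := by
  rw [LinearMap.mem_ker, LinearMap.ext_iff]
  exact forall_congr' fun f => by rw [d_apply]; exact sub_eq_zero

variable {E₁ E₂ E₃ E₄ : HolModule θ τ}

/-- The identity morphism in `H⁰`. -/
def id0 (E : HolModule θ τ) : H0 E E := ⟨LinearMap.id, mem_H0.mpr fun _ => rfl⟩

/-- The composition `H⁰ × H⁰ → H⁰`. -/
def comp0 (ψ : H0 E₂ E₃) (φ : H0 E₁ E₂) : H0 E₁ E₃ :=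
  ⟨ψ.1 ∘ₗ φ.1, mem_H0.mpr fun f => by
    simp [mem_H0.mp ψ.2, mem_H0.mp φ.2]⟩

/-- The composition `H⁰ × H¹ → H¹` induced by the composition of morphisms. -/
def postcomp (ψ : H0 E₂ E₃) : H1 E₁ E₂ →ₗ[ℂ] H1 E₁ E₃ :=
  Submodule.mapQ _ _
    { toFun := fun φ => ψ.1 ∘ₗ φ
      map_add' := fun φ φ' => by ext f; simp
      map_smul' := fun k φ => by ext f; simp } <| by
    rintro _ ⟨φ, rfl⟩
    refine ⟨ψ.1 ∘ₗ φ, ?_⟩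
    ext f
    simp [d_apply, mem_H0.mp ψ.2]

/-- The composition `H¹ × H⁰ → H¹` induced by the composition of morphisms. -/
def precomp (φ : H0 E₁ E₂) : H1 E₂ E₃ →ₗ[ℂ] H1 E₁ E₃ :=
  Submodule.mapQ _ _
    { toFun := fun ψ => ψ ∘ₗ φ.1
      map_add' := fun ψ ψ' => by ext f; simp
      map_smul' := fun k ψ => by ext f; simp } <| by
    rintro _ ⟨ψ, rfl⟩
    refine ⟨ψ ∘ₗ φ.1, ?_⟩
    ext f
    simp [d_apply, mem_H0.mp φ.2]

lemma postcomp_mk (ψ : H0 E₂ E₃) (φ : Mor E₁ E₂) :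
    postcomp ψ (Submodule.Quotient.mk φ) = Submodule.Quotient.mk (ψ.1 ∘ₗ φ) := rfl

lemma precomp_mk (φ : H0 E₁ E₂) (ψ : Mor E₂ E₃) :
    precomp φ (Submodule.Quotient.mk ψ) = Submodule.Quotient.mk (ψ ∘ₗ φ.1) := rfl

end HolModule

/-- An object `E[n]`, where `E` is a right `A_θ`-module with a holomorphic structure. -/
structure Shifted (θ : ℝ) (τ : ℂ) where
  obj : HolModule θ τ
  shift : ℤ

namespace Shifted

variable {τ : ℂ}

open HolModule

/-- The cohomology category: the morphisms from `E[n]` to `E'[n']` are the total cohomology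
`H⁰ ⊕ H¹` of the complex `(Hom_{A_θ}(E, E') → Hom_{A_θ}(E, E'))[n' - n]`. The products of two
classes in `H¹` vanish, since the complexes have two terms. -/
instance : Category (Shifted θ τ) where
  Hom X Y := H0 X.obj Y.obj × H1 X.obj Y.obj
  id X := (id0 X.obj, 0)
  comp f g := (comp0 g.1 f.1, postcomp g.1 f.2 + precomp f.1 g.2)
  id_comp f := by
    obtain ⟨f0, f1⟩ := f
    induction f1 using Submodule.Quotient.induction_on with
    | _ f1 => exact Prod.ext (Subtype.ext rfl) (by simp [precomp_mk]; rfl)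
  comp_id f := by
    obtain ⟨f0, f1⟩ := f
    induction f1 using Submodule.Quotient.induction_on with
    | _ f1 => exact Prod.ext (Subtype.ext rfl) (by simp [postcomp_mk]; rfl)
  assoc f g h := by
    obtain ⟨f0, f1⟩ := f
    obtain ⟨g0, g1⟩ := g
    obtain ⟨h0, h1⟩ := h
    induction f1 using Submodule.Quotient.induction_on with
    | _ f1 =>
    induction g1 using Submodule.Quotient.induction_on with
    | _ g1 =>
    induction h1 using Submodule.Quotient.induction_on with
    | _ h1 =>
    refine Prod.ext (Subtype.ext rfl) ?_
    simp only [postcomp_mk, precomp_mk, map_add, add_assoc]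
    rfl

lemma comp_def {X Y Z : Shifted θ τ} (f : X ⟶ Y) (g : Y ⟶ Z) :
    f ≫ g = (comp0 g.1 f.1, postcomp g.1 f.2 + precomp f.1 g.2) := rfl

lemma hom_induction {X Y : Shifted θ τ} {P : (X ⟶ Y) → Prop}
    (h : ∀ (f0 : H0 X.obj Y.obj) (f1 : Mor X.obj Y.obj), P (f0, Submodule.Quotient.mk f1))
    (f : X ⟶ Y) : P f := by
  obtain ⟨f0, f1⟩ := f
  induction f1 using Submodule.Quotient.induction_on with
  | _ f1 => exact h f0 f1

instance (X Y : Shifted θ τ) : AddCommGroup (X ⟶ Y) :=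
  inferInstanceAs (AddCommGroup (H0 X.obj Y.obj × H1 X.obj Y.obj))

instance (X Y : Shifted θ τ) : Module ℂ (X ⟶ Y) :=
  inferInstanceAs (Module ℂ (H0 X.obj Y.obj × H1 X.obj Y.obj))

instance : Preadditive (Shifted θ τ) where
  add_comp X Y Z f f' g := by
    induction f using hom_induction with | _ f0 f1 =>
    induction f' using hom_induction with | _ f0' f1' =>
    induction g using hom_induction with | _ g0 g1 =>
    refine Prod.ext (Subtype.ext ?_) (congrArg Submodule.Quotient.mk ?_)
    · exact LinearMap.comp_add _ _ _
    · show g0.1 ∘ₗ (f1 + f1') + g1 ∘ₗ (f0.1 + f0'.1) =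
        (g0.1 ∘ₗ f1 + g1 ∘ₗ f0.1) + (g0.1 ∘ₗ f1' + g1 ∘ₗ f0'.1)
      rw [LinearMap.comp_add, LinearMap.comp_add]; abel
  comp_add X Y Z f g g' := by
    induction f using hom_induction with | _ f0 f1 =>
    induction g using hom_induction with | _ g0 g1 =>
    induction g' using hom_induction with | _ g0' g1' =>
    refine Prod.ext (Subtype.ext ?_) (congrArg Submodule.Quotient.mk ?_)
    · exact LinearMap.add_comp _ _ _
    · show (g0.1 + g0'.1) ∘ₗ f1 + (g1 + g1') ∘ₗ f0.1 =
        (g0.1 ∘ₗ f1 + g1 ∘ₗ f0.1) + (g0'.1 ∘ₗ f1 + g1' ∘ₗ f0.1)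
      rw [LinearMap.add_comp, LinearMap.add_comp]; abel

instance : Linear ℂ (Shifted θ τ) where
  smul_comp X Y Z k f g := by
    induction f using hom_induction with | _ f0 f1 =>
    induction g using hom_induction with | _ g0 g1 =>
    refine Prod.ext (Subtype.ext ?_) (congrArg Submodule.Quotient.mk ?_)
    · ext x; show g0.1 (k • f0.1 x) = k • g0.1 (f0.1 x); exact LinearMap.map_smul_of_tower _ _ _
    · ext x
      show g0.1 (k • f1 x) + g1 (k • f0.1 x) = k • (g0.1 (f1 x) + g1 (f0.1 x))
      rw [LinearMap.map_smul_of_tower, LinearMap.map_smul_of_tower, smul_add]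
  comp_smul X Y Z f k g := by
    induction f using hom_induction with | _ f0 f1 =>
    induction g using hom_induction with | _ g0 g1 =>
    refine Prod.ext (Subtype.ext ?_) (congrArg Submodule.Quotient.mk ?_)
    · rfl
    · ext x
      show k • g0.1 (f1 x) + k • g1 (f0.1 x) = k • (g0.1 (f1 x) + g1 (f0.1 x))
      rw [smul_add]

end Shifted

/-! ### Graded linear categories -/

/-- A grading on a `ℂ`-linear category: each space of morphisms is the direct sum of its
homogeneous parts, identities have degree `0`, and degrees add under composition. -/
class GradedCategory (C : Type*) [Category C] [Preadditive C] [Linear ℂ C] where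
  deg : ∀ (X Y : C), ℤ → Submodule ℂ (X ⟶ Y)
  isInternal : ∀ X Y : C, DirectSum.IsInternal (deg X Y)
  id_mem : ∀ X : C, 𝟙 X ∈ deg X X 0
  comp_mem : ∀ {X Y Z : C} {i j : ℤ} {f : X ⟶ Y} {g : Y ⟶ Z},
    f ∈ deg X Y i → g ∈ deg Y Z j → f ≫ g ∈ deg X Z (i + j)

namespace Shifted

variable {τ : ℂ}

open HolModule

/-- The morphisms of degree `k` from `E[n]` to `E'[n']`: the complex
`(Hom_{A_θ}(E, E') → Hom_{A_θ}(E, E'))[n' - n]` sits in degrees `n - n'` and `n - n' + 1`. -/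
def degree (X Y : Shifted θ τ) (k : ℤ) : Submodule ℂ (X ⟶ Y) where
  carrier := {f | (k ≠ X.shift - Y.shift → f.1 = 0) ∧ (k ≠ X.shift - Y.shift + 1 → f.2 = 0)}
  zero_mem' := ⟨fun _ => rfl, fun _ => rfl⟩
  add_mem' := fun hf hg =>
    ⟨fun h => (congrArg₂ (· + ·) (hf.1 h) (hg.1 h)).trans (add_zero _),
     fun h => (congrArg₂ (· + ·) (hf.2 h) (hg.2 h)).trans (add_zero _)⟩
  smul_mem' := fun c _ hf =>
    ⟨fun h => (congrArg (c • ·) (hf.1 h)).trans (smul_zero _),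
     fun h => (congrArg (c • ·) (hf.2 h)).trans (smul_zero _)⟩

lemma mem_degree {X Y : Shifted θ τ} {k : ℤ} {f : X ⟶ Y} : f ∈ degree X Y k ↔
    (k ≠ X.shift - Y.shift → f.1 = 0) ∧ (k ≠ X.shift - Y.shift + 1 → f.2 = 0) := Iff.rfl

lemma degree_isInternal (X Y : Shifted θ τ) : DirectSum.IsInternal (degree X Y) := by
  rw [DirectSum.isInternal_submodule_iff_iSupIndep_and_iSup_eq_top]
  constructor
  · intro i
    let K : Submodule ℂ (X ⟶ Y) :=
      { carrier := {f | (i = X.shift - Y.shift → f.1 = 0) ∧ (i = X.shift - Y.shift + 1 → f.2 = 0)}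
        zero_mem' := ⟨fun _ => rfl, fun _ => rfl⟩
        add_mem' := fun hf hg =>
          ⟨fun h => (congrArg₂ (· + ·) (hf.1 h) (hg.1 h)).trans (add_zero _),
           fun h => (congrArg₂ (· + ·) (hf.2 h) (hg.2 h)).trans (add_zero _)⟩
        smul_mem' := fun c _ hf =>
          ⟨fun h => (congrArg (c • ·) (hf.1 h)).trans (smul_zero _),
           fun h => (congrArg (c • ·) (hf.2 h)).trans (smul_zero _)⟩ }
    have hK : (⨆ j, ⨆ _ : j ≠ i, degree X Y j) ≤ K := by
      refine iSup₂_le fun j hj f hf => ⟨fun h => hf.1 ?_, fun h => hf.2 ?_⟩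
      · rw [← h]; exact hj
      · rw [← h]; exact hj
    refine Disjoint.mono_right hK ?_
    rw [Submodule.disjoint_def]
    intro f hf hf'
    refine Prod.ext ?_ ?_
    · by_cases h : i = X.shift - Y.shift
      · exact hf'.1 h
      · exact hf.1 h
    · by_cases h : i = X.shift - Y.shift + 1
      · exact hf'.2 h
      · exact hf.2 h
  · rw [eq_top_iff]
    intro f _
    have h0 : ((f.1, 0) : H0 X.obj Y.obj × H1 X.obj Y.obj) ∈ degree X Y (X.shift - Y.shift) :=
      ⟨fun h => absurd rfl h, fun _ => rfl⟩
    have h1 : ((0, f.2) : H0 X.obj Y.obj × H1 X.obj Y.obj) ∈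
        degree X Y (X.shift - Y.shift + 1) :=
      ⟨fun _ => rfl, fun h => absurd rfl h⟩
    have h := add_mem (Submodule.mem_iSup_of_mem (p := degree X Y) _ h0)
      (Submodule.mem_iSup_of_mem (p := degree X Y) _ h1)
    have e : ((f.1, 0) + (0, f.2) : H0 X.obj Y.obj × H1 X.obj Y.obj) = f :=
      Prod.ext (add_zero _) (zero_add _)
    rw [← e]
    exact h

instance : GradedCategory (Shifted θ τ) where
  deg := degree
  isInternal := degree_isInternal
  id_mem X := ⟨fun h => absurd (sub_self _).symm h, fun _ => rfl⟩
  comp_mem {X Y Z i j f g} hf hg := by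
    rw [mem_degree] at hf hg ⊢
    rw [comp_def]
    constructor
    · intro h
      by_cases hi : i = X.shift - Y.shift
      · have hj : g.1 = 0 := hg.1 (by omega)
        rw [hj]; rfl
      · rw [hf.1 hi]
        exact Subtype.ext (LinearMap.comp_zero _)
    · intro h
      have h1 : postcomp (E₁ := X.obj) g.1 f.2 = 0 := by
        by_cases hi : i = X.shift - Y.shift + 1
        · have hj : g.1 = 0 := hg.1 (by omega)
          rw [hj]
          induction f.2 using Submodule.Quotient.induction_on with
          | _ f1 => rfl
        · rw [hf.2 hi, map_zero]
      have h2 : precomp (E₃ := Z.obj) f.1 g.2 = 0 := by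
        by_cases hj : j = Y.shift - Z.shift + 1
        · have hi : f.1 = 0 := hf.1 (by omega)
          rw [hi]
          induction g.2 using Submodule.Quotient.induction_on with
          | _ g1 => exact congrArg Submodule.Quotient.mk (LinearMap.comp_zero _)
        · rw [hg.2 hj, map_zero]
      show postcomp g.1 f.2 + precomp f.1 g.2 = 0
      rw [h1, h2, add_zero]

end Shifted

/-- Full subcategories (and, more generally, induced categories) of a graded category are
graded. -/
instance inducedGraded {B C : Type*} [Category C] [Preadditive C] [Linear ℂ C] [GradedCategory C]
    (F : B → C) : GradedCategory (InducedCategory C F) where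
  deg X Y k := (GradedCategory.deg (F X) (F Y) k).comap
    ({ toFun := fun f => f.hom
       map_add' := fun _ _ => rfl
       map_smul' := fun _ _ => rfl } : (X ⟶ Y) →ₗ[ℂ] (F X ⟶ F Y))
  isInternal X Y := by
    let L : (X ⟶ Y) ≃ₗ[ℂ] (F X ⟶ F Y) :=
      { toFun := fun f => f.hom
        map_add' := fun _ _ => rfl
        map_smul' := fun _ _ => rfl
        invFun := fun f => InducedCategory.homMk f
        left_inv := fun _ => rfl
        right_inv := fun _ => rfl }
    have h := GradedCategory.isInternal (F X) (F Y)
    rw [DirectSum.isInternal_submodule_iff_iSupIndep_and_iSup_eq_top] at h ⊢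
    let φ := (Submodule.orderIsoMapComap L).symm
    refine ⟨h.1.map_orderIso φ, ?_⟩
    exact (φ.map_iSup _).symm.trans ((congrArg φ h.2).trans φ.map_top)
  id_mem X := GradedCategory.id_mem (F X)
  comp_mem hf hg := GradedCategory.comp_mem (C := C) hf hg

/-- An equivalence of graded `ℂ`-linear categories: an equivalence of categories whose functors
are linear and preserve degrees and whose unit and counit are of degree `0`. -/
structure GradedEquivalence (C D : Type*) [Category C] [Preadditive C] [Linear ℂ C]
    [GradedCategory C] [Category D] [Preadditive D] [Linear ℂ D] [GradedCategory D]
    extends C ≌ D where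
  functor_additive : functor.Additive
  functor_linear : functor.Linear ℂ
  inverse_additive : inverse.Additive
  inverse_linear : inverse.Linear ℂ
  functor_map_mem : ∀ {X Y : C} {k : ℤ} {f : X ⟶ Y}, f ∈ GradedCategory.deg X Y k →
    functor.map f ∈ GradedCategory.deg (functor.obj X) (functor.obj Y) k
  inverse_map_mem : ∀ {X Y : D} {k : ℤ} {f : X ⟶ Y}, f ∈ GradedCategory.deg X Y k →
    inverse.map f ∈ GradedCategory.deg (inverse.obj X) (inverse.obj Y) k
  unit_mem : ∀ X : C, unitIso.hom.app X ∈ GradedCategory.deg _ _ 0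
  unitInv_mem : ∀ X : C, unitIso.inv.app X ∈ GradedCategory.deg _ _ 0
  counit_mem : ∀ X : D, counitIso.hom.app X ∈ GradedCategory.deg _ _ 0
  counitInv_mem : ∀ X : D, counitIso.inv.app X ∈ GradedCategory.deg _ _ 0

/-! ### Standard holomorphic bundles -/

open Matrix in
/-- `rk(g, θ) = cθ + d`, where `(c, d)` is the second row of `g`. -/
def rk (g : SpecialLinearGroup (Fin 2) ℤ) (θ : ℝ) : ℝ := g.1 1 0 * θ + g.1 1 1

open Matrix in
lemma rk_neg (g : SpecialLinearGroup (Fin 2) ℤ) (θ : ℝ) : rk (-g) θ = -rk g θ := by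
  simp [rk]; ring

/-- The trivial module `A_θ` with the holomorphic structure `∇_z(a) = 2πi z a + δ_τ(a)`. -/
def trivialBundle (θ : ℝ) (τ z : ℂ) : HolModule θ τ where
  carrier := A θ
  nabla := (2 * Real.pi * Complex.I * z : ℂ) • LinearMap.id + A.delta τ
  leibniz f a := by
    simp only [LinearMap.add_apply, LinearMap.smul_apply, LinearMap.id_apply,
      MulOpposite.smul_eq_mul_unop, MulOpposite.unop_op, A.delta_mul, add_mul, smul_mul_assoc]
    abel

/-- The module `E_{d,c}(θ)` for `c ≠ 0`, `d + cθ ≠ 0`, with the holomorphic structure `∇_z`. -/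
def schwartzBundle (θ : ℝ) (τ : ℂ) (c d : ℤ) (hc : c ≠ 0) (hr : (d + c * θ : ℝ) ≠ 0) (z : ℂ) :
    HolModule θ τ :=
  haveI : NeZero c := ⟨hc⟩
  { carrier := SchwartzModule θ c d
    nabla := SchwartzModule.nabla τ z
    leibniz := SchwartzModule.nabla_smul hr τ z }

open Matrix in
/-- The standard holomorphic bundle `E_g^z(θ)`: the basic module `E_g(θ) = E_{d,c}(θ)`, where
`(c, d)` is the second row of `g`, with the holomorphic structure `∇_z`. If `c = 0`, then
`d = ±1` and `E_{d,0}(θ) = A_θ`. -/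
def standardBundle (θ : ℝ) (τ : ℂ) (g : SpecialLinearGroup (Fin 2) ℤ) (hg : rk g θ ≠ 0) (z : ℂ) :
    HolModule θ τ :=
  if hc : g.1 1 0 = 0 then trivialBundle θ τ z
  else schwartzBundle θ τ (g.1 1 0) (g.1 1 1) hc (by rw [add_comm]; exact hg) z

open Matrix in
/-- The objects `E_g^z(θ)[n]` of `C^{st}(θ, τ)`, where `rk(g, θ) > 0`. -/
@[ext] structure StandardObject (θ : ℝ) where
  g : SpecialLinearGroup (Fin 2) ℤ
  z : ℂ
  n : ℤ
  rk_pos : 0 < rk g θ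

/-- The object `E_g^z(θ)[n]` in the category of all holomorphic modules and their shifts. -/
def StandardObject.toShifted (τ : ℂ) (X : StandardObject θ) : Shifted θ τ :=
  ⟨standardBundle θ τ X.g X.rk_pos.ne' X.z, X.n⟩

/-- The graded cohomology category `H^*C^{st}(θ, τ)`. -/
abbrev HCst (θ : ℝ) (τ : ℂ) : Type :=
  InducedCategory (Shifted θ τ) (StandardObject.toShifted (θ := θ) τ)

/-- The objects `E_g^z(θ)[n]` of `H^*C^{st}(θ, τ)` with `rk(g, θ') ≠ 0`. -/
def rkNeZero (θ : ℝ) (τ : ℂ) (θ' : ℝ) : ObjectProperty (HCst θ τ) :=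
  fun X : StandardObject θ => rk X.g θ' ≠ 0

instance {C : Type*} [Category C] [Preadditive C] [Linear ℂ C] [GradedCategory C]
    (P : ObjectProperty C) : GradedCategory P.FullSubcategory :=
  inferInstanceAs (GradedCategory (InducedCategory C ObjectProperty.FullSubcategory.obj))

/-- The graded category `H^*C^{st}(θ, τ)_{θ'}`. -/
abbrev HCstSub (θ : ℝ) (τ : ℂ) (θ' : ℝ) : Type := (rkNeZero θ τ θ').FullSubcategory

/-- The object `E_g^z(θ)[n]` of `H^*C^{st}(θ, τ)_{θ'}`. -/
def HCstSub.mk {θ : ℝ} {τ : ℂ} {θ' : ℝ} (X : StandardObject θ) (h : rk X.g θ' ≠ 0) :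
    HCstSub θ τ θ' := ⟨X, h⟩

/-- The rule on objects: with `λ(g) = rk(g, θ) / rk(g, θ')`, the object `E_g^z(θ)[n]` is sent to
`E_g^{λ(g)z}(θ')[n]` if `rk(g, θ') > 0`; if `rk(g, θ') < 0` it is sent to
`E_{-g}^{λ(g)z}(θ')[n - 1]` when `θ < θ'` and to `E_{-g}^{λ(g)z}(θ')[n + 1]` when `θ' < θ`. -/
def transfer (θ : ℝ) (τ : ℂ) (θ' : ℝ) (X : HCstSub θ τ θ') : HCstSub θ' τ θ :=
  let Y : StandardObject θ := X.obj
  let w : ℂ := (rk Y.g θ / rk Y.g θ' : ℝ) * Y.z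
  if h : 0 < rk Y.g θ' then HCstSub.mk ⟨Y.g, w, Y.n, h⟩ Y.rk_pos.ne'
  else HCstSub.mk ⟨-Y.g, w, if θ < θ' then Y.n - 1 else Y.n + 1, by
      have h' : rk Y.g θ' ≠ 0 := X.property
      rw [rk_neg]
      exact neg_pos.mpr (lt_of_le_of_ne (not_lt.mp h) h')⟩
    (by rw [rk_neg]; exact neg_ne_zero.mpr Y.rk_pos.ne')

end NCTorus

end

/-!
The proof describes the graded category attached to `θ` by coordinates in which `θ` does not occur.

**Kernels.** A matrix `g` with `rk(g, θ) > 0` is a `Frame`, with rows `p`, `v` and rank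
`r = ⟨v⟩ = cθ + d`. For two frames, `Kernel P Q` is the space of Schwartz functions on the quotient
of `ℝ × ℤ²` by `(u, ℓ) ↦ (u, ℓ + v_P)` and `(u, ℓ) ↦ (u - r_Q, ℓ + v_Q)`; they compose by
convolution. If `O` is the frame of `g = 1`, then `Kernel O O` is the algebra `A_θ` (Fourier series,
`equivA`), and `Kernel O P` is the standard bundle of `P` for both cases of its definition
(`exists_model`), with the algebra acting by composition. A partition of unity writes the identity
of `P` as a finite sum of kernels through `O` (`exists_partition`), that is, the bundle is a
projective module; consequently the `A_θ`-linear maps between the bundles of `P` and `Q` are exactly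
the kernels in `Kernel P Q` (`Model.morEquiv`). The differential of the morphism complex becomes the
ordinary differential operator `D = ∂/∂u + 2πi (τx + z' - z)`, where `x` is a coordinate which is
affine in `u` with the slope difference `μ = m_Q - m_P` as its coefficient.

**Cohomology.** The sign of `μ` is that of the determinant `P.dt Q.v` of `v_P` and `v_Q`.
* If `μ > 0`, the Gaussian solution of `D f = 0` decays since `Im τ < 0`. The kernel of `D` consists
  of its multiples by functions on the finite group `ℤ² / (ℤ v_P + ℤ v_Q)`, and `D` is surjective
  (`D_surjective`).
* If `μ < 0`, the Gaussian grows, `D` is injective, and its cokernel is identified with the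
  functions on the same group by integration against the inverse of the Gaussian (`period`).
* If `μ = 0`, the complex is a direct sum of complexes on circles with a monodromy. Those with
  nontrivial monodromy are acyclic, uniformly so; for equal parameters exactly one circle remains,
  and `H⁰` and `H¹` are one-dimensional (`eq_smul_id`, `trace`).

Parameters which differ by an element of `r⁻¹(ℤτ + ℤ)` give isomorphic bundles
(`Model.translate`), so that each bundle can be modelled with its parameter in a normal form. Then
bundles of the same slope have equal parameters or no morphisms at all (`StandardObject.separated`).

**Structure constants.** A morphism thus has coordinates in `Val`: a function on `ℤ²` with periods
`v_P` and `v_Q`, or a pair of scalars. The composite is computed from the `Datum` `(p, v, w = r z)`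
of each bundle (`coord_comp`): a product of Gaussians is again a Gaussian up to a constant
(`gauss_mul_gauss`), which gives a theta series, and for opposite slopes the trace unfolds to a
finite pairing (`trace_comp_left`). The resulting formula `Datum.mulVal` depends only on the data,
is the same for products in `H⁰ ⊗ H⁰`, `H⁰ ⊗ H¹` and `H¹ ⊗ H⁰`, and does not change if one of the
data is replaced by its negative.

**Change of `θ`.** The transfer from `θ` to `θ'` keeps the datum or changes its sign
(`datum_transfer`), the factor `λ(g)` being what keeps `w = r z` up to sign. Hence coordinates and
composition are the same for both categories. If the signs of `rk` at `θ'` differ for two bundles,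
then the sign of their determinant changes and `H⁰` is exchanged with `H¹`. Since
`rk(h, θ') rk(g, θ) - rk(h, θ) rk(g, θ') = (θ' - θ) det` (`rk_mul_sub`), the original sign of the
determinant is then known from the order of `θ` and `θ'`, and the shift in the transfer restores
the degree (`hasDegree_transfer`). Two graded categories with the same coordinates are equivalent
(`Coordinates.exists_gradedEquivalence`).
-/

noncomputable section

namespace NCTorus

section

/-! ### Frames of `ℤ²` -/

/-- A matrix `g ∈ SL₂(ℤ)` with `rk(g, θ) > 0`. Its second row `(c, d)` is the primitive vector that
labels a basic module, its first row `(a, b)` completes it to a basis of `ℤ²`. -/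
@[ext] structure Frame (θ : ℝ) where
  g : Matrix.SpecialLinearGroup (Fin 2) ℤ
  pos : 0 < rk g θ

/-- The pairing `⟨ℓ⟩ = ℓ₁ θ + ℓ₂` of a lattice vector with `(θ, 1)`. -/
def proj (θ : ℝ) (l : ℤ × ℤ) : ℝ := l.1 * θ + l.2

lemma proj_add (θ : ℝ) (l m : ℤ × ℤ) : proj θ (l + m) = proj θ l + proj θ m := by
  simp [proj]; ring

lemma proj_sub (θ : ℝ) (l m : ℤ × ℤ) : proj θ (l - m) = proj θ l - proj θ m := by
  simp [proj]; ring

lemma proj_smul (θ : ℝ) (t : ℤ) (l : ℤ × ℤ) : proj θ (t • l) = t * proj θ l := by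
  simp [proj]; ring

namespace Frame

variable {θ : ℝ} (P Q R S : Frame θ)

/-- The upper left entry of `g`. -/
def a : ℤ := P.g.1 0 0

/-- The upper right entry of `g`. -/
def b : ℤ := P.g.1 0 1

/-- The lower left entry of `g`. -/
def c : ℤ := P.g.1 1 0

/-- The lower right entry of `g`. -/
def d : ℤ := P.g.1 1 1

lemma det_eq : P.a * P.d - P.b * P.c = 1 := by
  have h := P.g.2
  rw [Matrix.det_fin_two] at h
  exact h

/-- The second row `(c, d)`. -/
def v : ℤ × ℤ := (P.c, P.d)

/-- The first row `(a, b)`. -/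
def p : ℤ × ℤ := (P.a, P.b)

/-- The rank `⟨v⟩ = cθ + d`. -/
def r : ℝ := proj θ P.v

/-- The slope `c / (cθ + d)`. -/
def m : ℝ := P.c / P.r

/-- The determinant of `(ℓ, v)`, a coordinate on `ℤ² / ℤv`. -/
def dt (l : ℤ × ℤ) : ℤ := l.1 * P.d - l.2 * P.c

lemma r_pos : 0 < P.r := by
  have h := P.pos
  simpa [r, rk, proj, v, c, d] using h

lemma r_ne : P.r ≠ 0 := P.r_pos.ne'

lemma r_def : P.r = P.c * θ + P.d := rfl

lemma dt_add (l l' : ℤ × ℤ) : P.dt (l + l') = P.dt l + P.dt l' := by simp [dt]; ring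
lemma dt_sub (l l' : ℤ × ℤ) : P.dt (l - l') = P.dt l - P.dt l' := by simp [dt]; ring
lemma dt_smul (t : ℤ) (l : ℤ × ℤ) : P.dt (t • l) = t * P.dt l := by simp [dt]; ring
@[simp] lemma dt_v : P.dt P.v = 0 := by simp [dt, v]; ring
@[simp] lemma dt_p : P.dt P.p = 1 := by simp [dt, p, P.det_eq]
@[simp] lemma dt_zero : P.dt 0 = 0 := by simp [dt]

/-- Every lattice vector is congruent to a multiple of `p` modulo `v`. -/
lemma exists_eq (l : ℤ × ℤ) : ∃ s : ℤ, l = P.dt l • P.p + s • P.v := by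
  refine ⟨P.a * l.2 - P.b * l.1, ?_⟩
  have h := P.det_eq
  ext
  · simp [dt, p, v]; linear_combination (-l.1) * h
  · simp [dt, p, v]; linear_combination (-l.2) * h

/-- The coordinate on the source of kernels in which they decay rapidly. It adds up under
composition. -/
def x (u : ℝ) (l : ℤ × ℤ) : ℝ := Q.m * u - P.m * (u + proj θ l) + l.1

lemma x_add (u : ℝ) (l l' : ℤ × ℤ) :
    x P R u l = x P Q (u + proj θ l') (l - l') + x Q R u l' := by
  simp only [x, proj_sub, Prod.fst_sub, Int.cast_sub]; ring

lemma x_eq (u : ℝ) (l : ℤ × ℤ) : x P Q u l = P.dt l / P.r + (Q.m - P.m) * u := by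
  have h : (P.dt l : ℝ) = P.r * l.1 - P.c * proj θ l := by
    simp [dt, r_def, proj]; ring
  rw [h, x, m, m]
  field_simp [P.r_ne, Q.r_ne]
  ring

lemma x_add_left (u : ℝ) (l : ℤ × ℤ) : x P Q u (l + P.v) = x P Q u l := by
  rw [x_eq, x_eq, dt_add, dt_v, add_zero]

lemma slope_sub : Q.m - P.m = P.dt Q.v / (P.r * Q.r) := by
  have h1 := P.r_ne
  have h2 := Q.r_ne
  rw [m, m, div_sub_div _ _ h2 h1, div_eq_div_iff (mul_ne_zero h2 h1) (mul_ne_zero h1 h2)]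
  simp [dt, v, r_def]; ring

lemma x_add_right (u : ℝ) (l : ℤ × ℤ) : x P Q (u - Q.r) (l + Q.v) = x P Q u l := by
  rw [x_eq, x_eq, dt_add, slope_sub]
  have h1 := P.r_ne
  have h2 := Q.r_ne
  push_cast
  field_simp
  ring

lemma dt_v_symm : Q.dt P.v = -P.dt Q.v := by simp [dt, v]; ring

lemma x_smul_p (u : ℝ) (t : ℤ) : x P Q u (t • P.p) = t / P.r + (Q.m - P.m) * u := by
  rw [x_eq, dt_smul, dt_p, mul_one]

lemma hasDerivAt_x (l : ℤ × ℤ) (u : ℝ) :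
    HasDerivAt (fun s => x P Q s l) (Q.m - P.m) u := by
  have h : (fun s => x P Q s l) = fun s => P.dt l / P.r + (Q.m - P.m) * s := by
    ext s; rw [x_eq]
  rw [h]
  simpa using ((hasDerivAt_id u).const_mul (Q.m - P.m)).const_add (P.dt l / P.r : ℝ)

/-- A sum over `ℤ² / ℤv` does not depend on the choice of the transversal. -/
lemma tsum_transversal {Θ : ℤ × ℤ → ℂ} (h : ∀ l, Θ (l + P.v) = Θ l) (l : ℤ × ℤ) :
    ∑' t : ℤ, Θ (t • P.p + l) = ∑' t : ℤ, Θ (t • P.p) := by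
  have h' : ∀ (s : ℤ) l, Θ (l + s • P.v) = Θ l := by
    intro s
    induction s with
    | zero => simp
    | succ n ih => intro l; rw [add_smul, one_smul, ← add_assoc, h, ih]
    | pred n ih =>
      intro l
      rw [← h, sub_smul, one_smul, add_assoc, sub_add_cancel, ih]
  obtain ⟨s, hs⟩ := P.exists_eq l
  rw [← (Equiv.addRight (P.dt l)).tsum_eq (fun t : ℤ => Θ (t • P.p))]
  refine tsum_congr fun t => ?_
  simp only [Equiv.coe_addRight]
  conv_lhs => rw [hs, ← add_assoc, ← add_smul]
  exact h' _ _

end Frame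

/-! ### Rapidly decreasing smooth functions on `ℝ × ℤ²` -/

section Schwartz

variable {x : ℝ → ℤ × ℤ → ℝ} {f g : ℝ → ℤ × ℤ → ℂ}

/-- Rapid decrease in the direction of `x`. -/
def Rapid (x : ℝ → ℤ × ℤ → ℝ) (f : ℝ → ℤ × ℤ → ℂ) : Prop :=
  ∀ j : ℕ, ∃ C : ℝ, ∀ u l, (1 + |x u l|) ^ j * ‖f u l‖ ≤ C

lemma Rapid.add (hf : Rapid x f) (hg : Rapid x g) : Rapid x (f + g) := fun j => by
  obtain ⟨C, hC⟩ := hf j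
  obtain ⟨D, hD⟩ := hg j
  refine ⟨C + D, fun u l => ?_⟩
  calc _ ≤ (1 + |x u l|) ^ j * (‖f u l‖ + ‖g u l‖) := by gcongr; exact norm_add_le _ _
    _ ≤ C + D := by rw [mul_add]; exact add_le_add (hC u l) (hD u l)

lemma Rapid.of_le (hf : Rapid x f) (K : ℝ) (h : ∀ u l, ‖g u l‖ ≤ K * ‖f u l‖) : Rapid x g :=
  fun j => by
    obtain ⟨C, hC⟩ := hf j
    refine ⟨|K| * C, fun u l => ?_⟩
    calc _ ≤ (1 + |x u l|) ^ j * (|K| * ‖f u l‖) := by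
          gcongr; exact (h u l).trans (by gcongr; exact le_abs_self K)
      _ = |K| * ((1 + |x u l|) ^ j * ‖f u l‖) := by ring
      _ ≤ _ := by gcongr; exact hC u l

lemma Rapid.mul_x (hf : Rapid x f) : Rapid x (fun u l => x u l * f u l) := fun j => by
  obtain ⟨C, hC⟩ := hf (j + 1)
  refine ⟨C, fun u l => le_trans ?_ (hC u l)⟩
  rw [norm_mul, Complex.norm_real, Real.norm_eq_abs, pow_succ, mul_assoc]
  gcongr
  linarith [abs_nonneg (x u l)]

/-- The constants of rapid decrease can be taken positive. -/
lemma Rapid.bound (hf : Rapid x f) (j : ℕ) :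
    ∃ C : ℝ, 0 < C ∧ ∀ u l, ‖f u l‖ ≤ C * ((1 + |x u l|) ^ j)⁻¹ := by
  obtain ⟨C, hC⟩ := hf j
  refine ⟨|C| + 1, by positivity, fun u l => ?_⟩
  rw [← div_eq_mul_inv, le_div_iff₀ (by positivity), mul_comm]
  exact (hC u l).trans (by linarith [le_abs_self C])

/-- Functions smooth in the real variable which are rapidly decreasing with all derivatives. The
definition is coinductive: the function belongs to a class of rapidly decreasing functions which
is stable under differentiation. -/
def IsSchwartz (x : ℝ → ℤ × ℤ → ℝ) (f : ℝ → ℤ × ℤ → ℂ) : Prop :=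
  ∃ 𝓒 : Set (ℝ → ℤ × ℤ → ℂ), f ∈ 𝓒 ∧ ∀ g ∈ 𝓒, Rapid x g ∧
    ∃ g' ∈ 𝓒, ∀ u l, HasDerivAt (fun s => g s l) (g' u l) u

/-- The derivative in the real variable. -/
def dd (f : ℝ → ℤ × ℤ → ℂ) : ℝ → ℤ × ℤ → ℂ := fun u l => deriv (fun s => f s l) u

namespace IsSchwartz

lemma rapid (hf : IsSchwartz x f) : Rapid x f := by
  obtain ⟨C, h1, h2⟩ := hf
  exact (h2 f h1).1

lemma exists_deriv (hf : IsSchwartz x f) :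
    ∃ f', IsSchwartz x f' ∧ ∀ u l, HasDerivAt (fun s => f s l) (f' u l) u := by
  obtain ⟨C, h1, h2⟩ := hf
  obtain ⟨f', h3, h4⟩ := (h2 f h1).2
  exact ⟨f', ⟨C, h3, h2⟩, h4⟩

lemma hasDerivAt (hf : IsSchwartz x f) (u : ℝ) (l : ℤ × ℤ) :
    HasDerivAt (fun s => f s l) (dd f u l) u := by
  obtain ⟨f', -, h⟩ := hf.exists_deriv
  exact (h u l).differentiableAt.hasDerivAt

lemma dd (hf : IsSchwartz x f) : IsSchwartz x (dd f) := by
  obtain ⟨f', h1, h⟩ := hf.exists_deriv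
  have : NCTorus.dd f = f' := by
    ext u l; exact (h u l).deriv
  rwa [this]

lemma continuous (hf : IsSchwartz x f) (l : ℤ × ℤ) : Continuous fun u => f u l :=
  continuous_iff_continuousAt.mpr fun u => (hf.hasDerivAt u l).continuousAt

lemma zero : IsSchwartz x 0 :=
  ⟨{0}, rfl, fun g hg => by
    rw [Set.mem_singleton_iff] at hg
    subst hg
    exact ⟨fun j => ⟨0, by simp⟩, 0, rfl, fun u l => hasDerivAt_const u 0⟩⟩

lemma add (hf : IsSchwartz x f) (hg : IsSchwartz x g) : IsSchwartz x (f + g) := by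
  refine ⟨{h | ∃ f g, IsSchwartz x f ∧ IsSchwartz x g ∧ h = f + g}, ⟨f, g, hf, hg, rfl⟩, ?_⟩
  rintro _ ⟨f, g, hf, hg, rfl⟩
  exact ⟨hf.rapid.add hg.rapid, _, ⟨_, _, hf.dd, hg.dd, rfl⟩,
    fun u l => (hf.hasDerivAt u l).add (hg.hasDerivAt u l)⟩

/-- Multiplication by a bounded function of the lattice variable. -/
lemma coeff_mul {a : ℤ × ℤ → ℂ} {K : ℝ} (ha : ∀ l, ‖a l‖ ≤ K) (hf : IsSchwartz x f) :
    IsSchwartz x (fun u l => a l * f u l) := by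
  refine ⟨{h | ∃ f, IsSchwartz x f ∧ h = fun u l => a l * f u l}, ⟨f, hf, rfl⟩, ?_⟩
  rintro _ ⟨f, hf, rfl⟩
  refine ⟨hf.rapid.of_le K fun u l => ?_, _, ⟨_, hf.dd, rfl⟩,
    fun u l => (hf.hasDerivAt u l).const_mul _⟩
  rw [norm_mul]
  gcongr
  exact ha l

lemma smul (k : ℂ) (hf : IsSchwartz x f) : IsSchwartz x (k • f) :=
  coeff_mul (a := fun _ => k) (K := ‖k‖) (fun _ => le_rfl) hf

lemma mul_x {μ : ℝ} (hx : ∀ u l, HasDerivAt (fun s => x s l) μ u) (hf : IsSchwartz x f) :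
    IsSchwartz x (fun u l => x u l * f u l) := by
  refine ⟨{h | ∃ f g, IsSchwartz x f ∧ IsSchwartz x g ∧ h = fun u l => x u l * f u l + g u l},
    ⟨f, 0, hf, zero, by ext; simp⟩, ?_⟩
  rintro _ ⟨f, g, hf, hg, rfl⟩
  refine ⟨hf.rapid.mul_x.add hg.rapid, _,
    ⟨NCTorus.dd f, fun u l => μ * f u l + NCTorus.dd g u l, hf.dd, (hf.smul μ).add hg.dd, rfl⟩,
    fun u l => ?_⟩
  refine (((hx u l).ofReal_comp.mul (hf.hasDerivAt u l)).add
    (hg.hasDerivAt u l)).congr_deriv ?_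
  simp
  ring

lemma poly_mul {μ : ℝ} (hx : ∀ u l, HasDerivAt (fun s => x s l) μ u) (p : Polynomial ℂ)
    (hf : IsSchwartz x f) : IsSchwartz x (fun u l => p.eval (x u l : ℂ) * f u l) := by
  induction p using Polynomial.induction_on generalizing f with
  | C k => simpa using! hf.smul k
  | add p q hp hq =>
    simp only [Polynomial.eval_add, add_mul]
    exact (hp hf).add (hq hf)
  | monomial n k ih =>
    have h := ih (hf.mul_x hx)
    convert h using 3
    simp [pow_succ, mul_assoc]

/-- A rapidly decreasing solution of a first order equation with affine coefficient and Schwartz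
right hand side is a Schwartz function. -/
lemma of_ode {μ : ℝ} (hx : ∀ u l, HasDerivAt (fun s => x s l) μ u) {σ : ℝ → ℤ × ℤ → ℂ}
    (hσ : Rapid x σ) (hf : IsSchwartz x f) (α β : ℂ)
    (h : ∀ u l, HasDerivAt (fun s => σ s l) (f u l - (α * x u l + β) * σ u l) u) :
    IsSchwartz x σ := by
  have rapid_poly : ∀ p : Polynomial ℂ, Rapid x (fun u l => p.eval (x u l : ℂ) * σ u l) := by
    intro p
    induction p using Polynomial.induction_on with
    | C k => exact hσ.of_le ‖k‖ fun u l => by simp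
    | add p q hp hq =>
      simp only [Polynomial.eval_add, add_mul]
      exact hp.add hq
    | monomial n k ih =>
      convert ih.mul_x using 3
      simp [pow_succ]; ring
  -- The functions `p(x) σ + g` with `p` a polynomial and `g` Schwartz decay rapidly, and the
  -- equation for `σ` shows that their derivatives are again of this form.
  refine ⟨{h | ∃ (p : Polynomial ℂ) (g : _), IsSchwartz x g ∧
    h = fun u l => p.eval (x u l : ℂ) * σ u l + g u l}, ⟨1, 0, zero, by ext; simp⟩, ?_⟩
  rintro _ ⟨p, g, hg, rfl⟩
  refine ⟨(rapid_poly p).add hg.rapid, _,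
    ⟨Polynomial.C (μ : ℂ) * p.derivative - p * (Polynomial.C α * Polynomial.X + Polynomial.C β),
      _, (hf.poly_mul hx p).add hg.dd, rfl⟩, fun u l => ?_⟩
  have hp : HasDerivAt (fun s => p.eval (x s l : ℂ)) (p.derivative.eval (x u l : ℂ) * μ) u :=
    HasDerivAt.comp (h := fun s => (x s l : ℂ)) (h₂ := fun z => p.eval z) u
      (p.hasDerivAt (x u l : ℂ)) (hx u l).ofReal_comp
  refine ((hp.mul (h u l)).add (hg.hasDerivAt u l)).congr_deriv ?_
  simp
  ring

end IsSchwartz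

end Schwartz

end

section

/-! ### Convolution -/

section Sums

lemma one_add_abs_le (s t : ℝ) : 1 + |s| ≤ (1 + |t|) * (1 + |s - t|) := by
  have h := abs_add_le t (s - t)
  rw [add_sub_cancel] at h
  nlinarith [mul_nonneg (abs_nonneg t) (abs_nonneg (s - t))]

lemma inv_sq_le (s t : ℝ) :
    ((1 + |s|) ^ 2)⁻¹ ≤ (1 + |s - t|) ^ 2 * ((1 + |t|) ^ 2)⁻¹ := by
  rw [← div_eq_mul_inv, inv_eq_one_div, div_le_div_iff₀ (by positivity) (by positivity), one_mul,
    ← mul_pow]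
  have h := one_add_abs_le t s
  rw [abs_sub_comm] at h
  gcongr
  rwa [mul_comm]

lemma summable_inv_sq : Summable fun n : ℤ => ((1 + |(n : ℝ)|) ^ 2)⁻¹ := by
  have h0 : Summable fun n : ℤ => 1 / (n : ℝ) ^ 2 :=
    Real.summable_one_div_int_pow.mpr one_lt_two
  refine Summable.of_norm_bounded_eventually h0 ?_
  filter_upwards [(Set.finite_singleton (0 : ℤ)).compl_mem_cofinite] with n hn
  have hn' : (n : ℝ) ≠ 0 := by simpa using hn
  have h : 0 < |(n : ℝ)| := abs_pos.mpr hn'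
  rw [Real.norm_of_nonneg (by positivity), one_div, ← sq_abs (n : ℝ)]
  gcongr
  linarith

/-- The sums of `(1 + |t/ρ + s|)⁻²` over `t ∈ ℤ` are bounded uniformly in `s`. -/
lemma exists_tsum_inv_sq_le {ρ : ℝ} (hρ : 0 < ρ) : ∃ B : ℝ, 0 < B ∧ ∀ s : ℝ,
    (Summable fun t : ℤ => ((1 + |t / ρ + s|) ^ 2)⁻¹) ∧
      ∑' t : ℤ, ((1 + |t / ρ + s|) ^ 2)⁻¹ ≤ B := by
  set B₀ := ∑' n : ℤ, ((1 + |(n : ℝ)|) ^ 2)⁻¹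
  have hB₀ : 0 ≤ B₀ := tsum_nonneg fun n => by positivity
  refine ⟨(2 + ρ) ^ 2 * B₀ + 1, by positivity, fun s => ?_⟩
  -- Up to a constant, `|t / ρ + s|` is the distance of `t` from the integer next to `-s ρ`.
  have key : ∀ t : ℤ, ((1 + |t / ρ + s|) ^ 2)⁻¹ ≤
      (2 + ρ) ^ 2 * ((1 + |((t + round (s * ρ) : ℤ) : ℝ)|) ^ 2)⁻¹ := by
    intro t
    rw [← div_eq_mul_inv, inv_eq_one_div, div_le_div_iff₀ (by positivity) (by positivity),
      one_mul, ← mul_pow]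
    have h1 : |((t + round (s * ρ) : ℤ) : ℝ)| ≤ ρ * |t / ρ + s| + 1 := by
      have h2 := abs_sub_round (s * ρ)
      have h3 : ((t + round (s * ρ) : ℤ) : ℝ) = ρ * (t / ρ + s) - (s * ρ - round (s * ρ)) := by
        push_cast; field_simp; ring
      rw [h3]
      refine (abs_sub _ _).trans ?_
      rw [abs_mul, abs_of_pos hρ]
      linarith
    gcongr
    nlinarith [abs_nonneg (t / ρ + s)]
  have hs : Summable fun t : ℤ =>
      (2 + ρ) ^ 2 * ((1 + |((t + round (s * ρ) : ℤ) : ℝ)|) ^ 2)⁻¹ :=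
    ((Equiv.addRight (round (s * ρ))).summable_iff.mpr summable_inv_sq).mul_left _
  have hs' := Summable.of_nonneg_of_le (fun t => by positivity) key hs
  refine ⟨hs', (hs'.tsum_le_tsum key hs).trans ?_⟩
  have h := (Equiv.addRight (round (s * ρ))).tsum_eq (fun n : ℤ => ((1 + |(n : ℝ)|) ^ 2)⁻¹)
  simp only [Equiv.coe_addRight] at h
  rw [tsum_mul_left, h]
  linarith

/-- A double series dominated by a summable sequence times series of uniformly bounded sum. -/
lemma summable_mul_of_tsum_le {a : ℤ → ℝ} {F : ℤ → ℤ → ℝ} {B : ℝ} (ha : ∀ s, 0 ≤ a s)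
    (hF : ∀ s t, 0 ≤ F s t) (ha' : Summable a) (hF' : ∀ s, Summable (F s))
    (hB : ∀ s, ∑' t, F s t ≤ B) : Summable fun p : ℤ × ℤ => a p.1 * F p.1 p.2 := by
  have h0 : (0 : ℤ × ℤ → ℝ) ≤ fun p => a p.1 * F p.1 p.2 := fun p => mul_nonneg (ha _) (hF _ _)
  have h1 : ∀ s, Summable fun t => a s * F s t := fun s => (hF' s).mul_left (a s)
  have h2 : Summable fun s => ∑' t, a s * F s t := by
    simp only [tsum_mul_left]
    exact Summable.of_nonneg_of_le (fun s => mul_nonneg (ha s) (tsum_nonneg (hF s)))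
      (fun s => mul_le_mul_of_nonneg_left (hB s) (ha s)) (ha'.mul_right B)
  exact (summable_prod_of_nonneg h0).mpr ⟨h1, h2⟩

end Sums

variable {θ : ℝ} {P Q R S : Frame θ}

open _root_.NCTorus.Frame

/-- The contribution of `m ∈ ℤ²` to the convolution `f * g`. -/
def convTerm (f g : ℝ → ℤ × ℤ → ℂ) (u : ℝ) (l m : ℤ × ℤ) : ℂ := f u m * g (u + proj θ m) (l - m)

/-- The convolution of kernels, a sum over `ℤ² / ℤv` where `v` is the vector of the intermediate
frame. -/
def conv (Q : Frame θ) (f g : ℝ → ℤ × ℤ → ℂ) (u : ℝ) (l : ℤ × ℤ) : ℂ :=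
  ∑' t : ℤ, convTerm (θ := θ) f g u l (t • Q.p)

section

variable {f f₁ g g₁ : ℝ → ℤ × ℤ → ℂ}

/-- The argument of `g` in a term of the convolution and that of `f` add up to the given one, so
that the decay of `g` and of `f` together gives decay in `x P R`, and two powers of `f` remain to
sum over `t`. -/
lemma convTerm_bound (hf : Rapid (x Q R) f) (hg : Rapid (x P Q) g) (j : ℕ) :
    ∃ C : ℝ, 0 < C ∧ ∀ u l (t : ℤ),
      (1 + |x P R u l|) ^ j * ‖convTerm (θ := θ) f g u l (t • Q.p)‖ ≤
        C * ((1 + |t / Q.r + (R.m - Q.m) * u|) ^ 2)⁻¹ := by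
  obtain ⟨C, hC, h1⟩ := hf.bound (j + 2)
  obtain ⟨D, hD, h2⟩ := hg.bound j
  refine ⟨C * D, by positivity, fun u l t => ?_⟩
  have h3 := h1 u (t • Q.p)
  have h4 := h2 (u + proj θ (t • Q.p)) (l - t • Q.p)
  have h5 : 1 + |x P R u l| ≤ (1 + |x P Q (u + proj θ (t • Q.p)) (l - t • Q.p)|) *
      (1 + |x Q R u (t • Q.p)|) := by
    rw [x_add P Q R u l (t • Q.p)]
    have := abs_add_le (x P Q (u + proj θ (t • Q.p)) (l - t • Q.p)) (x Q R u (t • Q.p))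
    nlinarith [mul_nonneg (abs_nonneg (x P Q (u + proj θ (t • Q.p)) (l - t • Q.p)))
      (abs_nonneg (x Q R u (t • Q.p)))]
  rw [← x_smul_p]
  set X := 1 + |x P Q (u + proj θ (t • Q.p)) (l - t • Q.p)|
  set Y := 1 + |x Q R u (t • Q.p)|
  have hX : 0 < X := by positivity
  have hY : 0 < Y := by positivity
  rw [convTerm, norm_mul]
  calc _ ≤ (X * Y) ^ j * ((C * (Y ^ (j + 2))⁻¹) * (D * (X ^ j)⁻¹)) := by gcongr
    _ = _ := by rw [mul_pow, pow_add]; field_simp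

lemma summable_convTerm (hf : Rapid (x Q R) f) (hg : Rapid (x P Q) g) (u : ℝ) (l : ℤ × ℤ) :
    Summable fun t : ℤ => ‖convTerm (θ := θ) f g u l (t • Q.p)‖ := by
  obtain ⟨C, hC, h⟩ := convTerm_bound hf hg 0
  obtain ⟨B, hB, h'⟩ := exists_tsum_inv_sq_le Q.r_pos
  exact Summable.of_nonneg_of_le (fun _ => norm_nonneg _) (fun t => by simpa using h u l t)
    ((h' _).1.mul_left C)

lemma rapid_conv (hf : Rapid (x Q R) f) (hg : Rapid (x P Q) g) : Rapid (x P R) (conv Q f g) := by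
  intro j
  obtain ⟨C, hC, h⟩ := convTerm_bound hf hg j
  obtain ⟨B, hB, h'⟩ := exists_tsum_inv_sq_le Q.r_pos
  refine ⟨C * B, fun u l => ?_⟩
  have hs := summable_convTerm hf hg u l
  calc _ ≤ (1 + |x P R u l|) ^ j * ∑' t : ℤ, ‖convTerm (θ := θ) f g u l (t • Q.p)‖ := by
        gcongr; exact norm_tsum_le_tsum_norm hs
    _ = ∑' t : ℤ, (1 + |x P R u l|) ^ j * ‖convTerm (θ := θ) f g u l (t • Q.p)‖ :=
        tsum_mul_left.symm
    _ ≤ ∑' t : ℤ, C * ((1 + |t / Q.r + (R.m - Q.m) * u|) ^ 2)⁻¹ :=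
        (hs.mul_left _).tsum_le_tsum (h u l) ((h' _).1.mul_left C)
    _ ≤ _ := by rw [tsum_mul_left]; gcongr; exact (h' _).2

lemma conv_add_left (hf : Rapid (x Q R) f) (hf₁ : Rapid (x Q R) f₁) (hg : Rapid (x P Q) g) :
    conv Q (f + f₁) g = conv Q f g + conv Q f₁ g := by
  ext u l
  refine Eq.trans (tsum_congr fun t => ?_) (Summable.tsum_add
    (summable_convTerm hf hg u l).of_norm (summable_convTerm hf₁ hg u l).of_norm)
  simp [convTerm, add_mul]

lemma conv_add_right (hf : Rapid (x Q R) f) (hg : Rapid (x P Q) g) (hg₁ : Rapid (x P Q) g₁) :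
    conv Q f (g + g₁) = conv Q f g + conv Q f g₁ := by
  ext u l
  refine Eq.trans (tsum_congr fun t => ?_) (Summable.tsum_add
    (summable_convTerm hf hg u l).of_norm (summable_convTerm hf hg₁ u l).of_norm)
  simp [convTerm, mul_add]

lemma conv_smul_left (k : ℂ) : conv Q (k • f) g = k • conv Q f g := by
  ext u l
  refine Eq.trans (tsum_congr fun t => ?_) tsum_mul_left
  simp [convTerm, mul_assoc]

lemma conv_smul_right (k : ℂ) : conv Q f (k • g) = k • conv Q f g := by
  ext u l
  refine Eq.trans (tsum_congr fun t => ?_) tsum_mul_left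
  simp [convTerm, mul_left_comm]

/-- The Leibniz rule. The derivatives of the terms are dominated on an interval of length `2`,
where `x Q R` varies by at most a constant. -/
lemma hasDerivAt_conv (hf : IsSchwartz (x Q R) f) (hg : IsSchwartz (x P Q) g) (u : ℝ)
    (l : ℤ × ℤ) : HasDerivAt (fun s => conv Q f g s l)
      (conv Q (dd f) g u l + conv Q f (dd g) u l) u := by
  obtain ⟨C, hC, h⟩ := convTerm_bound hf.dd.rapid hg.rapid 0
  obtain ⟨D, hD, h₁⟩ := convTerm_bound hf.rapid hg.dd.rapid 0
  obtain ⟨B, hB, h'⟩ := exists_tsum_inv_sq_le Q.r_pos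
  rw [conv, conv, ← Summable.tsum_add
    (summable_convTerm hf.dd.rapid hg.rapid u l).of_norm
    (summable_convTerm hf.rapid hg.dd.rapid u l).of_norm]
  set K := (1 + |R.m - Q.m|) ^ 2
  refine hasDerivAt_tsum_of_isPreconnected (𝕜 := ℝ)
    (u := fun t : ℤ => (C + D) * (K * ((1 + |t / Q.r + (R.m - Q.m) * u|) ^ 2)⁻¹))
    (t := Metric.ball u 1) (y₀ := u)
    (g := fun t s => convTerm (θ := θ) f g s l (t • Q.p))
    (g' := fun t s => convTerm (θ := θ) (dd f) g s l (t • Q.p)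
      + convTerm (θ := θ) f (dd g) s l (t • Q.p))
    (((h' _).1.mul_left _).mul_left _) Metric.isOpen_ball (convex_ball u 1).isPreconnected
    (fun t s _ => ?_) (fun t s hs => ?_) (Metric.mem_ball_self one_pos)
    (summable_convTerm hf.rapid hg.rapid u l).of_norm (Metric.mem_ball_self one_pos)
  · exact (hf.hasDerivAt s _).mul
      ((hg.hasDerivAt (s + proj θ (t • Q.p)) _).comp_add_const s _)
  · have h2 : |t / Q.r + (R.m - Q.m) * s - (t / Q.r + (R.m - Q.m) * u)| ≤ |R.m - Q.m| := by
      rw [add_sub_add_left_eq_sub, ← mul_sub, abs_mul]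
      rw [Metric.mem_ball, Real.dist_eq] at hs
      exact mul_le_of_le_one_right (abs_nonneg _) hs.le
    calc _ ≤ ‖convTerm (θ := θ) (dd f) g s l (t • Q.p)‖
          + ‖convTerm (θ := θ) f (dd g) s l (t • Q.p)‖ := norm_add_le _ _
      _ ≤ (C + D) * ((1 + |t / Q.r + (R.m - Q.m) * s|) ^ 2)⁻¹ := by
          rw [add_mul]
          exact add_le_add (by simpa using h s l t) (by simpa using h₁ s l t)
      _ ≤ _ := by
          gcongr
          refine (inv_sq_le _ (t / Q.r + (R.m - Q.m) * u)).trans ?_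
          gcongr ?_ * _
          simp only [K]
          gcongr

lemma IsSchwartz.conv (hf : IsSchwartz (x Q R) f) (hg : IsSchwartz (x P Q) g) :
    IsSchwartz (x P R) (conv Q f g) := by
  -- The additive monoid generated by the convolutions is closed under differentiation.
  let M : Set (ℝ → ℤ × ℤ → ℂ) :=
    {h | ∃ f g, IsSchwartz (x Q R) f ∧ IsSchwartz (x P Q) g ∧ h = NCTorus.conv Q f g}
  refine ⟨AddSubmonoid.closure M, AddSubmonoid.subset_closure ⟨f, g, hf, hg, rfl⟩, ?_⟩
  intro h hh
  induction hh using AddSubmonoid.closure_induction with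
  | mem h hh =>
    obtain ⟨f, g, hf, hg, rfl⟩ := hh
    exact ⟨rapid_conv hf.rapid hg.rapid, _,
      add_mem (AddSubmonoid.subset_closure ⟨_, _, hf.dd, hg, rfl⟩)
        (AddSubmonoid.subset_closure ⟨_, _, hf, hg.dd, rfl⟩), hasDerivAt_conv hf hg⟩
  | zero => exact ⟨IsSchwartz.zero.rapid, 0, zero_mem _, fun u l => hasDerivAt_const u 0⟩
  | add h₁ h₂ _ _ ih₁ ih₂ =>
    obtain ⟨r₁, d₁, m₁, e₁⟩ := ih₁
    obtain ⟨r₂, d₂, m₂, e₂⟩ := ih₂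
    exact ⟨r₁.add r₂, _, add_mem m₁ m₂, fun u l => (e₁ u l).add (e₂ u l)⟩

end

/-! ### The spaces of kernels -/

/-- The space `Hom(P, Q)` of Schwartz functions on the quotient of `ℝ × ℤ²` by the two translations
that belong to the vectors of `P` and `Q`. -/
structure Kernel (P Q : Frame θ) where
  toFun : ℝ → ℤ × ℤ → ℂ
  isSchwartz : IsSchwartz (x P Q) toFun
  add_left : ∀ u l, toFun u (l + P.v) = toFun u l
  add_right : ∀ u l, toFun (u - Q.r) (l + Q.v) = toFun u l

namespace Kernel

instance : CoeFun (Kernel P Q) fun _ => ℝ → ℤ × ℤ → ℂ := ⟨toFun⟩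

@[ext] lemma ext {f g : Kernel P Q} (h : ∀ u l, f u l = g u l) : f = g := by
  obtain ⟨f, _, _, _⟩ := f
  obtain ⟨g, _, _, _⟩ := g
  have : f = g := funext fun u => funext fun l => h u l
  subst this
  rfl

instance : Zero (Kernel P Q) := ⟨⟨0, IsSchwartz.zero, fun _ _ => rfl, fun _ _ => rfl⟩⟩

instance : Add (Kernel P Q) := ⟨fun f g => ⟨f.toFun + g.toFun, f.isSchwartz.add g.isSchwartz,
  fun u l => congrArg₂ (· + ·) (f.add_left u l) (g.add_left u l),
  fun u l => congrArg₂ (· + ·) (f.add_right u l) (g.add_right u l)⟩⟩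

instance : SMul ℂ (Kernel P Q) := ⟨fun k f => ⟨k • f.toFun, f.isSchwartz.smul k,
  fun u l => congrArg (k • ·) (f.add_left u l), fun u l => congrArg (k • ·) (f.add_right u l)⟩⟩

instance : Neg (Kernel P Q) := ⟨fun f => (-1 : ℂ) • f⟩

@[simp] lemma add_apply (f g : Kernel P Q) (u : ℝ) (l : ℤ × ℤ) : (f + g) u l = f u l + g u l := rfl
@[simp] lemma smul_apply (k : ℂ) (f : Kernel P Q) (u : ℝ) (l : ℤ × ℤ) :
    (k • f) u l = k * f u l := rfl
@[simp] lemma zero_apply (u : ℝ) (l : ℤ × ℤ) : (0 : Kernel P Q) u l = 0 := rfl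
@[simp] lemma neg_apply (f : Kernel P Q) (u : ℝ) (l : ℤ × ℤ) : (-f) u l = -f u l :=
  neg_one_mul _

instance : AddCommGroup (Kernel P Q) where
  add_assoc f g h := by ext; simp [add_assoc]
  zero_add f := by ext; simp
  add_zero f := by ext; simp
  nsmul := nsmulRec
  zsmul := zsmulRec
  neg_add_cancel f := by ext; simp
  add_comm f g := by ext; simp [add_comm]

instance : Module ℂ (Kernel P Q) where
  one_smul f := by ext; simp
  mul_smul k k' f := by ext; simp [mul_assoc]
  smul_zero k := by ext; simp
  smul_add k f g := by ext; simp [mul_add]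
  add_smul k k' f := by ext; simp [add_mul]
  zero_smul f := by ext; simp

lemma rapid (f : Kernel P Q) : Rapid (x P Q) f := f.isSchwartz.rapid
lemma continuous (f : Kernel P Q) (l : ℤ × ℤ) : Continuous fun u => f u l :=
  f.isSchwartz.continuous l

lemma sub_left (f : Kernel P Q) (u : ℝ) (l : ℤ × ℤ) : f u (l - P.v) = f u l := by
  rw [← f.add_left, sub_add_cancel]

lemma add_right' (f : Kernel P Q) (u : ℝ) (l : ℤ × ℤ) : f u (l + Q.v) = f (u + Q.r) l := by
  rw [← f.add_right (u + Q.r), add_sub_cancel_right]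

lemma sub_right (f : Kernel P Q) (u : ℝ) (l : ℤ × ℤ) : f (u + Q.r) (l - Q.v) = f u l := by
  rw [← f.add_right, add_sub_cancel_right, sub_add_cancel]

lemma convTerm_add (f : Kernel Q R) (g : Kernel P Q) (u : ℝ) (l m : ℤ × ℤ) :
    convTerm (θ := θ) f g u l (m + Q.v) = convTerm (θ := θ) f g u l m := by
  rw [convTerm, convTerm, f.add_left, proj_add, ← add_assoc, ← sub_sub]
  exact congrArg _ (g.sub_right _ _)

lemma tsum_convTerm (f : Kernel Q R) (g : Kernel P Q) (u : ℝ) (l m : ℤ × ℤ) :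
    ∑' t : ℤ, convTerm (θ := θ) f g u l (t • Q.p + m) = conv Q f g u l :=
  Q.tsum_transversal (convTerm_add f g u l) m

/-- Composition of kernels. -/
def comp (f : Kernel Q R) (g : Kernel P Q) : Kernel P R :=
  ⟨conv Q f g, f.isSchwartz.conv g.isSchwartz, fun u l => tsum_congr fun t => by
      rw [convTerm, convTerm, add_sub_right_comm, g.add_left],
    fun u l => by
      rw [← tsum_convTerm f g _ _ R.v]
      refine tsum_congr fun t => ?_
      have h : u - R.r + (proj θ (t • Q.p) + proj θ R.v) = u + proj θ (t • Q.p) := by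
        rw [Frame.r]; ring
      rw [convTerm, convTerm, f.add_right, proj_add, add_sub_add_right_eq_sub, h]⟩

lemma comp_apply (f : Kernel Q R) (g : Kernel P Q) (u : ℝ) (l : ℤ × ℤ) :
    comp f g u l = ∑' t : ℤ, f u (t • Q.p) * g (u + proj θ (t • Q.p)) (l - t • Q.p) := rfl

lemma comp_add (f : Kernel Q R) (g g' : Kernel P Q) : comp f (g + g') = comp f g + comp f g' :=
  ext fun u l => congrFun₂ (conv_add_right f.rapid g.rapid g'.rapid) u l

lemma add_comp (f f' : Kernel Q R) (g : Kernel P Q) : comp (f + f') g = comp f g + comp f' g :=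
  ext fun u l => congrFun₂ (conv_add_left f.rapid f'.rapid g.rapid) u l

lemma comp_smul (k : ℂ) (f : Kernel Q R) (g : Kernel P Q) : comp f (k • g) = k • comp f g :=
  ext fun u l => congrFun₂ (conv_smul_right k) u l

lemma smul_comp (k : ℂ) (f : Kernel Q R) (g : Kernel P Q) : comp (k • f) g = k • comp f g :=
  ext fun u l => congrFun₂ (conv_smul_left k) u l

/-- Both sides are the sum of an absolutely convergent double series; in one of them the inner
summation is shifted by the outer index, which is harmless because `tsum_convTerm` allows any
transversal. -/
lemma comp_assoc (f : Kernel R S) (g : Kernel Q R) (h : Kernel P Q) :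
    comp (comp f g) h = comp f (comp g h) := by
  ext u l
  obtain ⟨C, hC, hf⟩ := f.rapid.bound 2
  obtain ⟨D, hD, hg⟩ := g.rapid.bound 2
  obtain ⟨E, hE, hh⟩ := h.rapid.bound 0
  obtain ⟨B, hB, hs⟩ := exists_tsum_inv_sq_le Q.r_pos
  obtain ⟨B', hB', hs'⟩ := exists_tsum_inv_sq_le R.r_pos
  let F : ℤ → ℤ → ℂ := fun s t => convTerm (θ := θ) f g u (t • Q.p) (s • R.p) *
    h (u + proj θ (t • Q.p)) (l - t • Q.p)
  have hx : ∀ s t : ℤ, x Q R (u + proj θ (s • R.p)) (t • Q.p - s • R.p) =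
      t / Q.r + ((S.m - Q.m) * u - (s / R.r + (S.m - R.m) * u)) := fun s t => by
    have h1 := x_add Q R S u (t • Q.p) (s • R.p)
    rw [x_smul_p, x_smul_p] at h1
    linarith
  have hF : ∀ s t, ‖F s t‖ ≤ (C * ((1 + |s / R.r + (S.m - R.m) * u|) ^ 2)⁻¹) *
      ((D * ((1 + |t / Q.r + ((S.m - Q.m) * u - (s / R.r + (S.m - R.m) * u))|) ^ 2)⁻¹) * E) := by
    intro s t
    have h1 := hf u (s • R.p)
    have h2 := hg (u + proj θ (s • R.p)) (t • Q.p - s • R.p)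
    have h3 := hh (u + proj θ (t • Q.p)) (l - t • Q.p)
    rw [x_smul_p] at h1
    rw [hx] at h2
    simp only [pow_zero, inv_one, mul_one] at h3
    simp only [F, convTerm, norm_mul]
    rw [mul_assoc]
    exact mul_le_mul h1 (mul_le_mul h2 h3 (norm_nonneg _) (by positivity)) (by positivity)
      (by positivity)
  have hsum : Summable (Function.uncurry F) := by
    refine Summable.of_norm_bounded (summable_mul_of_tsum_le (B := D * B * E)
      (F := fun s t => (D * ((1 + |t / Q.r + ((S.m - Q.m) * u -
        (s / R.r + (S.m - R.m) * u))|) ^ 2)⁻¹) * E) (fun s => by positivity)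
      (fun s t => by positivity) ((hs' ((S.m - R.m) * u)).1.mul_left C)
      (fun s => ((hs _).1.mul_left D).mul_right E) fun s => ?_) fun p => hF p.1 p.2
    rw [tsum_mul_right, tsum_mul_left]
    gcongr
    exact (hs _).2
  calc comp (comp f g) h u l = ∑' t : ℤ, ∑' s : ℤ, F s t := tsum_congr fun t => by
        exact tsum_mul_right.symm
    _ = ∑' s : ℤ, ∑' t : ℤ, F s t := hsum.tsum_comm
    _ = _ := tsum_congr fun s => by
        have h1 := tsum_convTerm g h (u + proj θ (s • R.p)) (l - s • R.p) (-(s • R.p))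
        refine Eq.trans ?_ (congrArg (f u (s • R.p) * ·) h1)
        rw [← tsum_mul_left]
        refine tsum_congr fun t => ?_
        have e1 : u + proj θ (s • R.p) + proj θ (t • Q.p - s • R.p) = u + proj θ (t • Q.p) := by
          rw [proj_sub]; ring
        have e2 : l - s • R.p - (t • Q.p - s • R.p) = l - t • Q.p := by abel
        simp only [F, convTerm, ← sub_eq_add_neg, e1, e2, mul_assoc]

/-- The identity kernel. -/
def id (P Q : Frame θ) (h : P.v = Q.v) : Kernel P Q :=
  ⟨fun _ l => if P.dt l = 0 then 1 else 0, by
    refine ⟨{fun _ l => if P.dt l = 0 then 1 else 0, 0}, by simp, ?_⟩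
    rintro g (rfl | rfl)
    · refine ⟨fun j => ⟨1, fun u l => ?_⟩, 0, by simp, fun u l => hasDerivAt_const _ _⟩
      by_cases hl : P.dt l = 0
      · have : Q.m = P.m := by
          have h1 : Q.c = P.c := congrArg Prod.fst h.symm
          rw [Frame.m, Frame.m, Frame.r, Frame.r, h, h1]
        simp [hl, x_eq, this]
      · simp [hl]
    · exact ⟨IsSchwartz.zero.rapid, 0, by simp, fun u l => hasDerivAt_const _ _⟩,
    fun u l => by simp [dt_add], fun u l => by simp [dt_add, ← h]⟩

lemma id_apply (h : P.v = Q.v) (u : ℝ) (l : ℤ × ℤ) :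
    id P Q h u l = if P.dt l = 0 then 1 else 0 := rfl

lemma comp_id (f : Kernel P Q) : comp f (id P P rfl) = f := by
  ext u l
  rw [comp_apply, tsum_eq_single (P.dt l)]
  · rw [id_apply, dt_sub, dt_smul, dt_p, mul_one, sub_self, if_pos rfl, mul_one]
    obtain ⟨s, hs⟩ := P.exists_eq l
    have h' : ∀ (s : ℤ) l, f u (l + s • P.v) = f u l := by
      intro s
      induction s with
      | zero => simp
      | succ n ih => intro l; rw [add_smul, one_smul, ← add_assoc, f.add_left, ih]
      | pred n ih => intro l; rw [sub_smul, one_smul, ← add_sub_assoc, f.sub_left, ih]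
    conv_rhs => rw [hs, h']
  · intro t ht
    rw [id_apply, dt_sub, dt_smul, dt_p, mul_one, if_neg (sub_ne_zero.mpr ht.symm), mul_zero]

lemma id_comp (f : Kernel P Q) : comp (id Q Q rfl) f = f := by
  ext u l
  rw [comp_apply, tsum_eq_single 0]
  · simp [id_apply, proj]
  · intro t ht
    rw [id_apply, dt_smul, dt_p, mul_one, if_neg ht, zero_mul]

/-- The operator `∂/∂u + 2πi (τ x + b)`, which corresponds to the differential of the complex of
morphisms. -/
def D (τ b : ℂ) : Kernel P Q →ₗ[ℂ] Kernel P Q where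
  toFun f := ⟨fun u l => dd f u l + 2 * Real.pi * Complex.I * (τ * x P Q u l + b) * f u l, by
      have h := (f.isSchwartz.dd.add ((f.isSchwartz.mul_x (fun u l => hasDerivAt_x P Q l u)).smul
        (2 * Real.pi * Complex.I * τ))).add (f.isSchwartz.smul (2 * Real.pi * Complex.I * b))
      convert h using 1
      ext u l
      simp
      ring,
    fun u l => by
      have h : dd f u (l + P.v) = dd f u l := by simp only [dd, f.add_left]
      simp only [h, f.add_left, x_add_left],
    fun u l => by
      have h : dd f (u - Q.r) (l + Q.v) = dd f u l := by
        simp only [dd, f.add_right']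
        rw [deriv_comp_add_const (fun s => f.1 s l), sub_add_cancel]
      simp only [h, f.add_right, x_add_right]⟩
  map_add' f g := by
    ext u l
    have h : dd (f + g : Kernel P Q) u l = dd f u l + dd g u l :=
      ((f.isSchwartz.hasDerivAt u l).add (g.isSchwartz.hasDerivAt u l)).deriv
    show dd (f + g : Kernel P Q) u l + _ * (f u l + g u l) = (_ + _) + (_ + _)
    rw [h]
    ring
  map_smul' k f := by
    ext u l
    have h : dd (k • f : Kernel P Q) u l = k * dd f u l :=
      ((f.isSchwartz.hasDerivAt u l).const_mul k).deriv
    show dd (k • f : Kernel P Q) u l + _ * (k * f u l) = k * (_ + _)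
    rw [h]
    ring

lemma D_apply (τ b : ℂ) (f : Kernel P Q) (u : ℝ) (l : ℤ × ℤ) :
    D τ b f u l = dd f u l + 2 * Real.pi * Complex.I * (τ * x P Q u l + b) * f u l := rfl

lemma hasDerivAt (f : Kernel P Q) (τ b : ℂ) (u : ℝ) (l : ℤ × ℤ) :
    HasDerivAt (fun s => f s l)
      (D τ b f u l - 2 * Real.pi * Complex.I * (τ * x P Q u l + b) * f u l) u := by
  rw [D_apply, add_sub_cancel_right]
  exact f.isSchwartz.hasDerivAt u l

/-- A kernel whose derivative is as prescribed by the operator `D`. -/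
lemma D_eq_of_hasDerivAt {τ b : ℂ} {f g : Kernel P Q} (h : ∀ u l, HasDerivAt (fun s => f s l)
    (g u l - 2 * Real.pi * Complex.I * (τ * x P Q u l + b) * f u l) u) : D τ b f = g := by
  ext u l
  rw [D_apply, dd, (h u l).deriv, sub_add_cancel]

/-- The Leibniz rule. -/
lemma D_comp (τ b b' : ℂ) (f : Kernel Q R) (g : Kernel P Q) :
    D τ (b + b') (comp f g) = comp (D τ b' f) g + comp f (D τ b g) := by
  ext u l
  have h : dd (comp f g) u l = _ := (hasDerivAt_conv f.isSchwartz g.isSchwartz u l).deriv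
  have h1 := (summable_convTerm f.isSchwartz.dd.rapid g.rapid u l).of_norm
  have h2 := (summable_convTerm f.rapid g.isSchwartz.dd.rapid u l).of_norm
  have h3 := (summable_convTerm f.rapid g.rapid u l).of_norm
  rw [D_apply, h]
  refine Eq.trans ?_ (Summable.tsum_add
    (summable_convTerm (D τ b' f).rapid g.rapid u l).of_norm
    (summable_convTerm f.rapid (D τ b g).rapid u l).of_norm)
  refine Eq.trans (congrArg₂ (· + ·) (Summable.tsum_add h1 h2).symm tsum_mul_left.symm) ?_
  refine Eq.trans (Summable.tsum_add (h1.add h2) (h3.mul_left _)).symm ?_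
  refine tsum_congr fun t => ?_
  simp only [convTerm, D_apply]
  rw [x_add P Q R u l (t • Q.p)]
  push_cast
  ring

end Kernel

end

section

variable {θ : ℝ} {P Q R S : Frame θ}

open _root_.NCTorus.Frame

/-! ### Comparison with Schwartz functions of one variable -/

/-- A family of Schwartz functions of one variable with uniformly bounded seminorms. -/
lemma isSchwartz_of_family {x : ℝ → ℤ × ℤ → ℝ} {s₀ : ℤ × ℤ → ℝ} {μ : ℝ}
    (hx : ∀ u l, x u l = μ * (u + s₀ l)) {F : ℤ × ℤ → 𝓢(ℝ, ℂ)}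
    (hF : ∀ j k, ∃ C, ∀ l, SchwartzMap.seminorm ℂ j k (F l) ≤ C) :
    IsSchwartz x fun u l => F l (u + s₀ l) := by
  refine ⟨{g | ∃ F : ℤ × ℤ → 𝓢(ℝ, ℂ), (∀ j k, ∃ C, ∀ l, SchwartzMap.seminorm ℂ j k (F l) ≤ C) ∧
    g = fun u l => F l (u + s₀ l)}, ⟨F, hF, rfl⟩, ?_⟩
  rintro _ ⟨F, hF, rfl⟩
  refine ⟨fun j => ?_, _, ⟨fun l => SchwartzMap.derivCLM ℂ ℂ (F l), fun j k => ?_, rfl⟩,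
    fun u l => ?_⟩
  · obtain ⟨C, hC⟩ := hF j 0
    obtain ⟨D, hD⟩ := hF 0 0
    have key : ∀ y : ℝ, (1 + |μ * y|) ^ j ≤ 2 ^ (j - 1) * (1 + |μ| ^ j * |y| ^ j) := fun y => by
      rw [abs_mul, ← mul_pow]
      simpa using add_pow_le (zero_le_one' ℝ) (mul_nonneg (abs_nonneg μ) (abs_nonneg y)) j
    refine ⟨2 ^ (j - 1) * (D + |μ| ^ j * C), fun u l => ?_⟩
    have h1 : |u + s₀ l| ^ j * ‖F l (u + s₀ l)‖ ≤ C := by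
      have := SchwartzMap.norm_pow_mul_le_seminorm ℂ (F l) j (u + s₀ l)
      rw [Real.norm_eq_abs] at this
      exact this.trans (hC l)
    have h2 : ‖F l (u + s₀ l)‖ ≤ D := (SchwartzMap.norm_le_seminorm ℂ _ _).trans (hD l)
    rw [hx]
    calc _ ≤ 2 ^ (j - 1) * (1 + |μ| ^ j * |u + s₀ l| ^ j) * ‖F l (u + s₀ l)‖ := by
          gcongr; exact key _
      _ = 2 ^ (j - 1) * (‖F l (u + s₀ l)‖ + |μ| ^ j * (|u + s₀ l| ^ j * ‖F l (u + s₀ l)‖)) := by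
          ring
      _ ≤ _ := by gcongr
  · simp only [seminorm_deriv]; exact hF j (k + 1)
  · exact ((F l).hasDerivAt (u + s₀ l)).comp_add_const u (s₀ l)

lemma IsSchwartz.exists_iteratedDeriv {x : ℝ → ℤ × ℤ → ℝ} {f : ℝ → ℤ × ℤ → ℂ}
    (hf : IsSchwartz x f) (k : ℕ) :
    ∃ g, IsSchwartz x g ∧ ∀ l, iteratedDeriv k (fun u => f u l) = fun u => g u l := by
  induction k with
  | zero => exact ⟨f, hf, fun l => iteratedDeriv_zero⟩
  | succ k ih =>
    obtain ⟨g, hg, h⟩ := ih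
    refine ⟨NCTorus.dd g, hg.dd, fun l => ?_⟩
    rw [iteratedDeriv_succ, h]
    rfl

/-- A member of a Schwartz family, as a Schwartz function of one variable. -/
def toSchwartz {x : ℝ → ℤ × ℤ → ℝ} {f : ℝ → ℤ × ℤ → ℂ} (hf : IsSchwartz x f) (l : ℤ × ℤ) (s₀ μ : ℝ)
    (hμ : μ ≠ 0) (hx : ∀ u, x u l = μ * (u + s₀)) : 𝓢(ℝ, ℂ) where
  toFun y := f (y - s₀) l
  smooth' := by
    have h : ContDiff ℝ (⊤ : ℕ∞) fun u => f u l := by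
      refine contDiff_of_differentiable_iteratedDeriv fun m _ => ?_
      obtain ⟨g, hg, h⟩ := hf.exists_iteratedDeriv m
      rw [h]
      exact fun u => (hg.hasDerivAt u l).differentiableAt
    exact h.comp (contDiff_id.sub contDiff_const)
  decay' j k := by
    obtain ⟨g, hg, h⟩ := hf.exists_iteratedDeriv k
    obtain ⟨C, hC⟩ := hg.rapid j
    refine ⟨(|μ| ^ j)⁻¹ * C, fun y => ?_⟩
    rw [norm_iteratedFDeriv_eq_norm_iteratedDeriv, iteratedDeriv_comp_sub_const k (fun u => f u l),
      h, ← div_eq_inv_mul, le_div_iff₀ (by positivity)]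
    refine le_trans ?_ (hC (y - s₀) l)
    rw [hx, sub_add_cancel, mul_right_comm, ← mul_pow, Real.norm_eq_abs, mul_comm |y|, ← abs_mul]
    gcongr
    linarith

@[simp] lemma toSchwartz_apply {x : ℝ → ℤ × ℤ → ℝ} {f : ℝ → ℤ × ℤ → ℂ} (hf : IsSchwartz x f)
    (l : ℤ × ℤ) (s₀ μ : ℝ) (hμ : μ ≠ 0) (hx : ∀ u, x u l = μ * (u + s₀)) (y : ℝ) :
    toSchwartz hf l s₀ μ hμ hx y = f (y - s₀) l := rfl

/-! ### The frame of the trivial module and a partition of unity -/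

/-- The frame of the trivial module `A_θ`. -/
def Frame.O (θ : ℝ) : Frame θ := ⟨1, by simp [rk]⟩

namespace Frame

@[simp] lemma O_v : (O θ).v = (0, 1) := by simp [v, O, c, d]
@[simp] lemma O_p : (O θ).p = (1, 0) := by simp [p, O, a, b]
@[simp] lemma O_c : (O θ).c = 0 := by simp [O, c]
@[simp] lemma O_r : (O θ).r = 1 := by simp [r, proj]
@[simp] lemma O_m : (O θ).m = 0 := by simp [m]
@[simp] lemma O_dt (l : ℤ × ℤ) : (O θ).dt l = l.1 := by simp [dt, O, c, d]

lemma d_eq_one (h : P.c = 0) : P.d = 1 := by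
  have h1 := P.det_eq
  have h2 := P.r_pos
  rw [r_def, h] at h2
  rw [h, mul_zero, sub_zero] at h1
  have h3 : 0 < P.d := by simpa using h2
  rcases Int.isUnit_iff.mp (IsUnit.of_mul_eq_one_right _ h1) with h | h
  · exact h
  · omega

lemma v_eq_of_c_eq_zero (h : P.c = 0) : P.v = (O θ).v := by
  rw [O_v, v, h, d_eq_one h]

lemma x_O_left (u : ℝ) (l : ℤ × ℤ) : x (O θ) P u l = P.m * u + l.1 := by simp [x]
lemma x_O_right (u : ℝ) (l : ℤ × ℤ) : x P (O θ) u l = -P.m * (u + proj θ l) + l.1 := by simp [x]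

lemma dvd_of_dt (P : Frame θ) {l : ℤ × ℤ} (h : P.dt l = 0) : P.c ∣ l.1 := by
  obtain ⟨s, hs⟩ := P.exists_eq l
  rw [h, zero_smul, zero_add] at hs
  exact ⟨s, by rw [hs]; simp [v, mul_comm]⟩

end Frame

section Bump

/-- The integer translates of `y ↦ σ (y + 1) - σ y` form a partition of unity on `ℝ`; grouping
them in blocks of `n` gives this telescoping sum. -/
lemma tsum_smoothTransition {n : ℕ} (hn : 0 < n) (y : ℝ) :
    ∑' t : ℤ, (Real.smoothTransition (y + n * t + n) - Real.smoothTransition (y + n * t)) = 1 := by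
  have hn' : (0 : ℝ) < n := by exact_mod_cast hn
  have hn1 : (1 : ℝ) ≤ n := by exact_mod_cast hn
  -- All but two terms vanish: the argument passes through the interval `[0, 1]`, outside which `σ`
  -- is locally constant, next to `t = k`.
  set k : ℤ := ⌈-y / n⌉ with hk
  have h1 : -y ≤ n * k := by
    have := Int.le_ceil (-y / n)
    rw [div_le_iff₀ hn'] at this
    linarith
  have h2 : n * k < -y + n := by
    have := Int.ceil_lt_add_one (-y / n)
    rw [← hk, ← sub_lt_iff_lt_add, lt_div_iff₀ hn'] at this
    linarith
  have lo : ∀ t : ℤ, t < k → Real.smoothTransition (y + n * t) = 0 := fun t ht => by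
    have h3 : (t : ℝ) ≤ k - 1 := by exact_mod_cast Int.le_sub_one_of_lt ht
    exact Real.smoothTransition.zero_of_nonpos (by nlinarith)
  have hi : ∀ t : ℤ, k < t → Real.smoothTransition (y + n * t) = 1 := fun t ht => by
    have h3 : (k : ℝ) + 1 ≤ t := by exact_mod_cast ht
    exact Real.smoothTransition.one_of_one_le (by nlinarith)
  have next : ∀ t : ℤ, y + n * t + n = y + n * ((t + 1 : ℤ) : ℝ) := fun t => by push_cast; ring
  rw [tsum_eq_sum (s := {k - 1, k})]
  · rw [Finset.sum_pair (by omega), next, next, sub_add_cancel, lo (k - 1) (by omega),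
      hi (k + 1) (by omega)]
    ring
  · intro t ht
    simp only [Finset.mem_insert, Finset.mem_singleton, not_or] at ht
    rw [next]
    rcases lt_or_ge t k with h | h
    · rw [lo _ h, lo _ (by omega), sub_self]
    · rw [hi t (by omega), hi _ (by omega), sub_self]

/-- The function `u ↦ σ (u / ε + k) - σ (u / ε - k + 1)`, which vanishes for `|u| ≥ k ε` and is `1`
for `|u| ≤ (k - 1) ε`. -/
def bumpFun (ε : ℝ) (k : ℕ) (u : ℝ) : ℝ :=
  Real.smoothTransition (u / ε + k) - Real.smoothTransition (u / ε - k + 1)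

variable {ε : ℝ} (hε : 0 < ε) (k : ℕ)

include hε in
lemma bumpFun_eq_zero {u : ℝ} (hk : 1 ≤ k) (h : k * ε ≤ |u|) : bumpFun ε k u = 0 := by
  have hk' : (1 : ℝ) ≤ k := by exact_mod_cast hk
  rw [bumpFun]
  rcases le_abs.mp h with h | h
  · rw [← le_div_iff₀ hε] at h
    rw [Real.smoothTransition.one_of_one_le (by linarith),
      Real.smoothTransition.one_of_one_le (by linarith), sub_self]
  · rw [← le_div_iff₀ hε, neg_div] at h
    rw [Real.smoothTransition.zero_of_nonpos (by linarith),
      Real.smoothTransition.zero_of_nonpos (by linarith), sub_self]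

include hε in
lemma bumpFun_eq_one {u : ℝ} (h : |u| ≤ (k - 1) * ε) : bumpFun ε k u = 1 := by
  obtain ⟨h1, h2⟩ := abs_le.mp h
  rw [← div_le_iff₀ hε] at h2
  rw [← neg_mul, ← le_div_iff₀ hε] at h1
  rw [bumpFun, Real.smoothTransition.one_of_one_le (by linarith),
    Real.smoothTransition.zero_of_nonpos (by linarith), sub_zero]

/-- `bumpFun` as a Schwartz function. -/
def bump (hk : 1 ≤ k) : 𝓢(ℝ, ℂ) :=
  HasCompactSupport.toSchwartzMap (f := fun u => (bumpFun ε k u : ℂ))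
    (HasCompactSupport.intro (isCompact_closedBall (0 : ℝ) (k * ε)) fun u hu => by
      rw [Metric.mem_closedBall, dist_zero_right, not_le, Real.norm_eq_abs] at hu
      rw [bumpFun_eq_zero hε k hk hu.le, Complex.ofReal_zero]) <| by
    unfold bumpFun
    have h1 : ∀ c : ℝ, ContDiff ℝ (⊤ : ℕ∞) fun u : ℝ => Real.smoothTransition (u / ε + c) :=
      fun c => Real.smoothTransition.contDiff.comp ((contDiff_id.div_const _).add contDiff_const)
    have h2 := (h1 k).sub (h1 (-k + 1))
    exact Complex.ofRealCLM.contDiff.comp (by simpa only [← add_assoc, ← sub_eq_add_neg] using! h2)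

end Bump

section Partition

variable (P) (hc : P.c ≠ 0)

/-- The kernel from `O` to `P` supported on the orbit of `0 ∈ ℤ²` and given there by `F`. -/
def ofOrbit (F : 𝓢(ℝ, ℂ)) : Kernel (O θ) P where
  toFun u l := (if P.c ∣ l.1 then F else 0) (u + l.1 * (P.r / P.c))
  isSchwartz := by
    refine isSchwartz_of_family (μ := P.c / P.r) (fun u l => ?_) fun j k =>
      ⟨SchwartzMap.seminorm ℂ j k F, fun l => ?_⟩
    · have h1 : (P.c : ℝ) ≠ 0 := by exact_mod_cast hc
      have := P.r_ne
      rw [x_O_left, m]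
      field_simp
    · split_ifs
      · exact le_rfl
      · simp
  add_left u l := by simp
  add_right u l := by
    have h1 : (P.c : ℝ) ≠ 0 := by exact_mod_cast hc
    have h2 : u - P.r + ((l + P.v).1 : ℤ) * (P.r / P.c) = u + l.1 * (P.r / P.c) := by
      simp only [v, Prod.fst_add]
      push_cast
      field_simp
      ring
    have h3 : P.c ∣ (l + P.v).1 ↔ P.c ∣ l.1 := by simp [v]
    simp only [h2, h3]

/-- The kernel from `P` to `O` supported on the orbit of `0 ∈ ℤ²` and given there by `F`. -/
def toOrbit (F : 𝓢(ℝ, ℂ)) : Kernel P (O θ) where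
  toFun u l := (if P.c ∣ l.1 then F else 0) (u + (proj θ l - l.1 * (P.r / P.c)))
  isSchwartz := by
    refine isSchwartz_of_family (μ := -P.c / P.r) (fun u l => ?_) fun j k =>
      ⟨SchwartzMap.seminorm ℂ j k F, fun l => ?_⟩
    · have h1 : (P.c : ℝ) ≠ 0 := by exact_mod_cast hc
      have := P.r_ne
      rw [x_O_right, m]
      field_simp
      ring
    · split_ifs
      · exact le_rfl
      · simp
  add_left u l := by
    have h1 : (P.c : ℝ) ≠ 0 := by exact_mod_cast hc
    have h2 : proj θ (l + P.v) - ((l + P.v).1 : ℤ) * (P.r / P.c)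
        = proj θ l - l.1 * (P.r / P.c) := by
      rw [proj_add, ← r]
      simp only [v, Prod.fst_add]
      push_cast
      field_simp
      ring
    have h3 : P.c ∣ (l + P.v).1 ↔ P.c ∣ l.1 := by simp [v]
    simp only [h2, h3]
  add_right u l := by
    simp [proj, ← add_assoc]
    congr 1
    ring

variable {P}

lemma ofOrbit_mul_toOrbit (F G : 𝓢(ℝ, ℂ)) (u : ℝ) (l : ℤ × ℤ) :
    Kernel.comp (ofOrbit P hc F) (toOrbit P hc G) u l = if P.c ∣ l.1 then
      ∑' t : ℤ, F (u + t * P.r) * G (u + t * P.r + (proj θ l - l.1 * (P.r / P.c))) else 0 := by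
  have h1 : (P.c : ℝ) ≠ 0 := by exact_mod_cast hc
  have hinj : Function.Injective fun t : ℤ => P.c * t := mul_right_injective₀ hc
  rw [Kernel.comp_apply, ← hinj.tsum_eq]
  · split_ifs with hl
    · refine tsum_congr fun t => ?_
      have h2 : P.c ∣ l.1 - P.c * t := dvd_sub hl (dvd_mul_right _ _)
      simp only [ofOrbit, toOrbit, O_p, Prod.smul_mk, smul_eq_mul, mul_one, mul_zero, dvd_mul_right,
        if_true, Prod.fst_sub, h2, proj]
      congr 2
      · push_cast; field_simp
      · push_cast; simp; field_simp; ring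
    · refine (tsum_congr fun t => ?_).trans tsum_zero
      have h2 : ¬ P.c ∣ l.1 - P.c * t := fun h => hl (by
        have := dvd_add h (dvd_mul_right P.c t)
        rwa [sub_add_cancel] at this)
      simp [toOrbit, h2]
  · intro t ht
    by_contra h
    refine ht ?_
    have h2 : ¬ P.c ∣ t := fun ⟨s, hs⟩ => h ⟨s, hs.symm⟩
    simp [ofOrbit, h2]

end Partition

/-- The identity of `P` is a sum of kernels that factor through `O`. This is the statement that
the module `E_P` is finitely generated and projective. -/
theorem exists_partition (P : Frame θ) : ∃ (n : ℕ) (f : Fin n → Kernel (O θ) P)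
    (h : Fin n → Kernel P (O θ)), ∑ i, Kernel.comp (f i) (h i) = Kernel.id P P rfl := by
  by_cases hc : P.c = 0
  -- For `c = 0` the frames `P` and `O` have the same vector, and the identity factors through `O`.
  · have hv := v_eq_of_c_eq_zero hc
    refine ⟨1, fun _ => Kernel.id _ _ hv.symm, fun _ => Kernel.id _ _ hv, ?_⟩
    rw [Finset.univ_unique, Finset.sum_singleton]
    ext u l
    rw [Kernel.comp_apply, tsum_eq_single 0]
    · simp [Kernel.id_apply]
    · intro t ht
      simp [Kernel.id_apply, ht]
  · have h1 : (P.c : ℝ) ≠ 0 := by exact_mod_cast hc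
    have hr := P.r_pos
    -- For `c ≠ 0` the circle `ℝ / rℤ` is covered by `n` intervals, so short that the support of
    -- `F i` is disjoint from all nontrivial integer translates of that of `G i`.
    obtain ⟨n, hn⟩ := exists_nat_gt (8 * P.r)
    have hn0 : (0 : ℝ) < n := lt_trans (by positivity) hn
    set ε := P.r / n with hεdef
    have hε : 0 < ε := by positivity
    have hε8 : ε < 1 / 8 := by
      rw [hεdef, div_lt_div_iff₀ hn0 (by norm_num)]; linarith
    let F : Fin n → 𝓢(ℝ, ℂ) := fun i =>
      SchwartzMap.compSubConstCLM ℂ (i * ε) (bump hε 1 le_rfl)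
    let G : Fin n → 𝓢(ℝ, ℂ) := fun i =>
      SchwartzMap.compSubConstCLM ℂ (i * ε) (bump hε 2 (by norm_num))
    have hF : ∀ i y, F i y = bumpFun ε 1 (y - i * ε) := fun i y => rfl
    have hG : ∀ i y, G i y = bumpFun ε 2 (y - i * ε) := fun i y => rfl
    -- `G i` equals `1` on the support of `F i`.
    have hFG : ∀ i y, F i y * G i y = bumpFun ε 1 (y - i * ε) := fun i y => by
      rw [hF, hG]
      by_cases h : |y - i * ε| ≤ ε
      · rw [bumpFun_eq_one hε 2 (by push_cast; linarith), Complex.ofReal_one, mul_one]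
      · rw [bumpFun_eq_zero hε 1 le_rfl (by push_cast; linarith), Complex.ofReal_zero, zero_mul]
    have hFG' : ∀ i y (s : ℤ), s ≠ 0 → F i y * G i (y + s) = 0 := fun i y s hs => by
      rw [hF, hG]
      by_cases h : |y - i * ε| ≤ ε
      · have hs' : (1 : ℝ) ≤ |(s : ℝ)| := by exact_mod_cast Int.one_le_abs hs
        rw [bumpFun_eq_zero hε 2 one_le_two, Complex.ofReal_zero, mul_zero]
        have := abs_sub_abs_le_abs_sub (s : ℝ) (-(y - i * ε))
        rw [abs_neg, sub_neg_eq_add] at this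
        rw [show y + s - i * ε = s + (y - i * ε) by ring]
        push_cast
        linarith
      · rw [bumpFun_eq_zero hε 1 le_rfl (by push_cast; linarith), Complex.ofReal_zero, zero_mul]
    refine ⟨n, fun i => ofOrbit P hc (F i), fun i => toOrbit P hc (G i), ?_⟩
    ext u l
    have hsum : ∀ (f : Fin n → Kernel P P), (∑ i, f i) u l = ∑ i, f i u l := fun f => by
      let φ : Kernel P P →+ ℂ :=
        { toFun := fun k => k u l, map_zero' := rfl, map_add' := fun _ _ => rfl }
      exact map_sum φ f Finset.univ
    rw [hsum]
    simp only [ofOrbit_mul_toOrbit, Kernel.id_apply]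
    by_cases hl : P.c ∣ l.1
    · simp only [hl, if_true]
      obtain ⟨k, hk⟩ := hl
      have hs : proj θ l - l.1 * (P.r / P.c) = ((l.2 - k * P.d : ℤ) : ℝ) := by
        rw [proj, hk, r_def]; push_cast; field_simp; ring
      have hdt : P.dt l = P.c * -(l.2 - k * P.d) := by rw [dt, hk]; ring
      rw [hs]
      -- On the orbit of `0` the sum is the partition of unity by the translates of `F i`; off this
      -- orbit all terms are products of functions of disjoint supports.
      by_cases h0 : l.2 - k * P.d = 0
      · rw [if_pos (by rw [hdt, h0]; simp), h0]
        simp only [Int.cast_zero, add_zero, hFG]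
        have hfin : ∀ i : Fin n, Summable fun t : ℤ =>
            (bumpFun ε 1 (u + t * P.r - i * ε) : ℂ) := by
          intro i
          refine summable_of_hasFiniteSupport ?_
          refine ((Set.finite_Icc ⌊(i * ε - ε - u) / P.r⌋ ⌈(i * ε + ε - u) / P.r⌉)).subset ?_
          intro t ht
          have h2 : |u + t * P.r - i * ε| < ε := by
            by_contra h
            exact ht (by
              show (bumpFun ε 1 (u + t * P.r - i * ε) : ℂ) = 0
              rw [bumpFun_eq_zero hε 1 le_rfl (by push_cast; linarith), Complex.ofReal_zero])
          obtain ⟨h3, h4⟩ := abs_lt.mp h2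
          constructor
          · rw [← Int.cast_le (R := ℝ)]
            refine (Int.floor_le _).trans ?_
            rw [div_le_iff₀ hr]; linarith
          · rw [← Int.cast_le (R := ℝ)]
            refine le_trans ?_ (Int.le_ceil _)
            rw [le_div_iff₀ hr]; linarith
        rw [← Summable.tsum_finsetSum fun i _ => hfin i]
        -- The sum of the `n` bumps telescopes.
        have htel := tsum_smoothTransition (n := n) (by exact_mod_cast hn0) (u / ε - n + 1)
        have hterm : ∀ t : ℤ, ∑ i : Fin n, (bumpFun ε 1 (u + t * P.r - i * ε) : ℂ) =
            ((Real.smoothTransition (u / ε - n + 1 + n * t + n)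
              - Real.smoothTransition (u / ε - n + 1 + n * t) : ℝ) : ℂ) := by
          intro t
          rw [← Complex.ofReal_sum]
          congr 1
          have h5 : ∀ i : ℕ, bumpFun ε 1 (u + t * P.r - i * ε) =
              Real.smoothTransition (u / ε + n * t + 1 - i)
                - Real.smoothTransition (u / ε + n * t + 1 - (i + 1 : ℕ)) := by
            intro i
            have h6 : (u + t * P.r - i * ε) / ε = u / ε + n * t - i := by
              rw [hεdef]; field_simp
            rw [bumpFun, h6]
            push_cast
            congr 2 <;> ring
          rw [← Finset.sum_range fun i : ℕ => bumpFun ε 1 (u + t * P.r - i * ε),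
            Finset.sum_congr rfl fun i _ => h5 i, Finset.sum_range_sub']
          congr 2 <;> push_cast <;> ring
        rw [tsum_congr hterm, ← Complex.ofReal_tsum, htel, Complex.ofReal_one]
      · rw [if_neg (by rw [hdt]; exact mul_ne_zero hc (neg_ne_zero.mpr h0))]
        simp only [hFG' _ _ _ h0, tsum_zero, Finset.sum_const_zero]
    · have h2 : P.dt l ≠ 0 := fun h => hl (P.dvd_of_dt h)
      simp [hl, h2]

end

section

variable {θ : ℝ} {P Q R S : Frame θ}

open _root_.NCTorus.Frame

namespace Kernel

lemma add_left_smul (f : Kernel P Q) (s : ℤ) (u : ℝ) (l : ℤ × ℤ) : f u (l + s • P.v) = f u l := by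
  induction s generalizing l with
  | zero => simp
  | succ n ih => rw [add_smul, one_smul, ← add_assoc, f.add_left, ih]
  | pred n ih => rw [sub_smul, one_smul, ← add_sub_assoc, f.sub_left, ih]

lemma add_right_smul (f : Kernel P Q) (s : ℤ) (u : ℝ) (l : ℤ × ℤ) :
    f u (l + s • Q.v) = f (u + s * Q.r) l := by
  induction s generalizing u l with
  | zero => simp
  | succ n ih =>
    rw [add_smul, one_smul, ← add_assoc, f.add_right', ih]
    congr 1
    push_cast
    ring
  | pred n ih =>
    rw [sub_smul, one_smul, ← add_sub_assoc]
    have h := f.sub_right (u - Q.r) (l + -(n : ℤ) • Q.v)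
    rw [sub_add_cancel] at h
    rw [h, ih]
    congr 1
    push_cast
    ring

lemma apply_fst (f : Kernel (O θ) P) (u : ℝ) (l : ℤ × ℤ) : f u (l.1, 0) = f u l := by
  rw [← f.add_left_smul (-l.2) u l]
  congr 1
  ext <;> simp

lemma apply_congr (f : Kernel (O θ) P) (u : ℝ) {l l' : ℤ × ℤ} (h : l.1 = l'.1) :
    f u l = f u l' := by rw [← apply_fst, h, apply_fst]

/-- Kernels depend on the vectors of their frames only. -/
def castRight (h : P.v = Q.v) : Kernel R P ≃ₗ[ℂ] Kernel R Q :=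
  have hr : P.r = Q.r := congrArg (proj θ) h
  have hx : x R P = x R Q := by
    have h1 : P.m = Q.m := by rw [Frame.m, Frame.m, hr, show P.c = Q.c from congrArg Prod.fst h]
    ext u l
    rw [x, x, h1]
  { toFun := fun f => ⟨f.toFun, hx ▸ f.isSchwartz, f.add_left, h ▸ hr ▸ f.add_right⟩
    invFun := fun f => ⟨f.toFun, hx ▸ f.isSchwartz, f.add_left, h ▸ hr ▸ f.add_right⟩
    map_add' := fun _ _ => rfl
    map_smul' := fun _ _ => rfl
    left_inv := fun _ => rfl
    right_inv := fun _ => rfl }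

@[simp] lemma castRight_apply (h : P.v = Q.v) (f : Kernel R P) (u : ℝ) (l : ℤ × ℤ) :
    castRight h f u l = f u l := rfl

lemma D_castRight (h : P.v = Q.v) (τ b : ℂ) (f : Kernel R P) :
    D τ b (castRight h f) = castRight h (D τ b f) := by
  ext u l
  have hr : P.r = Q.r := congrArg (proj θ) h
  have h1 : P.m = Q.m := by rw [Frame.m, Frame.m, hr, show P.c = Q.c from congrArg Prod.fst h]
  rw [castRight_apply, D_apply, D_apply, castRight_apply, x, x, h1]
  rfl

end Kernel

/-! ### Fourier series: the algebra `A_θ` as a space of kernels -/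

lemma hasDerivAt_e_mul (m : ℤ) (s u : ℝ) :
    HasDerivAt (fun u : ℝ => e (m * (u + s))) (2 * Real.pi * Complex.I * m * e (m * (u + s))) u := by
  have h := hasDerivAt_char m (-s) u
  have h1 : char m (-s) = fun u : ℝ => e (m * (u + s)) := by
    ext u; simp [char]
  rwa [h1] at h

lemma continuous_e_mul (m : ℤ) (s : ℝ) : Continuous fun u : ℝ => e (m * (u + s)) :=
  continuous_iff_continuousAt.mpr fun u => (hasDerivAt_e_mul m s u).continuousAt

lemma integral_e (m : ℤ) : ∫ u in (0 : ℝ)..1, e (m * u) = if m = 0 then 1 else 0 := by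
  by_cases hm : m = 0
  · simp [hm]
  · have hm' : (2 * Real.pi * Complex.I * m : ℂ) ≠ 0 := by
      simp [Real.pi_ne_zero, hm]
    have h := integral_exp_mul_complex (a := 0) (b := 1) hm'
    have h1 : ∀ u : ℝ, e (m * u) = Complex.exp (2 * Real.pi * Complex.I * m * u) := fun u => by
      rw [e]; congr 1; push_cast; ring
    simp_rw [h1, h, if_neg hm]
    have h2 := e_int m
    rw [e] at h2
    push_cast at h2
    simp [h2]

lemma A.summable_row (a : A θ) (n : ℤ) : Summable fun m : ℤ => ‖a.coeff (n, m)‖ :=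
  a.summable_norm.comp_injective (i := fun m : ℤ => (n, m)) fun _ _ h => (Prod.ext_iff.mp h).2

lemma e_mul_int_mul (m : ℤ) (t : ℝ) (j : ℤ) : e (m * (t + j)) = e (m * t) := by
  rw [mul_add, e_add, ← Int.cast_mul, e_int, mul_one]

lemma hasDerivAt_series (a : A θ) (n : ℤ) (u : ℝ) :
    HasDerivAt (fun u : ℝ => ∑' m : ℤ, a.coeff (n, m) * e (m * (u + n * θ)))
      (∑' m : ℤ, (A.delta 0 a).coeff (n, m) * e (m * (u + n * θ))) u := by
  have h2 := (A.delta 0 a).summable_row n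
  refine (hasDerivAt_tsum h2 (fun m y => (hasDerivAt_e_mul m (n * θ) y).const_mul
    (a.coeff (n, m))) (fun m y => ?_) (y₀ := u) ?_ u).congr_deriv ?_
  · simp [A.coeff_delta, mul_comm]
  · exact Summable.of_norm (by simpa using a.summable_row n)
  · refine tsum_congr fun m => ?_
    rw [A.coeff_delta]
    simp
    ring

/-- The kernel that represents the series `∑ a(n₁,n₂) U₁^n₁ U₂^n₂`. -/
def ofA : A θ →ₗ[ℂ] Kernel (O θ) (O θ) where
  toFun a :=
    { toFun := fun u l => ∑' m : ℤ, a.coeff (l.1, m) * e (m * (u + l.1 * θ))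
      isSchwartz := by
        -- The derivative of a series is the series with coefficients `2πi m a(n, m)`, that is, of
        -- `δ₀ a`.
        refine ⟨{f | ∃ a : A θ, f = fun u l => ∑' m : ℤ, a.coeff (l.1, m) * e (m * (u + l.1 * θ))},
          ⟨a, rfl⟩, ?_⟩
        rintro _ ⟨a, rfl⟩
        refine ⟨fun j => ⟨∑' n, weight n ^ j * ‖a.coeff n‖, fun u l => ?_⟩, _,
          ⟨A.delta 0 a, rfl⟩, fun u l => ?_⟩
        · have h1 : (1 + |x (O θ) (O θ) u l|) ^ j * ‖∑' m : ℤ, a.coeff (l.1, m) *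
              e (m * (u + l.1 * θ))‖ ≤ ∑' m : ℤ, weight (l.1, m) ^ j * ‖a.coeff (l.1, m)‖ := by
            have hs : Summable fun m : ℤ => ‖a.coeff (l.1, m) * e (m * (u + l.1 * θ))‖ := by
              simpa using a.summable_row l.1
            refine (mul_le_mul_of_nonneg_left (norm_tsum_le_tsum_norm hs) (by positivity)).trans ?_
            rw [← tsum_mul_left]
            refine (hs.mul_left _).tsum_le_tsum (fun m => ?_) ((a.summable j).comp_injective
              (i := fun m : ℤ => (l.1, m)) fun _ _ h => (Prod.ext_iff.mp h).2)
            rw [norm_mul, norm_e, mul_one, x_O_left, O_m, zero_mul, zero_add]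
            gcongr
            simp [weight]
          refine h1.trans ?_
          exact (tsum_comp_le_tsum_of_inj (a.summable j)
            (fun n => mul_nonneg (pow_nonneg (weight_pos n).le _) (norm_nonneg _))
            (i := fun m : ℤ => (l.1, m)) fun _ _ h => (Prod.ext_iff.mp h).2)
        · exact hasDerivAt_series a l.1 u
      add_left := fun u l => by simp
      add_right := fun u l => by
        simp only [O_v, O_r, Prod.fst_add, add_zero]
        refine tsum_congr fun m => ?_
        rw [← e_mul_int_mul m (u + l.1 * θ) (-1)]
        push_cast
        congr 3
        ring }
  map_add' a b := by
    ext u l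
    refine Eq.trans (tsum_congr fun m => by rw [A.coeff_add, add_mul]) (Summable.tsum_add
      (Summable.of_norm (by simpa using a.summable_row l.1))
      (Summable.of_norm (by simpa using b.summable_row l.1)))
  map_smul' k a := by
    ext u l
    exact Eq.trans (tsum_congr fun m => by rw [A.coeff_smul, mul_assoc]; rfl) tsum_mul_left

lemma ofA_apply (a : A θ) (u : ℝ) (l : ℤ × ℤ) :
    ofA a u l = ∑' m : ℤ, a.coeff (l.1, m) * e (m * (u + l.1 * θ)) := rfl

/-- The action of the series `a` on kernels from the frame of the trivial module. -/
lemma comp_ofA (f : Kernel (O θ) P) (a : A θ) (u : ℝ) (l : ℤ × ℤ) :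
    Kernel.comp f (ofA a) u l =
      ∑' n : ℤ × ℤ, a.coeff n * (e (n.2 * (u + l.1 * θ)) * f u (l.1 - n.1, 0)) := by
  obtain ⟨C, hC, hf⟩ := f.rapid.bound 0
  have hs : Summable fun n : ℤ × ℤ => a.coeff n * (e (n.2 * (u + l.1 * θ)) *
      f u (l.1 - n.1, 0)) := by
    refine Summable.of_norm_bounded (a.summable_norm.mul_right C) fun n => ?_
    rw [norm_mul, norm_mul, norm_e, one_mul]
    gcongr
    simpa using hf u (l.1 - n.1, 0)
  rw [hs.tsum_prod, Kernel.comp_apply, ← (Equiv.subLeft l.1).tsum_eq]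
  refine tsum_congr fun n => ?_
  rw [ofA_apply, ← tsum_mul_left]
  refine tsum_congr fun m => ?_
  have h1 : u + proj θ ((l.1 - n) • (O θ).p) + ((l - (l.1 - n) • (O θ).p).1 : ℤ) * θ
      = u + l.1 * θ := by
    simp [proj]; ring
  have h2 : (l - (l.1 - n) • (O θ).p).1 = n := by simp
  rw [Equiv.subLeft_apply, h1, h2]
  simp only [O_p, Prod.smul_mk, smul_eq_mul, mul_one, mul_zero]
  ring

/-- The Fourier coefficients of a kernel from `O` to `O`. -/
def fourier (f : Kernel (O θ) (O θ)) (n m : ℤ) : ℂ :=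
  ∫ u in (0 : ℝ)..1, e (-m * u) * f (u - n * θ) (n, 0)

lemma fourier_norm_le (f : Kernel (O θ) (O θ)) {C : ℝ} {n : ℤ}
    (h : ∀ u, ‖f u (n, 0)‖ ≤ C) (m : ℤ) : ‖fourier f n m‖ ≤ C := by
  have h1 := intervalIntegral.norm_integral_le_of_norm_le_const (a := 0) (b := 1)
    (f := fun u => e (-m * u) * f (u - n * θ) (n, 0)) (C := C) fun u _ => by
      rw [norm_mul, norm_e, one_mul]; exact h _
  rwa [sub_zero, abs_one, mul_one] at h1

lemma O_periodic (f : Kernel (O θ) (O θ)) (n : ℤ) :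
    Function.Periodic (fun u => f (u - n * θ) (n, 0)) 1 := fun u => by
  have h := f.add_right_smul 1 (u - n * θ) (n, 0)
  have h2 := f.add_left_smul 1 (u - n * θ) (n, 0)
  rw [h2, O_r] at h
  show f (u + 1 - n * θ) (n, 0) = f (u - n * θ) (n, 0)
  rw [h]
  congr 1
  push_cast
  ring

/-- Integration by parts; the boundary terms cancel by periodicity. -/
lemma fourier_D (f : Kernel (O θ) (O θ)) (n m : ℤ) :
    fourier (Kernel.D 0 0 f) n m = 2 * Real.pi * Complex.I * m * fourier f n m := by
  have hd : ∀ u, HasDerivAt (fun u => e (-m * u) * f (u - n * θ) (n, 0))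
      (-(2 * Real.pi * Complex.I * m) * (e (-m * u) * f (u - n * θ) (n, 0))
        + e (-m * u) * Kernel.D 0 0 f (u - n * θ) (n, 0)) u := fun u => by
    have h1 := hasDerivAt_e_mul (-m) 0 u
    have h2 := (f.hasDerivAt 0 0 (u - n * θ) (n, 0)).comp_sub_const u (n * θ)
    simp only [add_zero, Int.cast_neg] at h1
    refine (h1.mul h2).congr_deriv ?_
    simp
    ring
  have hc : Continuous fun u : ℝ => e (-m * u) := by
    have := continuous_e_mul (-m) 0
    simpa using this
  have hc1 : Continuous fun u => e (-m * u) * f (u - n * θ) (n, 0) :=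
    hc.mul ((f.continuous _).comp (continuous_id.sub continuous_const))
  have hc2 : Continuous fun u => e (-m * u) * Kernel.D 0 0 f (u - n * θ) (n, 0) :=
    hc.mul (((Kernel.D 0 0 f).continuous _).comp (continuous_id.sub continuous_const))
  have hc3 : Continuous fun u =>
      -(2 * Real.pi * Complex.I * m) * (e (-m * u) * f (u - n * θ) (n, 0)) :=
    continuous_const.mul hc1
  have h := intervalIntegral.integral_eq_sub_of_hasDerivAt (a := 0) (b := 1) (fun u _ => hd u)
    ((hc3.add hc2).intervalIntegrable _ _)
  rw [intervalIntegral.integral_add (hc3.intervalIntegrable _ _)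
    (hc2.intervalIntegrable _ _), intervalIntegral.integral_const_mul] at h
  have h3 : e (-m * 1) * f (1 - n * θ) (n, 0) = e (-m * 0) * f (0 - n * θ) (n, 0) := by
    have h4 := O_periodic f n 0
    have h5 := e_int (-m)
    simp only [zero_add] at h4
    push_cast at h5
    rw [h4, mul_one, h5]
    simp
  rw [h3, sub_self] at h
  rw [fourier, fourier]
  linear_combination h

/-- The decay in `n` is that of the kernel, and each derivative gains a factor `m`. -/
lemma fourier_decay (k j : ℕ) : ∀ f : Kernel (O θ) (O θ), ∃ C : ℝ, ∀ n m : ℤ,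
    |(m : ℝ)| ^ k * ((1 + |(n : ℝ)|) ^ j * ‖fourier f n m‖) ≤ C := by
  induction k with
  | zero =>
    intro f
    obtain ⟨C, hC, h⟩ := f.rapid.bound j
    refine ⟨C, fun n m => ?_⟩
    have h1 := fourier_norm_le f (n := n) (C := C * ((1 + |(n : ℝ)|) ^ j)⁻¹) (fun u => by
      simpa [x_O_left] using h u (n, 0)) m
    rw [← div_eq_mul_inv, le_div_iff₀ (by positivity)] at h1
    linarith
  | succ k ih =>
    intro f
    obtain ⟨C, hC⟩ := ih (Kernel.D 0 0 f)
    refine ⟨C, fun n m => le_trans ?_ (hC n m)⟩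
    have h1 : ‖(2 * Real.pi * Complex.I * m : ℂ)‖ = 2 * Real.pi * |(m : ℝ)| := by
      simp [abs_of_pos Real.pi_pos]
    have h2 : 1 ≤ 2 * Real.pi := by linarith [Real.pi_gt_three]
    rw [fourier_D, norm_mul, h1]
    calc _ = 1 * (|(m : ℝ)| ^ k * ((1 + |(n : ℝ)|) ^ j * (|(m : ℝ)| * ‖fourier f n m‖))) := by
          rw [pow_succ]; ring
      _ ≤ 2 * Real.pi * (|(m : ℝ)| ^ k * ((1 + |(n : ℝ)|) ^ j * (|(m : ℝ)| * ‖fourier f n m‖))) := by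
          gcongr
      _ = _ := by ring

/-- The element of `A_θ` with the Fourier coefficients of a kernel. -/
def toA (f : Kernel (O θ) (O θ)) : A θ where
  coeff n := fourier f n.1 n.2
  decay N := by
    obtain ⟨C, hC⟩ := fourier_decay 0 N f
    obtain ⟨D, hD⟩ := fourier_decay N N f
    refine ⟨2 ^ (N - 1) * (C + D), fun n => ?_⟩
    have h1 : weight n ^ N ≤ (1 + |(n.1 : ℝ)|) ^ N * (2 ^ (N - 1) * (1 + |(n.2 : ℝ)| ^ N)) := by
      have h2 := add_pow_le (zero_le_one' ℝ) (abs_nonneg (n.2 : ℝ)) N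
      rw [one_pow] at h2
      refine le_trans ?_ (mul_le_mul_of_nonneg_left h2 (by positivity))
      rw [← mul_pow]
      have := weight_pos n
      gcongr
      unfold weight
      nlinarith [mul_nonneg (abs_nonneg (n.1 : ℝ)) (abs_nonneg (n.2 : ℝ))]
    have h3 := hC n.1 n.2
    rw [pow_zero, one_mul] at h3
    calc _ ≤ ((1 + |(n.1 : ℝ)|) ^ N * (2 ^ (N - 1) * (1 + |(n.2 : ℝ)| ^ N)))
          * ‖fourier f n.1 n.2‖ := by gcongr
      _ = 2 ^ (N - 1) * ((1 + |(n.1 : ℝ)|) ^ N * ‖fourier f n.1 n.2‖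
          + |(n.2 : ℝ)| ^ N * ((1 + |(n.1 : ℝ)|) ^ N * ‖fourier f n.1 n.2‖)) := by ring
      _ ≤ _ := by gcongr; exact hD n.1 n.2

lemma toA_ofA (a : A θ) : toA (ofA a) = a := by
  ext ⟨n, m⟩
  show ∫ u in (0 : ℝ)..1, e (-m * u) * ofA a (u - n * θ) (n, 0) = _
  have h1 : ∀ u : ℝ, e (-m * u) * ofA a (u - n * θ) (n, 0) =
      ∑' k : ℤ, a.coeff (n, k) * e (((k - m : ℤ) : ℝ) * (u + 0)) := fun u => by
    rw [ofA_apply, ← tsum_mul_left]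
    refine tsum_congr fun k => ?_
    rw [sub_add_cancel, mul_left_comm, ← e_add]
    congr 2
    push_cast
    ring
  have hcont : ∀ k : ℤ, Continuous fun u : ℝ =>
      a.coeff (n, k) * e (((k - m : ℤ) : ℝ) * (u + 0)) := fun k =>
    continuous_const.mul (continuous_e_mul (k - m) 0)
  simp_rw [h1]
  have h := MeasureTheory.hasSum_integral_of_summable_integral_norm
    (μ := MeasureTheory.volume.restrict (Set.Ioc (0 : ℝ) 1))
    (F := fun (k : ℤ) (u : ℝ) => a.coeff (n, k) * e (((k - m : ℤ) : ℝ) * (u + 0)))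
    (fun k => ((hcont k).intervalIntegrable 0 1).1) (by
      simpa [norm_mul] using a.summable_row n)
  rw [intervalIntegral.integral_of_le zero_le_one, ← h.tsum_eq, tsum_eq_single m]
  · simp
  · intro k hk
    rw [← intervalIntegral.integral_of_le zero_le_one, intervalIntegral.integral_const_mul]
    simp only [add_zero]
    rw [integral_e, if_neg (sub_ne_zero.mpr hk), mul_zero]

/-- Fourier inversion on the circle `ℝ / ℤ`, for each `n` separately. -/
lemma ofA_toA (f : Kernel (O θ) (O θ)) : ofA (toA f) = f := by
  ext u l
  rw [← Kernel.apply_fst f, ofA_apply]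
  set n := l.1
  have : Fact ((0 : ℝ) < 1) := ⟨one_pos⟩
  have hp := O_periodic f n
  let F : C(AddCircle (1 : ℝ), ℂ) := ⟨hp.lift, by
    refine continuous_coinduced_dom.mpr ?_
    exact (f.continuous (n, 0)).comp (continuous_id.sub continuous_const)⟩
  have hF : ∀ y : ℝ, F (y : AddCircle (1 : ℝ)) = f (y - n * θ) (n, 0) := fun y => rfl
  have hfe : ∀ (k : ℤ) (y : ℝ), _root_.fourier k (y : AddCircle (1 : ℝ)) = e (k * y) := by
    intro k y
    rw [fourier_coe_apply, e]
    congr 1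
    push_cast
    ring
  have hcoeff : ∀ k : ℤ, fourierCoeff F k = (toA f).coeff (n, k) := fun k => by
    rw [fourierCoeff_eq_intervalIntegral _ _ 0]
    show _ = fourier f n k
    simp only [hfe, hF, zero_add, one_div_one, one_smul, smul_eq_mul, Int.cast_neg]
    rfl
  have hsum : Summable (fourierCoeff F) := by
    simp_rw [funext hcoeff]
    exact Summable.of_norm ((toA f).summable_row n)
  have h := has_pointwise_sum_fourier_series_of_summable hsum ((u + n * θ : ℝ) : AddCircle (1 : ℝ))
  rw [hF, add_sub_cancel_right] at h
  rw [← h.tsum_eq]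
  refine tsum_congr fun k => ?_
  rw [hcoeff, hfe, smul_eq_mul]

/-- The algebra `A_θ` as the space of kernels from `O` to `O`. -/
def equivA : A θ ≃ₗ[ℂ] Kernel (O θ) (O θ) :=
  { ofA with invFun := toA, left_inv := toA_ofA, right_inv := ofA_toA }

end

section

variable {θ : ℝ} {P Q R S : Frame θ} {τ : ℂ}

open _root_.NCTorus.Frame

/-! ### Morphisms between standard bundles as kernels -/

/-- An identification of a module with a holomorphic structure with the kernels from the trivial
frame to `P`: the algebra acts by composition and the holomorphic structure becomes `D τ z`. -/
structure Model (E : HolModule θ τ) (P : Frame θ) (z : ℂ) where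
  β : E.carrier ≃ₗ[ℂ] Kernel (O θ) P
  smul : ∀ f a, β (MulOpposite.op a • f) = Kernel.comp (β f) (ofA a)
  nabla : ∀ f, β (E.nabla f) = Kernel.D τ z (β f)

/-- The product of `A_θ` corresponds to the composition of kernels. -/
lemma comp_ofA_mul (hv : (O θ).v = P.v) (f a : A θ) :
    Kernel.castRight hv (ofA (f * a)) = Kernel.comp (Kernel.castRight hv (ofA f)) (ofA a) := by
  ext u l
  rw [comp_ofA, Kernel.castRight_apply, ofA_apply]
  set y : ℝ := u + l.1 * θ
  -- Both sides are sums over `ℤ²`; the value of the kernel at `(u, l)` is the sum of the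
  -- coefficients against this bounded weight.
  let F : ℤ × ℤ → ℂ := fun j => if j.1 = l.1 then e (j.2 * y) else 0
  have hF : ∀ j, ‖F j‖ ≤ 1 := fun j => by
    by_cases h : j.1 = l.1 <;> simp [F, h]
  have hinj : ∀ n : ℤ, Function.Injective fun m : ℤ => (n, m) :=
    fun _ _ _ h => (Prod.ext_iff.mp h).2
  have row : ∀ (n : ℤ) (g : ℤ × ℤ → ℂ), (∀ j, j.1 ≠ n → g j = 0) →
      ∑' j, g j = ∑' m : ℤ, g (n, m) := fun n g hg => by
    refine ((hinj n).tsum_eq fun j hj => ?_).symm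
    by_cases h : j.1 = n
    · exact ⟨j.2, by rw [← h]⟩
    · exact absurd (hg j h) hj
  have h1 := row l.1 (fun j => (f * a).coeff j * F j) fun j hj => by simp [F, hj]
  simp only [F, if_true] at h1
  rw [← h1, A.tsum_mul_coeff_right f a hF]
  refine tsum_congr fun n => ?_
  congr 1
  rw [row (l.1 - n.1) _ fun j hj => by
      have : j.1 + n.1 ≠ l.1 := fun h => hj (by omega)
      simp [F, this],
    Kernel.castRight_apply, ofA_apply, ← tsum_mul_left]
  refine tsum_congr fun m => ?_
  have h2 : F ((l.1 - n.1, m) + n) = e ((m + n.2 : ℝ) * y) := by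
    simp [F]
  have h3 : -(θ * m * n.1) + (m + n.2 : ℝ) * y
      = n.2 * y + m * (u + ((l.1 - n.1 : ℤ) : ℝ) * θ) := by
    simp only [y]; push_cast; ring
  rw [h2, A.phase, ← e_add, h3, e_add]
  ring

lemma D_ofA (z : ℂ) (f : A θ) : Kernel.D τ z (ofA f) =
    (2 * Real.pi * Complex.I * z : ℂ) • ofA f + ofA (A.delta τ f) := by
  refine Kernel.D_eq_of_hasDerivAt fun u l => (hasDerivAt_series f l.1 u).congr_deriv ?_
  have h1 : ofA (A.delta τ f) = ofA (A.delta 0 f) +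
      ofA (A.delta τ f - A.delta 0 f) := by rw [map_sub]; abel
  have h2 : ofA (A.delta τ f - A.delta 0 f) u l
      = 2 * Real.pi * Complex.I * (τ * l.1) * ofA f u l := by
    rw [ofA_apply, ofA_apply, ← tsum_mul_left]
    refine tsum_congr fun m => ?_
    rw [sub_eq_add_neg, A.coeff_add, A.coeff_neg, A.coeff_delta, A.coeff_delta]
    ring
  rw [h1, Kernel.add_apply, Kernel.add_apply, Kernel.smul_apply, h2, x_O_left, O_m]
  have h3 : ofA (A.delta 0 f) u l = ∑' m : ℤ, (A.delta 0 f).coeff (l.1, m) *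
    e (m * (u + l.1 * θ)) := rfl
  rw [h3]
  push_cast
  ring

/-- The model of the trivial module. -/
def trivialModel (hc : P.c = 0) (z : ℂ) : Model (trivialBundle θ τ z) P z where
  β := equivA.trans (Kernel.castRight (v_eq_of_c_eq_zero hc).symm)
  smul f a := comp_ofA_mul (v_eq_of_c_eq_zero hc).symm f a
  nabla (f : A θ) := by
    have hv := (v_eq_of_c_eq_zero hc).symm
    show Kernel.castRight hv (ofA ((2 * Real.pi * Complex.I * z : ℂ) • f + A.delta τ f)) =
      Kernel.D τ z (Kernel.castRight hv (ofA f))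
    rw [Kernel.D_castRight, D_ofA, map_add, map_smul]

lemma exists_val_eq {c : ℤ} (hc : c ≠ 0) (n : ℤ) :
    ∃ j : ℤ, n = ((n : ZMod c.natAbs).val : ℤ) + c * j := by
  have : NeZero c.natAbs := ⟨Int.natAbs_ne_zero.mpr hc⟩
  have h : ((n - ((n : ZMod c.natAbs).val : ℤ) : ℤ) : ZMod c.natAbs) = 0 := by
    push_cast
    simp
  rw [ZMod.intCast_zmod_eq_zero_iff_dvd] at h
  obtain ⟨j, hj⟩ := Int.natAbs_dvd.mp h
  exact ⟨j, by linarith⟩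

lemma intCast_self_natAbs (c : ℤ) : (c : ZMod c.natAbs) = 0 :=
  (ZMod.intCast_zmod_eq_zero_iff_dvd _ _).mpr (Int.natAbs_dvd.mpr dvd_rfl)

/-- The identification of `𝓢(ℝ × ℤ/cℤ)` with a space of kernels. -/
def schwartzEquiv (hc : P.c ≠ 0) : SchwartzModule θ P.c P.d ≃ₗ[ℂ] Kernel (O θ) P :=
  have hc' : (P.c : ℝ) ≠ 0 := by exact_mod_cast hc
  have hr := P.r_ne
  have : NeZero P.c.natAbs := ⟨Int.natAbs_ne_zero.mpr hc⟩
  have hx : ∀ u l, x (O θ) P u l = P.c / P.r * (u + l.1 * (P.r / P.c)) := fun u l => by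
    rw [x_O_left, Frame.m]
    field_simp
  { toFun := fun F =>
      { toFun := fun u l => F (l.1 : ZMod P.c.natAbs) (u + l.1 * (P.r / P.c))
        isSchwartz := isSchwartz_of_family (F := fun l => F (l.1 : ZMod P.c.natAbs)) hx
          fun j k => ⟨∑ α, SchwartzMap.seminorm ℂ j k (F α), fun l =>
            Finset.single_le_sum (f := fun α => SchwartzMap.seminorm ℂ j k (F α))
              (fun _ _ => apply_nonneg _ _) (Finset.mem_univ _)⟩
        add_left := fun u l => by simp
        add_right := fun u l => by
          have h : u - P.r + ((l + P.v).1 : ℤ) * (P.r / P.c) = u + l.1 * (P.r / P.c) := by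
            simp only [v, Prod.fst_add]
            push_cast
            field_simp
            ring
          rw [h]
          simp [v, intCast_self_natAbs] }
    map_add' := fun _ _ => rfl
    map_smul' := fun _ _ => rfl
    invFun := fun f α => toSchwartz f.isSchwartz (α.val, 0) (α.val * (P.r / P.c)) (P.c / P.r)
      (div_ne_zero hc' hr) fun u => by rw [hx]; simp
    left_inv := fun F => by
      ext α y
      rw [toSchwartz_apply]
      show F (((α.val : ℤ)) : ZMod P.c.natAbs) (_ - _ + ((α.val : ℤ) : ℝ) * _) = _
      rw [Int.cast_natCast, Int.cast_natCast, ZMod.natCast_zmod_val, sub_add_cancel]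
    -- A kernel is determined by its values at representatives of the classes of `l.1` modulo `c`.
    right_inv := fun f => by
      ext u l
      show toSchwartz f.isSchwartz _ _ _ _ _ (u + l.1 * (P.r / P.c)) = _
      rw [toSchwartz_apply]
      obtain ⟨j, hj⟩ := exists_val_eq hc l.1
      have h1 := f.add_right_smul j u (((l.1 : ZMod P.c.natAbs).val : ℤ), 0)
      rw [Kernel.apply_congr f u (l' := l) (by
        show _ + j * P.c = l.1
        linarith)] at h1
      rw [h1]
      congr 1
      have hj' : (l.1 : ℝ) = ((l.1 : ZMod P.c.natAbs).val : ℝ) + P.c * j := by exact_mod_cast hj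
      rw [hj']
      field_simp
      ring }

lemma schwartzEquiv_apply (hc : P.c ≠ 0) (F : SchwartzModule θ P.c P.d) (u : ℝ) (l : ℤ × ℤ) :
    schwartzEquiv hc F u l = F (l.1 : ZMod P.c.natAbs) (u + l.1 * (P.r / P.c)) := rfl

lemma schwartzEquiv_smul (hc : P.c ≠ 0) [NeZero P.c] (F : SchwartzModule θ P.c P.d) (a : A θ) :
    schwartzEquiv hc (MulOpposite.op a • F) = Kernel.comp (schwartzEquiv hc F) (ofA a) := by
  have hc' : (P.c : ℝ) ≠ 0 := by exact_mod_cast hc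
  ext u l
  rw [comp_ofA]
  refine (SchwartzModule.op_smul_apply F a _ _).trans (tsum_congr fun n => ?_)
  rw [SchwartzModule.actMono_apply, schwartzEquiv_apply]
  obtain ⟨j, hj⟩ := exists_val_eq hc l.1
  have hj' : ((l.1 : ZMod P.c.natAbs).val : ℝ) = l.1 - P.c * j := by
    rw [eq_sub_iff_add_eq]; exact_mod_cast hj.symm
  have h1 : (n.2 : ℝ) * (u + l.1 * (P.r / P.c) - ((l.1 : ZMod P.c.natAbs).val : ℝ) * P.d / P.c)
      = n.2 * (u + l.1 * θ) + ((n.2 * P.d * j : ℤ) : ℝ) := by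
    rw [hj', r_def]
    push_cast
    field_simp
    ring
  have h2 : u + l.1 * (P.r / P.c) - n.1 * ((P.d + P.c * θ) / P.c)
      = u + ((l.1 - n.1 : ℤ) : ℝ) * (P.r / P.c) := by
    rw [r_def]; push_cast; ring
  rw [h1, e_add, e_int, mul_one, h2, ← Int.cast_sub (R := ZMod P.c.natAbs)]

lemma schwartzEquiv_nabla (hc : P.c ≠ 0) (z : ℂ) (F : SchwartzModule θ P.c P.d) :
    schwartzEquiv hc (SchwartzModule.nabla τ z F) = Kernel.D τ z (schwartzEquiv hc F) := by
  refine (Kernel.D_eq_of_hasDerivAt fun u l => ?_).symm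
  have hc' : (P.c : ℝ) ≠ 0 := by exact_mod_cast hc
  have h1 : (schwartzEquiv hc (SchwartzModule.nabla τ z F) : ℝ → ℤ × ℤ → ℂ) u l = _ :=
    SchwartzModule.nabla_apply τ z F _ _
  have h2 := ((F (l.1 : ZMod P.c.natAbs)).hasDerivAt
    (u + l.1 * (P.r / P.c))).comp_add_const u (l.1 * (P.r / P.c))
  refine h2.congr_deriv ?_
  refine Eq.trans ?_ (congrArg (· - _) h1.symm)
  have h3 : P.c / (P.d + P.c * θ) * (u + l.1 * (P.r / P.c)) = x (O θ) P u l := by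
    have := P.r_ne
    have hr' : (P.d + P.c * θ : ℝ) = P.r := by rw [r_def]; ring
    rw [x_O_left, hr', Frame.m]
    field_simp
  rw [← h3, schwartzEquiv_apply]
  push_cast
  ring

/-- The model of a basic module of Schwartz functions. -/
def schwartzModel (hc : P.c ≠ 0) (hr : (P.d + P.c * θ : ℝ) ≠ 0) (z : ℂ) :
    Model (schwartzBundle θ τ P.c P.d hc hr z) P z :=
  have : NeZero P.c := ⟨hc⟩
  { β := schwartzEquiv hc
    smul := schwartzEquiv_smul hc
    nabla := schwartzEquiv_nabla hc z }

/-- Every standard bundle of positive rank is a space of kernels. -/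
theorem exists_model (P : Frame θ) (τ z : ℂ) :
    Nonempty (Model (standardBundle θ τ P.g P.pos.ne' z) P z) := by
  unfold standardBundle
  split_ifs with hc
  · exact ⟨trivialModel hc z⟩
  · exact ⟨schwartzModel hc _ z⟩

namespace Model

open HolModule

variable {E E' E'' : HolModule θ τ} {z z' z'' : ℂ} (M : Model E P z) (M' : Model E' Q z')
  (M'' : Model E'' R z'')

/-- The `A_θ`-linear map given by composition with a kernel. -/
def toMor : Kernel P Q →ₗ[ℂ] Mor E E' where
  toFun k :=
    { toFun := fun f => M'.β.symm (Kernel.comp k (M.β f))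
      map_add' := fun f g => by rw [map_add, Kernel.comp_add, map_add]
      map_smul' := fun a f => by
        obtain ⟨a, rfl⟩ := MulOpposite.op_surjective a
        apply M'.β.injective
        rw [RingHom.id_apply]
        have h := M.smul f a
        have h' := M'.smul (M'.β.symm (Kernel.comp k (M.β f))) a
        refine Eq.trans ?_ h'.symm
        rw [LinearEquiv.apply_symm_apply, LinearEquiv.apply_symm_apply, Kernel.comp_assoc, ← h] }
  map_add' k k' := by
    ext f
    show M'.β.symm _ = M'.β.symm _ + M'.β.symm _
    rw [Kernel.add_comp, map_add]
  map_smul' c k := by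
    ext f
    show M'.β.symm _ = c • M'.β.symm _
    rw [Kernel.smul_comp, map_smul]

lemma toMor_apply (k : Kernel P Q) (f : E.carrier) :
    toMor M M' k f = M'.β.symm (Kernel.comp k (M.β f)) := rfl

lemma toMor_comp (k' : Kernel Q R) (k : Kernel P Q) :
    toMor M M'' (Kernel.comp k' k) = toMor M' M'' k' ∘ₗ toMor M M' k := by
  ext f
  rw [LinearMap.comp_apply, toMor_apply, toMor_apply, toMor_apply, LinearEquiv.apply_symm_apply,
    Kernel.comp_assoc]

lemma toMor_id : toMor M M (Kernel.id P P rfl) = LinearMap.id := by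
  ext f
  rw [toMor_apply, Kernel.id_comp, LinearEquiv.symm_apply_apply, LinearMap.id_apply]

lemma d_toMor (k : Kernel P Q) : d E E' (toMor M M' k) = toMor M M' (Kernel.D τ (z' - z) k) := by
  ext f
  apply M'.β.injective
  rw [d_apply, map_sub, M'.nabla, toMor_apply, toMor_apply, toMor_apply,
    LinearEquiv.apply_symm_apply, LinearEquiv.apply_symm_apply, LinearEquiv.apply_symm_apply,
    M.nabla]
  have h := Kernel.D_comp (τ := τ) z (z' - z) k (M.β f)
  rw [add_sub_cancel] at h
  rw [h, add_sub_cancel_right]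

lemma comp_eq_sum {n : ℕ} {f : Fin n → Kernel (O θ) P} {h : Fin n → Kernel P (O θ)}
    (hfh : ∑ i, Kernel.comp (f i) (h i) = Kernel.id P P rfl) (g : Kernel R P) :
    ∑ i, Kernel.comp (f i) (Kernel.comp (h i) g) = g := by
  let L : Kernel P P →+ Kernel R P :=
    { toFun := fun k => Kernel.comp k g
      map_zero' := by simpa using Kernel.smul_comp 0 0 g
      map_add' := fun k k' => Kernel.add_comp k k' g }
  have h1 := congrArg L hfh
  rw [map_sum] at h1
  refine Eq.trans (Finset.sum_congr rfl fun i _ => ?_) (h1.trans (Kernel.id_comp g))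
  exact (Kernel.comp_assoc _ _ _).symm

/-- Every `A_θ`-linear map is given by a unique kernel. -/
lemma toMor_bijective : Function.Bijective (toMor M M') := by
  -- Injectivity: if `k` annihilates all kernels from `O` then `k = ∑ (k f_i) h_i = 0`.
  -- Surjectivity: an element `g` is `∑ f_i a_i` with `a_i = h_i g` in the algebra, so that `T` is
  -- determined by the elements `T f_i`, and is given by the kernel `∑ (T f_i) h_i`.
  obtain ⟨n, f, h, hfh⟩ := exists_partition P
  constructor
  · rw [injective_iff_map_eq_zero]
    intro k hk
    have h1 : ∀ g : Kernel (O θ) P, Kernel.comp k g = 0 := fun g => by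
      have h2 := congrArg M'.β (LinearMap.congr_fun hk (M.β.symm g))
      rwa [toMor_apply, LinearEquiv.apply_symm_apply, LinearEquiv.apply_symm_apply,
        LinearMap.zero_apply, map_zero] at h2
    let L : Kernel P P →+ Kernel P Q :=
      { toFun := fun g => Kernel.comp k g
        map_zero' := by simpa using Kernel.comp_smul 0 k 0
        map_add' := fun g g' => Kernel.comp_add k g g' }
    have h3 := congrArg L hfh
    rw [map_sum] at h3
    refine (Kernel.comp_id k).symm.trans (h3.symm.trans (Finset.sum_eq_zero fun i _ => ?_))
    show Kernel.comp k (Kernel.comp (f i) (h i)) = 0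
    rw [← Kernel.comp_assoc, h1]
    simpa using Kernel.smul_comp 0 0 (h i)
  · intro T
    refine ⟨∑ i, Kernel.comp (M'.β (T (M.β.symm (f i)))) (h i), ?_⟩
    ext g
    apply M'.β.injective
    have h1 : ∀ i, ∃ a, ofA a = Kernel.comp (h i) (M.β g) := fun i => equivA.surjective _
    choose a ha using h1
    have h2 : ∑ i, MulOpposite.op (a i) • M.β.symm (f i) = g := by
      apply M.β.injective
      rw [map_sum, ← comp_eq_sum hfh (M.β g)]
      refine Finset.sum_congr rfl fun i _ => ?_
      rw [M.smul, LinearEquiv.apply_symm_apply, ha]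
    rw [toMor_apply, LinearEquiv.apply_symm_apply]
    conv_rhs => rw [← h2, map_sum, map_sum]
    let L : Kernel P Q →+ Kernel (O θ) Q :=
      { toFun := fun k => Kernel.comp k (M.β g)
        map_zero' := by simpa using Kernel.smul_comp 0 0 (M.β g)
        map_add' := fun k k' => Kernel.add_comp k k' (M.β g) }
    refine (map_sum L _ _).trans (Finset.sum_congr rfl fun i _ => ?_)
    rw [map_smul, M'.smul, ha]
    exact Kernel.comp_assoc _ _ _

/-- The `A_θ`-linear maps are the kernels. -/
def morEquiv : Kernel P Q ≃ₗ[ℂ] Mor E E' :=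
  LinearEquiv.ofBijective (toMor M M') (toMor_bijective M M')

end Model

end

section

variable {θ : ℝ} {P Q R S : Frame θ} {τ b : ℂ}

open _root_.NCTorus.Frame

/-! ### Gaussian solutions of the Cauchy–Riemann equation -/

/-- Gaussians beat polynomials. -/
lemma exists_gaussian_bound {A : ℝ} (hA : 0 < A) (B : ℝ) (j : ℕ) :
    ∃ M : ℝ, 0 < M ∧ ∀ w : ℝ, (1 + |w|) ^ j * Real.exp (-A * w ^ 2 + B * |w|) ≤ M := by
  refine ⟨j.factorial * Real.exp (1 + (B + 1) ^ 2 / (4 * A)), by positivity, fun w => ?_⟩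
  have h1 := Real.pow_div_factorial_le_exp (x := 1 + |w|) (by positivity) j
  rw [div_le_iff₀ (by positivity)] at h1
  have h2 : 1 + |w| + (-A * w ^ 2 + B * |w|) ≤ 1 + (B + 1) ^ 2 / (4 * A) := by
    rw [← sq_abs w]
    have h3 : (B + 1) * |w| - A * |w| ^ 2 ≤ (B + 1) ^ 2 / (4 * A) := by
      rw [le_div_iff₀ (by positivity)]
      nlinarith [sq_nonneg (B + 1 - 2 * A * |w|)]
    linarith
  calc _ ≤ Real.exp (1 + |w|) * j.factorial * Real.exp (-A * w ^ 2 + B * |w|) := by gcongr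
    _ = j.factorial * Real.exp (1 + |w| + (-A * w ^ 2 + B * |w|)) := by
        rw [Real.exp_add (1 + |w|)]; ring
    _ ≤ _ := by gcongr

lemma hasDerivAt_cexp_quadratic (α β : ℂ) (u : ℝ) (l : ℤ × ℤ) :
    HasDerivAt (fun s => Complex.exp (α * (x P Q s l : ℂ) ^ 2 + β * x P Q s l))
      ((Q.m - P.m : ℝ) * (2 * α * x P Q u l + β) *
        Complex.exp (α * (x P Q u l : ℂ) ^ 2 + β * x P Q u l)) u := by
  have hx := (hasDerivAt_x P Q l u).ofReal_comp
  refine (((hx.pow 2).const_mul α).add (hx.const_mul β)).cexp.congr_deriv ?_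
  simp
  ring

/-- A decaying Gaussian of the coordinate `x` is a Schwartz function. -/
lemma isSchwartz_cexp {α : ℂ} (hα : α.re < 0) (β : ℂ) :
    IsSchwartz (x P Q) fun u l => Complex.exp (α * (x P Q u l : ℂ) ^ 2 + β * x P Q u l) := by
  refine IsSchwartz.of_ode (fun u l => hasDerivAt_x P Q l u) (fun j => ?_) IsSchwartz.zero
    (-(Q.m - P.m : ℝ) * 2 * α) (-(Q.m - P.m : ℝ) * β) fun u l => ?_
  · obtain ⟨M, hM, h⟩ := exists_gaussian_bound (neg_pos.mpr hα) |β.re| j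
    refine ⟨M, fun u l => le_trans ?_ (h (x P Q u l))⟩
    rw [Complex.norm_exp]
    gcongr
    have h1 : (α * (x P Q u l : ℂ) ^ 2 + β * x P Q u l).re
        = α.re * x P Q u l ^ 2 + β.re * x P Q u l := by
      rw [← Complex.ofReal_pow, Complex.add_re, Complex.re_mul_ofReal, Complex.re_mul_ofReal]
    rw [h1, neg_neg, ← abs_mul]
    linarith [le_abs_self (β.re * x P Q u l)]
  · refine (hasDerivAt_cexp_quadratic α β u l).congr_deriv ?_
    simp only [Pi.zero_apply]
    ring

/-- The solution `exp(-2πi(τx²/2 + bx)/μ)` of the equation `D τ b f = 0`, where `μ` is the difference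
of the slopes of the two frames. -/
def gauss (P Q : Frame θ) (τ b : ℂ) (u : ℝ) (l : ℤ × ℤ) : ℂ :=
  Complex.exp (-(2 * Real.pi * Complex.I) * (τ * (x P Q u l : ℂ) ^ 2 / 2 + b * x P Q u l)
    / (Q.m - P.m : ℝ))

lemma gauss_ne_zero (u : ℝ) (l : ℤ × ℤ) : gauss P Q τ b u l ≠ 0 := Complex.exp_ne_zero _

lemma gauss_eq (u : ℝ) (l : ℤ × ℤ) : gauss P Q τ b u l =
    Complex.exp (-(Real.pi * Complex.I * τ / (Q.m - P.m : ℝ)) * (x P Q u l : ℂ) ^ 2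
      + -(2 * Real.pi * Complex.I * b / (Q.m - P.m : ℝ)) * x P Q u l) := by
  rw [gauss]; congr 1; ring

lemma re_I_mul_div (z : ℂ) (s : ℝ) : (-(Real.pi * Complex.I * z / s)).re = Real.pi * z.im / s := by
  rw [← neg_div, Complex.div_ofReal_re]
  simp

lemma gauss_add_left (u : ℝ) (l : ℤ × ℤ) : gauss P Q τ b u (l + P.v) = gauss P Q τ b u l := by
  rw [gauss, x_add_left, gauss]

lemma gauss_add_right (u : ℝ) (l : ℤ × ℤ) :
    gauss P Q τ b (u - Q.r) (l + Q.v) = gauss P Q τ b u l := by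
  rw [gauss, x_add_right, gauss]

lemma gauss_congr_left {P' : Frame θ} (h : P.v = P'.v) (u : ℝ) (l : ℤ × ℤ) :
    gauss P Q τ b u l = gauss P' Q τ b u l := by
  have h2 : P.m = P'.m := by
    rw [Frame.m, Frame.m, show P.r = P'.r from congrArg (proj θ) h,
      show P.c = P'.c from congrArg Prod.fst h]
  simp only [gauss, x, h2]

lemma gauss_congr_right {Q' : Frame θ} (h : Q.v = Q'.v) (u : ℝ) (l : ℤ × ℤ) :
    gauss P Q τ b u l = gauss P Q' τ b u l := by
  have h2 : Q.m = Q'.m := by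
    rw [Frame.m, Frame.m, show Q.r = Q'.r from congrArg (proj θ) h,
      show Q.c = Q'.c from congrArg Prod.fst h]
  simp only [gauss, x, h2]

section

variable (hμ : Q.m - P.m ≠ 0)
include hμ

lemma hasDerivAt_gauss (u : ℝ) (l : ℤ × ℤ) : HasDerivAt (fun s => gauss P Q τ b s l)
    (-(2 * Real.pi * Complex.I * (τ * x P Q u l + b)) * gauss P Q τ b u l) u := by
  have hμ' : ((Q.m - P.m : ℝ) : ℂ) ≠ 0 := by exact_mod_cast hμ
  simp only [gauss_eq]
  refine (hasDerivAt_cexp_quadratic _ _ u l).congr_deriv ?_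
  field_simp
  ring

lemma continuous_gauss (l : ℤ × ℤ) : Continuous fun s => gauss P Q τ b s l :=
  continuous_iff_continuousAt.mpr fun u => (hasDerivAt_gauss hμ u l).continuousAt

lemma continuous_div_gauss (f : Kernel P Q) (l : ℤ × ℤ) :
    Continuous fun s => f s l / gauss P Q τ b s l :=
  (f.continuous l).div (continuous_gauss hμ l) fun _ => gauss_ne_zero _ _

lemma hasDerivAt_div_gauss (f : Kernel P Q) (u : ℝ) (l : ℤ × ℤ) :
    HasDerivAt (fun s => f s l / gauss P Q τ b s l)
      (Kernel.D τ b f u l / gauss P Q τ b u l) u := by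
  have hg := gauss_ne_zero (P := P) (Q := Q) (τ := τ) (b := b) u l
  refine ((f.hasDerivAt τ b u l).div (hasDerivAt_gauss hμ u l) hg).congr_deriv ?_
  field_simp
  ring

/-- The multiplier of the Gaussian in a solution. -/
lemma eq_mul_gauss {f : Kernel P Q} (hf : Kernel.D τ b f = 0) (u : ℝ) (l : ℤ × ℤ) :
    f u l = f 0 l / gauss P Q τ b 0 l * gauss P Q τ b u l := by
  have h := hasDerivAt_div_gauss (τ := τ) (b := b) hμ f
  have h1 := is_const_of_deriv_eq_zero (fun v => (h v l).differentiableAt)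
    (fun v => by rw [(h v l).deriv, hf]; simp) u 0
  rw [← h1, div_mul_cancel₀ _ (gauss_ne_zero _ _)]

/-- Variation of constants. -/
lemma hasDerivAt_gauss_mul {J : ℝ → ℂ} {k : ℂ} {u : ℝ} {l : ℤ × ℤ}
    (hJ : HasDerivAt J (k / gauss P Q τ b u l) u) :
    HasDerivAt (fun s => gauss P Q τ b s l * J s)
      (k - (2 * Real.pi * Complex.I * τ * x P Q u l + 2 * Real.pi * Complex.I * b) *
        (gauss P Q τ b u l * J u)) u := by
  have hg := gauss_ne_zero (P := P) (Q := Q) (τ := τ) (b := b) u l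
  refine ((hasDerivAt_gauss hμ u l).mul hJ).congr_deriv ?_
  field_simp
  ring

/-- The Gaussian at `u` controls the one at `s` as long as passing from `s` to `u` decreases it. -/
lemma exists_ratio_bound (hτ : τ.im < 0) {f : ℝ → ℤ × ℤ → ℂ} (hf : Rapid (x P Q) f) (j : ℕ) :
    ∃ C : ℝ, 0 < C ∧ ∀ u s l,
      |Q.m - P.m| * (x P Q u l - x P Q s l) ^ 2
        ≤ (Q.m - P.m) * (x P Q u l ^ 2 - x P Q s l ^ 2) →
      (1 + |x P Q u l|) ^ j * ‖gauss P Q τ b u l * (f s l / gauss P Q τ b s l)‖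
        ≤ C * (1 + (u - s) ^ 2)⁻¹ := by
  set μ := Q.m - P.m with hμd
  have hμ' : 0 < |μ| := abs_pos.mpr hμ
  have hA : 0 < -Real.pi * τ.im / |μ| := div_pos (by nlinarith [Real.pi_pos]) hμ'
  obtain ⟨M, hM, hM'⟩ := exists_gaussian_bound hA |2 * Real.pi * b.im / μ| (j + 2)
  obtain ⟨C, hC, hC'⟩ := hf.bound j
  refine ⟨C * M * (1 + (μ ^ 2)⁻¹), by positivity, fun u s l h => ?_⟩
  set X := x P Q u l
  set Y := x P Q s l
  have hXY : X - Y = μ * (u - s) := by simp only [X, Y, x_eq, μ]; ring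
  have hre : ∀ v, ‖gauss P Q τ b v l‖ = Real.exp (Real.pi * τ.im / μ * x P Q v l ^ 2 +
      2 * Real.pi * b.im / μ * x P Q v l) := fun v => by
    rw [gauss_eq, Complex.norm_exp, ← Complex.ofReal_pow, Complex.add_re, Complex.re_mul_ofReal,
      Complex.re_mul_ofReal, re_I_mul_div]
    have : -(2 * Real.pi * Complex.I * b / (Q.m - P.m : ℝ)) =
      -(Real.pi * Complex.I * (2 * b) / (Q.m - P.m : ℝ)) := by ring
    rw [this, re_I_mul_div]
    congr 2
    simp only [μ, Complex.mul_im, Complex.re_ofNat, Complex.im_ofNat, zero_mul, add_zero]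
    ring
  -- The quotient of the Gaussians is bounded by a Gaussian in the difference of the coordinates.
  have hexp : ‖gauss P Q τ b u l‖ / ‖gauss P Q τ b s l‖ ≤
      Real.exp (-(-Real.pi * τ.im / |μ|) * (X - Y) ^ 2 +
        |2 * Real.pi * b.im / μ| * |X - Y|) := by
    rw [hre, hre, ← Real.exp_sub]
    gcongr
    have h1 : Real.pi * τ.im / μ * (X ^ 2 - Y ^ 2) ≤ Real.pi * τ.im / |μ| * (X - Y) ^ 2 := by
      have h2 : Real.pi * τ.im / μ * (X ^ 2 - Y ^ 2) =
          Real.pi * τ.im / μ ^ 2 * (μ * (X ^ 2 - Y ^ 2)) := by field_simp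
      have h3 : Real.pi * τ.im / |μ| * (X - Y) ^ 2 =
          Real.pi * τ.im / μ ^ 2 * (|μ| * (X - Y) ^ 2) := by
        rw [← sq_abs μ]; field_simp
      rw [h2, h3]
      refine mul_le_mul_of_nonpos_left h (div_nonpos_of_nonpos_of_nonneg ?_ (sq_nonneg _))
      nlinarith [Real.pi_pos]
    have h4 : 2 * Real.pi * b.im / μ * (X - Y) ≤ |2 * Real.pi * b.im / μ| * |X - Y| := by
      rw [← abs_mul]; exact le_abs_self _
    have h5 : -(-Real.pi * τ.im / |μ|) = Real.pi * τ.im / |μ| := by ring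
    rw [h5]
    linarith
  have h6 := hM' (X - Y)
  have h7 : (1 + |X|) ^ j ≤ (1 + |Y|) ^ j * (1 + |X - Y|) ^ j := by
    rw [← mul_pow]
    exact pow_le_pow_left₀ (by positivity) (one_add_abs_le X Y) j
  have h8 : 1 + (u - s) ^ 2 ≤ (1 + (μ ^ 2)⁻¹) * (1 + |X - Y|) ^ 2 := by
    have h9 : (u - s) ^ 2 = (μ ^ 2)⁻¹ * |X - Y| ^ 2 := by
      rw [hXY, sq_abs, mul_pow]; field_simp
    rw [h9]
    have : 0 ≤ (μ ^ 2)⁻¹ := by positivity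
    nlinarith [abs_nonneg (X - Y), mul_nonneg this (abs_nonneg (X - Y)), sq_nonneg |X - Y|]
  rw [← div_eq_mul_inv, le_div_iff₀ (by positivity), norm_mul, norm_div]
  have h10 := hC' s l
  set E := Real.exp (-(-Real.pi * τ.im / |μ|) * (X - Y) ^ 2 +
        |2 * Real.pi * b.im / μ| * |X - Y|)
  calc (1 + |X|) ^ j * (‖gauss P Q τ b u l‖ * (‖f s l‖ / ‖gauss P Q τ b s l‖)) * (1 + (u - s) ^ 2)
      = (1 + |X|) ^ j * (‖gauss P Q τ b u l‖ / ‖gauss P Q τ b s l‖) * ‖f s l‖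
        * (1 + (u - s) ^ 2) := by ring
    _ ≤ ((1 + |Y|) ^ j * (1 + |X - Y|) ^ j) * E * (C * ((1 + |Y|) ^ j)⁻¹)
        * ((1 + (μ ^ 2)⁻¹) * (1 + |X - Y|) ^ 2) := by gcongr
    _ = C * (1 + (μ ^ 2)⁻¹) * ((1 + |X - Y|) ^ (j + 2) * E) * ((1 + |Y|) ^ j * ((1 + |Y|) ^ j)⁻¹) := by
        ring
    _ = C * (1 + (μ ^ 2)⁻¹) * ((1 + |X - Y|) ^ (j + 2) * E) := by
        rw [mul_inv_cancel₀ (by positivity), mul_one]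
    _ ≤ C * (1 + (μ ^ 2)⁻¹) * M := by gcongr
    _ = _ := by ring

end

/-- A rapidly decreasing solution of the Cauchy–Riemann equation with the invariance properties of
a kernel is a kernel. -/
lemma exists_D_eq {f : Kernel P Q} {σ : ℝ → ℤ × ℤ → ℂ} (hσ : Rapid (x P Q) σ)
    (h : ∀ u l, HasDerivAt (fun s => σ s l) (f u l -
      (2 * Real.pi * Complex.I * τ * x P Q u l + 2 * Real.pi * Complex.I * b) * σ u l) u)
    (h1 : ∀ u l, σ u (l + P.v) = σ u l) (h2 : ∀ u l, σ (u - Q.r) (l + Q.v) = σ u l) :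
    ∃ g : Kernel P Q, Kernel.D τ b g = f :=
  ⟨⟨σ, IsSchwartz.of_ode (fun u l => hasDerivAt_x P Q l u) hσ f.isSchwartz _ _ h, h1, h2⟩,
    Kernel.D_eq_of_hasDerivAt fun u l => (h u l).congr_deriv (by ring)⟩

/-! ### Cohomology between frames of different slopes -/

/-- Functions on the finite group `ℤ² / (ℤ v_P + ℤ v_Q)`. -/
def IsPeriodic (v w : ℤ × ℤ) (a : ℤ × ℤ → ℂ) : Prop :=
  (∀ l, a (l + v) = a l) ∧ ∀ l, a (l + w) = a l

lemma add_smul_of_add {v : ℤ × ℤ} {a : ℤ × ℤ → ℂ} (h : ∀ l, a (l + v) = a l) (s : ℤ) (l : ℤ × ℤ) :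
    a (l + s • v) = a l := by
  induction s generalizing l with
  | zero => simp
  | succ n ih => rw [add_smul, one_smul, ← add_assoc, h, ih]
  | pred n ih => rw [← h, sub_smul, one_smul, add_assoc, sub_add_cancel, ih]

lemma IsPeriodic.add_smul_p {a : ℤ × ℤ → ℂ} (ha : IsPeriodic P.v Q.v a) (k : ℤ) (l : ℤ × ℤ) :
    a (l + (k * P.dt Q.v) • P.p) = a l := by
  obtain ⟨s, hs⟩ := P.exists_eq Q.v
  have h : (k * P.dt Q.v) • P.p = k • Q.v + (-(k * s)) • P.v := by
    conv_rhs => rw [hs]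
    rw [smul_add, mul_smul, neg_smul, mul_smul]
    abel
  rw [h, ← add_assoc, add_smul_of_add ha.1, add_smul_of_add ha.2]

lemma IsPeriodic.exists_bound {a : ℤ × ℤ → ℂ} (ha : IsPeriodic P.v Q.v a) (hc : P.dt Q.v ≠ 0) :
    ∃ K, ∀ l, ‖a l‖ ≤ K := by
  obtain ⟨K, hK⟩ : ∃ K, ∀ t ∈ Finset.Ico 0 |P.dt Q.v|, ‖a (t • P.p)‖ ≤ K :=
    ((Finset.Ico 0 |P.dt Q.v|).image fun t => ‖a (t • P.p)‖).exists_le.imp fun K h t ht =>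
      h _ (Finset.mem_image_of_mem _ ht)
  refine ⟨K, fun l => ?_⟩
  obtain ⟨s, hs⟩ := P.exists_eq l
  rw [hs, add_smul_of_add ha.1]
  have h1 := Int.emod_add_mul_ediv (P.dt l) (P.dt Q.v)
  have h2 : P.dt l • P.p = (P.dt l % P.dt Q.v) • P.p + (P.dt l / P.dt Q.v * P.dt Q.v) • P.p := by
    rw [← add_smul]; congr 1; linarith
  rw [h2, ha.add_smul_p]
  exact hK _ (Finset.mem_Ico.mpr ⟨Int.emod_nonneg _ hc, Int.emod_lt_abs _ hc⟩)

lemma slope_sub_ne_zero (hc : P.dt Q.v ≠ 0) : Q.m - P.m ≠ 0 := by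
  rw [slope_sub]
  exact div_ne_zero (by exact_mod_cast hc) (mul_ne_zero P.r_ne Q.r_ne)

lemma slope_sub_pos (hc : 0 < P.dt Q.v) : 0 < Q.m - P.m := by
  rw [slope_sub]
  exact div_pos (by exact_mod_cast hc) (mul_pos P.r_pos Q.r_pos)

lemma slope_sub_neg (hc : P.dt Q.v < 0) : Q.m - P.m < 0 := by
  rw [slope_sub]
  exact div_neg_of_neg_of_pos (by exact_mod_cast hc) (mul_pos P.r_pos Q.r_pos)

/-- The zero of `x` on the line with label `l`. -/
def root (P Q : Frame θ) (l : ℤ × ℤ) : ℝ := -(P.dt l / P.r) / (Q.m - P.m)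

lemma x_eq_mul_sub_root (hc : P.dt Q.v ≠ 0) (u : ℝ) (l : ℤ × ℤ) :
    x P Q u l = (Q.m - P.m) * (u - root P Q l) := by
  have := slope_sub_ne_zero hc
  rw [x_eq, root]
  field_simp
  ring

lemma root_add_left (l : ℤ × ℤ) : root P Q (l + P.v) = root P Q l := by
  rw [root, root, dt_add, dt_v, add_zero]

lemma root_add_right (hc : P.dt Q.v ≠ 0) (l : ℤ × ℤ) : root P Q (l + Q.v) = root P Q l - Q.r := by
  have hc' : (P.dt Q.v : ℝ) ≠ 0 := by exact_mod_cast hc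
  have := P.r_ne
  have := Q.r_ne
  rw [root, root, dt_add, slope_sub]
  push_cast
  field_simp
  ring

/-- For an increasing slope the holomorphic kernels are the multiples of the Gaussian by periodic
functions. -/
def ofPeriodic (hτ : τ.im < 0) (hc : 0 < P.dt Q.v) {a : ℤ × ℤ → ℂ} (ha : IsPeriodic P.v Q.v a) :
    Kernel P Q where
  toFun u l := a l * gauss P Q τ b u l
  isSchwartz := by
    obtain ⟨K, hK⟩ := ha.exists_bound hc.ne'
    refine IsSchwartz.coeff_mul hK ?_
    rw [show gauss P Q τ b = _ from funext₂ gauss_eq]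
    refine isSchwartz_cexp ?_ _
    rw [re_I_mul_div]
    exact div_neg_of_neg_of_pos (by nlinarith [Real.pi_pos]) (slope_sub_pos hc)
  add_left u l := by rw [ha.1, gauss_add_left]
  add_right u l := by rw [ha.2, gauss_add_right]

lemma D_ofPeriodic (hτ : τ.im < 0) (hc : 0 < P.dt Q.v) {a : ℤ × ℤ → ℂ}
    (ha : IsPeriodic P.v Q.v a) : Kernel.D τ b (ofPeriodic (b := b) hτ hc ha) = 0 :=
  Kernel.D_eq_of_hasDerivAt fun u l =>
    ((hasDerivAt_gauss (slope_sub_ne_zero hc.ne') u l).const_mul (a l)).congr_deriv (by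
      show _ = 0 - 2 * Real.pi * Complex.I * (τ * x P Q u l + b) * (a l * gauss P Q τ b u l)
      ring)

/-- The multiplier of the Gaussian. -/
def multiplier (τ b : ℂ) (f : Kernel P Q) (l : ℤ × ℤ) : ℂ := f 0 l / gauss P Q τ b 0 l

lemma isPeriodic_multiplier (hc : P.dt Q.v ≠ 0) {f : Kernel P Q} (hf : Kernel.D τ b f = 0) :
    IsPeriodic P.v Q.v (multiplier τ b f) := by
  refine ⟨fun l => by rw [multiplier, f.add_left, gauss_add_left, multiplier], fun l => ?_⟩
  have h := eq_mul_gauss (slope_sub_ne_zero hc) hf (0 - Q.r) (l + Q.v)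
  rw [f.add_right, gauss_add_right, ← div_eq_iff (gauss_ne_zero _ _)] at h
  exact h.symm

/-- Variation of constants, with the integral starting at the zero of `x`: between the root and `u`
the Gaussian decreases towards `u`, so that its quotients are bounded and the solution decays
rapidly. -/
lemma D_surjective (hτ : τ.im < 0) (hc : 0 < P.dt Q.v) (b : ℂ) :
    Function.Surjective (Kernel.D τ b : Kernel P Q → Kernel P Q) := by
  intro f
  have hμ := slope_sub_ne_zero hc.ne'
  have hμ' := slope_sub_pos hc
  have hcont := fun l => continuous_div_gauss (τ := τ) (b := b) hμ f l
  refine exists_D_eq (σ := fun u l => gauss P Q τ b u l *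
    ∫ s in root P Q l..u, f s l / gauss P Q τ b s l) (fun j => ?_) (fun u l => ?_)
    (fun u l => ?_) fun u l => ?_
  · obtain ⟨C, hC, h⟩ := exists_ratio_bound (b := b) hμ hτ f.rapid j
    refine ⟨C * Real.pi, fun u l => ?_⟩
    have hint : MeasureTheory.Integrable fun s : ℝ => C * (1 + (u - s) ^ 2)⁻¹ :=
      (integrable_inv_one_add_sq.comp_sub_left u).const_mul C
    have h1 : ‖(((1 + |x P Q u l|) ^ j : ℝ) : ℂ) * (gauss P Q τ b u l *
        ∫ s in root P Q l..u, f s l / gauss P Q τ b s l)‖ ≤ C * Real.pi := by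
      rw [← mul_assoc, ← intervalIntegral.integral_const_mul]
      refine (intervalIntegral.norm_integral_le_integral_norm_uIoc).trans ?_
      have h2 : ∫ s : ℝ, C * (1 + (u - s) ^ 2)⁻¹ = C * Real.pi := by
        rw [MeasureTheory.integral_const_mul,
          MeasureTheory.integral_sub_left_eq_self (fun s : ℝ => (1 + s ^ 2)⁻¹) MeasureTheory.volume,
          integral_univ_inv_one_add_sq]
      rw [← h2]
      refine le_trans (MeasureTheory.setIntegral_mono_on ?_ hint.integrableOn
        measurableSet_uIoc fun s hs => ?_) (MeasureTheory.setIntegral_le_integral hint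
          (Filter.Eventually.of_forall fun s => by positivity))
      · exact ((continuous_const.mul (hcont l)).norm.intervalIntegrable _ _).def'
      · have h3 := h u s l ?_
        · rw [mul_assoc, norm_mul, Complex.norm_real, Real.norm_of_nonneg (by positivity)]
          exact h3
        · rw [abs_of_pos hμ']
          refine mul_le_mul_of_nonneg_left ?_ hμ'.le
          rw [x_eq_mul_sub_root hc.ne', x_eq_mul_sub_root hc.ne']
          have h4 : 0 ≤ (s - root P Q l) * (u - s) := by
            rcases Set.mem_uIoc.mp hs with h | h
            · exact mul_nonneg (by linarith) (by linarith)
            · exact mul_nonneg_of_nonpos_of_nonpos (by linarith) (by linarith)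
          nlinarith [mul_nonneg (sq_nonneg (Q.m - P.m)) h4]
    rwa [norm_mul, Complex.norm_real, Real.norm_of_nonneg (by positivity)] at h1
  · exact hasDerivAt_gauss_mul hμ (intervalIntegral.integral_hasDerivAt_right
      ((hcont l).intervalIntegrable _ _) ((hcont l).stronglyMeasurableAtFilter _ _)
      (hcont l).continuousAt)
  · simp only [gauss_add_left, f.add_left, root_add_left]
  · simp only [gauss_add_right, root_add_right hc.ne']
    congr 1
    have h := intervalIntegral.integral_comp_sub_right (a := root P Q l) (b := u)
      (fun s => f s (l + Q.v) / gauss P Q τ b s (l + Q.v)) Q.r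
    rw [← h]
    simp only [gauss_add_right, f.add_right]

end

section

variable {θ : ℝ} {P Q R S : Frame θ} {τ b : ℂ}

open _root_.NCTorus.Frame MeasureTheory

/-- For a decreasing slope, a kernel is integrable against the inverse of the Gaussian. -/
lemma exists_div_gauss_bound (hτ : τ.im < 0) (hc : P.dt Q.v < 0) (f : Kernel P Q) (b : ℂ) :
    ∃ C : ℝ, 0 < C ∧ ∀ s l, ‖f s l / gauss P Q τ b s l‖ ≤ C * (1 + (root P Q l - s) ^ 2)⁻¹ := by
  obtain ⟨C, hC, h⟩ := exists_ratio_bound (b := b) (slope_sub_ne_zero hc.ne) hτ f.rapid 0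
  refine ⟨C, hC, fun s l => ?_⟩
  have h0 : x P Q (root P Q l) l = 0 := by rw [x_eq_mul_sub_root hc.ne, sub_self, mul_zero]
  have h1 := h (root P Q l) s l (by
    rw [h0, abs_of_neg (slope_sub_neg hc)]
    nlinarith)
  have h2 : gauss P Q τ b (root P Q l) l = 1 := by simp [gauss, h0]
  rwa [h2, one_mul, pow_zero, one_mul] at h1

lemma integrable_div_gauss (hτ : τ.im < 0) (hc : P.dt Q.v < 0) (f : Kernel P Q) (b : ℂ)
    (l : ℤ × ℤ) : Integrable fun s => f s l / gauss P Q τ b s l := by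
  obtain ⟨C, hC, h⟩ := exists_div_gauss_bound hτ hc f b
  exact ((integrable_inv_one_add_sq.comp_sub_left (root P Q l)).const_mul C).mono'
    (continuous_div_gauss (slope_sub_ne_zero hc.ne) f l).aestronglyMeasurable
    (Filter.Eventually.of_forall fun s => h s l)

/-- The linear functionals that detect the first cohomology for a decreasing slope. -/
def period (τ b : ℂ) (f : Kernel P Q) (l : ℤ × ℤ) : ℂ := ∫ s, f s l / gauss P Q τ b s l

lemma isPeriodic_period (f : Kernel P Q) : IsPeriodic P.v Q.v (period τ b f) := by
  refine ⟨fun l => by simp only [period, f.add_left, gauss_add_left], fun l => ?_⟩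
  have h := integral_sub_right_eq_self (μ := volume)
    (fun s => f s (l + Q.v) / gauss P Q τ b s (l + Q.v)) Q.r
  rw [period, ← h]
  simp only [gauss_add_right, f.add_right]
  rfl

lemma tendsto_div_gauss (hτ : τ.im < 0) (hc : P.dt Q.v < 0) (f : Kernel P Q) (b : ℂ)
    (l : ℤ × ℤ) {F : Filter ℝ} (hF : Filter.Tendsto (fun s : ℝ => |s|) F Filter.atTop) :
    Filter.Tendsto (fun s => f s l / gauss P Q τ b s l) F (nhds 0) := by
  obtain ⟨C, hC, h⟩ := exists_div_gauss_bound hτ hc f b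
  refine squeeze_zero_norm (fun s => h s l) ?_
  rw [← mul_zero C]
  refine Filter.Tendsto.const_mul C (Filter.Tendsto.inv_tendsto_atTop ?_)
  have h1 : Filter.Tendsto (fun s : ℝ => |s| - |root P Q l|) F Filter.atTop :=
    Filter.tendsto_atTop_add_const_right _ _ hF
  refine Filter.tendsto_atTop_mono (fun s => ?_) h1
  have h2 := abs_sub_abs_le_abs_sub s (root P Q l)
  rw [← abs_sub_comm] at h2
  refine h2.trans ?_
  rw [← sq_abs]
  nlinarith [sq_nonneg (|root P Q l - s| - 1)]

/-- The quotient of a holomorphic kernel by the growing Gaussian is constant and tends to `0`. -/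
lemma eq_zero_of_D_eq_zero (hτ : τ.im < 0) (hc : P.dt Q.v < 0) {f : Kernel P Q}
    (hf : Kernel.D τ b f = 0) : f = 0 := by
  ext u l
  rw [eq_mul_gauss (slope_sub_ne_zero hc.ne) hf]
  have h := tendsto_div_gauss hτ hc f b l Filter.tendsto_abs_atTop_atTop
  have h1 : ∀ s, f s l / gauss P Q τ b s l = f 0 l / gauss P Q τ b 0 l := fun s => by
    rw [div_eq_iff (gauss_ne_zero _ _)]
    exact eq_mul_gauss (slope_sub_ne_zero hc.ne) hf s l
  simp only [h1] at h
  rw [tendsto_nhds_unique tendsto_const_nhds h, zero_mul]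
  rfl

lemma period_D (hτ : τ.im < 0) (hc : P.dt Q.v < 0) (f : Kernel P Q) :
    period τ b (Kernel.D τ b f) = 0 := by
  ext l
  have h := integral_of_hasDerivAt_of_tendsto
    (fun s => hasDerivAt_div_gauss (slope_sub_ne_zero hc.ne) f s l)
    (integrable_div_gauss hτ hc (Kernel.D τ b f) b l)
    (tendsto_div_gauss hτ hc f b l Filter.tendsto_abs_atBot_atTop)
    (tendsto_div_gauss hτ hc f b l Filter.tendsto_abs_atTop_atTop)
  rw [sub_zero] at h
  exact h

/-- Variation of constants from `-∞`. The vanishing of the period allows one to integrate from `∞`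
instead, which gives the decay on the other side of the root. -/
lemma exists_D_eq_of_period_eq_zero (hτ : τ.im < 0) (hc : P.dt Q.v < 0) {f : Kernel P Q}
    (hf : period τ b f = 0) : ∃ g : Kernel P Q, Kernel.D τ b g = f := by
  have hμ := slope_sub_ne_zero hc.ne
  have hμ' := slope_sub_neg hc
  have hcont := fun l => continuous_div_gauss (τ := τ) (b := b) hμ f l
  have hint := fun l => integrable_div_gauss hτ hc f b l
  refine exists_D_eq (σ := fun u l => gauss P Q τ b u l *
    ∫ s in Set.Iic u, f s l / gauss P Q τ b s l) (fun j => ?_) (fun u l => ?_)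
    (fun u l => ?_) fun u l => ?_
  · obtain ⟨C, hC, h⟩ := exists_ratio_bound (b := b) hμ hτ f.rapid j
    refine ⟨C * Real.pi, fun u l => ?_⟩
    have hC' : Integrable fun s : ℝ => C * (1 + (u - s) ^ 2)⁻¹ :=
      (integrable_inv_one_add_sq.comp_sub_left u).const_mul C
    -- On either side of the root the integral extends over the half line where `|x|` increases.
    have h1 : ∀ A : Set ℝ, MeasurableSet A → (∀ s ∈ A, 0 ≤ (u - root P Q l) * (s - u)) →
        (1 + |x P Q u l|) ^ j * ‖gauss P Q τ b u l *
          ∫ s in A, f s l / gauss P Q τ b s l‖ ≤ C * Real.pi := by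
      intro A hA hs
      have h2 : ‖(((1 + |x P Q u l|) ^ j : ℝ) : ℂ) * (gauss P Q τ b u l *
          ∫ s in A, f s l / gauss P Q τ b s l)‖ ≤ C * Real.pi := by
        rw [← mul_assoc, ← integral_const_mul]
        refine (norm_integral_le_integral_norm _).trans ?_
        have h3 : ∫ s : ℝ, C * (1 + (u - s) ^ 2)⁻¹ = C * Real.pi := by
          rw [integral_const_mul, integral_sub_left_eq_self (fun s : ℝ => (1 + s ^ 2)⁻¹) volume,
            integral_univ_inv_one_add_sq]
        rw [← h3]
        refine le_trans (setIntegral_mono_on ((hint l).const_mul _).norm.integrableOn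
          hC'.integrableOn hA fun s hsA => ?_) (setIntegral_le_integral hC'
            (Filter.Eventually.of_forall fun s => by positivity))
        rw [mul_assoc, norm_mul, Complex.norm_real, Real.norm_of_nonneg (by positivity)]
        refine h u s l ?_
        rw [abs_of_neg hμ', x_eq_mul_sub_root hc.ne, x_eq_mul_sub_root hc.ne]
        nlinarith [mul_nonneg (mul_nonneg (sq_nonneg (Q.m - P.m)) (neg_nonneg.mpr hμ'.le))
          (hs s hsA)]
      rwa [norm_mul, Complex.norm_real, Real.norm_of_nonneg (by positivity)] at h2
    rcases le_total u (root P Q l) with hu | hu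
    · exact h1 _ measurableSet_Iic fun s hs => by
        have : s ≤ u := hs
        nlinarith
    · have h4 : ∫ s in Set.Iic u, f s l / gauss P Q τ b s l
          = -∫ s in Set.Ioi u, f s l / gauss P Q τ b s l := by
        rw [eq_neg_iff_add_eq_zero, ← Set.compl_Iic, integral_add_compl measurableSet_Iic (hint l)]
        exact congrFun hf l
      dsimp only
      rw [h4, mul_neg, norm_neg]
      exact h1 _ measurableSet_Ioi fun s hs => by
        have : u < s := hs
        nlinarith
  · refine hasDerivAt_gauss_mul hμ ?_
    have h1 := (intervalIntegral.integral_hasDerivAt_right ((hcont l).intervalIntegrable 0 u)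
      ((hcont l).stronglyMeasurableAtFilter _ _) (hcont l).continuousAt).const_add
      (∫ s in Set.Iic 0, f s l / gauss P Q τ b s l)
    refine h1.congr_of_eventuallyEq (Filter.Eventually.of_forall fun v => ?_)
    dsimp only
    rw [← intervalIntegral.integral_Iic_sub_Iic (hint l).integrableOn (hint l).integrableOn,
      add_sub_cancel]
  · simp only [gauss_add_left, f.add_left]
  · simp only [gauss_add_right]
    congr 1
    have h := (measurePreserving_sub_right volume Q.r).setIntegral_preimage_emb
      (measurableEmbedding_subRight Q.r)
      (fun s => f s (l + Q.v) / gauss P Q τ b s (l + Q.v)) (Set.Iic (u - Q.r))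
    rw [← h]
    simp only [gauss_add_right, f.add_right, Set.preimage_sub_const_Iic, sub_add_cancel]

/-- The period of the multiples of the Gaussian `gauss · exp(-α x²)` with `α` large enough for the
product to decay is a multiple of an ordinary Gaussian integral. -/
lemma exists_period_eq (hτ : τ.im < 0) (hc : P.dt Q.v < 0) {a : ℤ × ℤ → ℂ}
    (ha : IsPeriodic P.v Q.v a) : ∃ f : Kernel P Q, period τ b f = a := by
  obtain ⟨K, hK⟩ := ha.exists_bound hc.ne
  have hμ := slope_sub_ne_zero hc.ne
  set μ := Q.m - P.m with hμd
  -- The modulus of `gauss` grows as `exp(α x² / 2)`.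
  set α : ℝ := 2 * (-Real.pi * τ.im / -μ) with hα
  have hα' : 0 < α := by
    have := slope_sub_neg hc
    exact mul_pos two_pos (div_pos (by nlinarith [Real.pi_pos]) (by linarith))
  set N : ℂ := ∫ s : ℝ, Complex.exp (-((α * μ ^ 2 : ℝ) : ℂ) * (s : ℂ) ^ 2) with hN
  have hαμ : 0 < α * μ ^ 2 := by positivity
  have hN0 : N ≠ 0 := by
    rw [hN, integral_gaussian_complex (by rw [Complex.ofReal_re]; exact hαμ)]
    rw [Ne, Complex.cpow_eq_zero_iff]
    intro h
    refine div_ne_zero ?_ ?_ h.1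
    · exact_mod_cast Real.pi_ne_zero
    · exact_mod_cast hαμ.ne'
  let g : ℝ → ℤ × ℤ → ℂ := fun u l => Complex.exp (-(α : ℂ) * (x P Q u l : ℂ) ^ 2)
  have hg : ∀ u l, gauss P Q τ b u l * g u l = Complex.exp
      ((-(Real.pi * Complex.I * τ / (Q.m - P.m : ℝ)) - α) * (x P Q u l : ℂ) ^ 2
      + -(2 * Real.pi * Complex.I * b / (Q.m - P.m : ℝ)) * x P Q u l) := fun u l => by
    rw [gauss_eq, ← Complex.exp_add]; congr 1; ring
  refine ⟨⟨fun u l => a l * N⁻¹ * (gauss P Q τ b u l * g u l), ?_, fun u l => ?_, fun u l => ?_⟩, ?_⟩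
  · refine IsSchwartz.coeff_mul (a := fun l => a l * N⁻¹) (K := K * ‖N⁻¹‖) (fun l => ?_) ?_
    · rw [norm_mul]; gcongr; exact hK l
    · simp only [hg]
      refine isSchwartz_cexp ?_ _
      rw [Complex.sub_re, re_I_mul_div, Complex.ofReal_re, hα, ← hμd]
      have h1 : -Real.pi * τ.im / -μ = Real.pi * τ.im / μ := by rw [neg_mul, neg_div_neg_eq]
      rw [h1] at hα ⊢
      linarith
  · simp only [ha.1, gauss_add_left, g, x_add_left]
  · simp only [ha.2, gauss_add_right, g, x_add_right]
  · ext l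
    show ∫ s, a l * N⁻¹ * (gauss P Q τ b s l * g s l) / gauss P Q τ b s l = a l
    have h1 : ∀ s, a l * N⁻¹ * (gauss P Q τ b s l * g s l) / gauss P Q τ b s l
        = a l * N⁻¹ * Complex.exp (-((α * μ ^ 2 : ℝ) : ℂ) * ((s - root P Q l : ℝ) : ℂ) ^ 2) := by
      intro s
      have hs := gauss_ne_zero (P := P) (Q := Q) (τ := τ) (b := b) s l
      simp only [g, x_eq_mul_sub_root hc.ne]
      field_simp
      congr 2
      simp only [μ]
      push_cast
      ring
    simp_rw [h1]
    rw [integral_const_mul, integral_sub_right_eq_self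
      (fun s : ℝ => Complex.exp (-((α * μ ^ 2 : ℝ) : ℂ) * (s : ℂ) ^ 2)), ← hN,
      mul_assoc, inv_mul_cancel₀ hN0, mul_one]

/-! ### Cohomology between frames of equal slopes -/

section EqualSlopes

variable (hv : P.v = Q.v)
include hv

lemma r_eq_of_v_eq : P.r = Q.r := congrArg (proj θ) hv

lemma m_eq_of_v_eq : P.m = Q.m := by
  rw [Frame.m, Frame.m, r_eq_of_v_eq hv, show P.c = Q.c from congrArg Prod.fst hv]

lemma x_eq_of_v_eq (u : ℝ) (l : ℤ × ℤ) : x P Q u l = P.dt l / P.r := by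
  rw [x_eq, m_eq_of_v_eq hv, sub_self, zero_mul, add_zero]

lemma periodic_of_v_eq (f : Kernel P Q) (l : ℤ × ℤ) : Function.Periodic (fun u => f u l) P.r :=
  fun u => by
    show f (u + P.r) l = f u l
    rw [r_eq_of_v_eq hv, ← f.add_right', ← hv, f.add_left]

/-- The exponent of the monodromy on the line with label `l`. -/
def expo (τ b : ℂ) (P : Frame θ) (l : ℤ × ℤ) : ℂ :=
  2 * Real.pi * Complex.I * (τ * (P.dt l / P.r : ℝ) + b)

omit hv in
lemma expo_mul_r (l : ℤ × ℤ) :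
    expo τ b P l * P.r = 2 * Real.pi * Complex.I * (τ * P.dt l + P.r * b) := by
  have hr : (P.r : ℂ) ≠ 0 := by exact_mod_cast P.r_ne
  rw [expo]
  push_cast
  field_simp

lemma hasDerivAt_exp_mul (f : Kernel P Q) (u : ℝ) (l : ℤ × ℤ) :
    HasDerivAt (fun s : ℝ => Complex.exp (expo τ b P l * s) * f s l)
      (Complex.exp (expo τ b P l * u) * Kernel.D τ b f u l) u := by
  have h1 : HasDerivAt (fun s : ℝ => Complex.exp (expo τ b P l * s))
      (Complex.exp (expo τ b P l * u) * expo τ b P l) u := by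
    simpa using ((hasDerivAt_id u).ofReal_comp.const_mul (expo τ b P l)).cexp
  refine (h1.mul (f.hasDerivAt τ b u l)).congr_deriv ?_
  rw [x_eq_of_v_eq hv, expo]
  ring

/-- Where the monodromy is nontrivial, horizontal kernels vanish. -/
lemma eq_zero_of_monodromy {f : Kernel P Q} (hf : Kernel.D τ b f = 0) {l : ℤ × ℤ}
    (h : Complex.exp (expo τ b P l * P.r) ≠ 1) (u : ℝ) : f u l = 0 := by
  have h1 : ∀ u, HasDerivAt (fun s : ℝ => Complex.exp (expo τ b P l * s) * f s l) 0 u := fun u => by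
    simpa [hf] using hasDerivAt_exp_mul (τ := τ) (b := b) hv f u l
  have h2 := is_const_of_deriv_eq_zero (fun v => (h1 v).differentiableAt)
    (fun v => (h1 v).deriv) (u + P.r) u
  have h3 : f (u + P.r) l = f u l := periodic_of_v_eq hv f l u
  rw [h3, Complex.ofReal_add, mul_add, Complex.exp_add] at h2
  have h4 : (Complex.exp (expo τ b P l * P.r) - 1) * (Complex.exp (expo τ b P l * u) * f u l) = 0 := by
    linear_combination h2
  rcases mul_eq_zero.mp h4 with h5 | h5
  · exact absurd (sub_eq_zero.mp h5) h
  · exact (mul_eq_zero.mp h5).resolve_left (Complex.exp_ne_zero _)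

omit hv in
/-- The inverses of the operators `monodromy - 1` are uniformly bounded. -/
lemma exists_monodromy_bound (hτ : τ.im ≠ 0) (b : ℂ) (P : Frame θ) : ∃ K : ℝ, 0 < K ∧ ∀ l,
    Complex.exp (expo τ b P l * P.r) ≠ 1 →
      max 1 ‖Complex.exp (expo τ b P l * P.r)‖ ≤ K * ‖Complex.exp (expo τ b P l * P.r) - 1‖ := by
  let q : ℤ → ℂ := fun n => Complex.exp (2 * Real.pi * Complex.I * (τ * n + P.r * b))
  have hq : ∀ n, ‖q n‖ = Real.exp (-(2 * Real.pi * (τ.im * n + P.r * b.im))) := fun n => by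
    rw [Complex.norm_exp]; congr 1; simp
  suffices h : ∃ K : ℝ, 0 < K ∧ ∀ n, q n ≠ 1 → max 1 ‖q n‖ ≤ K * ‖q n - 1‖ by
    obtain ⟨K, hK, h⟩ := h
    refine ⟨K, hK, fun l hl => ?_⟩
    rw [expo_mul_r] at hl ⊢
    exact h _ hl
  -- For large `|n|` either `|q n| ≤ 1/2` or `|q n| ≥ 2`, where `K = 2` suffices; finitely many `n`
  -- remain.
  obtain ⟨B, hB⟩ : ∃ B : ℝ, ∀ n : ℤ, B ≤ |(n : ℝ)| →
      Real.log 2 ≤ |2 * Real.pi * (τ.im * n + P.r * b.im)| := by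
    refine ⟨(Real.log 2 + |P.r * b.im|) / |τ.im|, fun n hn => ?_⟩
    rw [div_le_iff₀ (abs_pos.mpr hτ), ← abs_mul, mul_comm (n : ℝ)] at hn
    have h1 := abs_sub_abs_le_abs_sub (τ.im * n) (-(P.r * b.im))
    rw [abs_neg, sub_neg_eq_add] at h1
    rw [abs_mul, abs_of_pos (by positivity : 0 < 2 * Real.pi)]
    have h2 : Real.log 2 ≤ |τ.im * n + P.r * b.im| := by linarith
    nlinarith [Real.pi_gt_three, abs_nonneg (τ.im * n + P.r * b.im)]
  let s : Finset ℤ := Finset.Icc (-⌈B⌉) ⌈B⌉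
  obtain ⟨K, hK⟩ := (s.image fun n => max 1 ‖q n‖ / ‖q n - 1‖).exists_le
  refine ⟨max K 2, by positivity, fun n hn => ?_⟩
  have hn' : 0 < ‖q n - 1‖ := norm_pos_iff.mpr (sub_ne_zero.mpr hn)
  by_cases hs : n ∈ s
  · rw [← div_le_iff₀ hn']
    exact (hK _ (Finset.mem_image_of_mem _ hs)).trans (le_max_left _ _)
  · have h1 : B ≤ |(n : ℝ)| := by
      by_contra h
      rw [not_le] at h
      have h2 : |n| ≤ ⌈B⌉ := by
        have h3 : (|n| : ℝ) ≤ ⌈B⌉ := h.le.trans (Int.le_ceil B)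
        exact_mod_cast h3
      exact hs (Finset.mem_Icc.mpr (abs_le.mp h2))
    have h4 := hB n h1
    refine le_trans ?_ (mul_le_mul_of_nonneg_right (le_max_right K 2) hn'.le)
    have h5 := norm_sub_norm_le (q n) 1
    have h6 := norm_sub_norm_le 1 (q n)
    rw [norm_sub_rev] at h6
    rw [norm_one] at h5 h6
    rcases le_abs.mp h4 with h | h
    · have h7 : ‖q n‖ ≤ 1 / 2 := by
        rw [hq, Real.exp_neg, one_div]
        gcongr
        exact (Real.exp_log two_pos).symm.trans_le (Real.exp_le_exp.mpr h)
      rw [max_eq_left (by linarith)]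
      linarith
    · have h7 : 2 ≤ ‖q n‖ := by
        rw [hq]
        exact (Real.exp_log two_pos).symm.trans_le (Real.exp_le_exp.mpr h)
      rw [max_eq_right (by linarith)]
      linarith

/-- The solution of the equation on a line with nontrivial monodromy. -/
def solve (τ b : ℂ) (f : Kernel P Q) (u : ℝ) (l : ℤ × ℤ) : ℂ :=
  (Complex.exp (expo τ b P l * P.r) - 1)⁻¹ *
    ∫ s in (0 : ℝ)..P.r, Complex.exp (expo τ b P l * s) * f (u + s) l

omit hv in
lemma solve_add_left (f : Kernel P Q) (u : ℝ) (l : ℤ × ℤ) :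
    solve τ b f u (l + P.v) = solve τ b f u l := by
  simp only [solve, expo, dt_add, dt_v, add_zero, f.add_left]

lemma solve_add_right (f : Kernel P Q) (u : ℝ) (l : ℤ × ℤ) :
    solve τ b f (u - Q.r) (l + Q.v) = solve τ b f u l := by
  rw [← hv, solve_add_left, ← r_eq_of_v_eq hv]
  have h : ∀ s, f (u - P.r + s) l = f (u + s) l := fun s => by
    rw [sub_add_eq_add_sub]
    exact (periodic_of_v_eq hv f l).sub_eq (u + s)
  simp only [solve, h]

/-- The integral over the period is `exp(-βu) (Φ(u + r) - Φ(u))` for a primitive `Φ` of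
`exp(βs) f(s)`, and periodicity of `f` reduces its derivative to a multiple of `exp(βr) - 1`. -/
lemma hasDerivAt_solve (f : Kernel P Q) {l : ℤ × ℤ}
    (h : Complex.exp (expo τ b P l * P.r) ≠ 1) (u : ℝ) :
    HasDerivAt (fun s => solve τ b f s l) (f u l - expo τ b P l * solve τ b f u l) u := by
  set β := expo τ b P l
  have hE : ∀ u : ℝ, HasDerivAt (fun s : ℝ => Complex.exp (β * s)) (Complex.exp (β * u) * β) u :=
    fun u => by simpa using ((hasDerivAt_id u).ofReal_comp.const_mul β).cexp
  have hcE : Continuous fun s : ℝ => Complex.exp (β * s) :=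
    continuous_iff_continuousAt.mpr fun u => (hE u).continuousAt
  let φ : ℝ → ℂ := fun s => Complex.exp (β * s) * f s l
  have hφ : Continuous φ := hcE.mul (f.continuous l)
  have h1 : ∀ u, ∫ s in (0 : ℝ)..P.r, Complex.exp (β * s) * f (u + s) l
      = Complex.exp (-β * u) * ((∫ s in (0 : ℝ)..(u + P.r), φ s) - ∫ s in (0 : ℝ)..u, φ s) := by
    intro u
    rw [intervalIntegral.integral_interval_sub_left (hφ.intervalIntegrable _ _)
      (hφ.intervalIntegrable _ _), ← intervalIntegral.integral_const_mul]
    have h2 := intervalIntegral.integral_comp_add_left (a := 0) (b := P.r)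
      (fun s => Complex.exp (-β * u) * φ s) u
    rw [add_zero] at h2
    rw [← h2]
    refine intervalIntegral.integral_congr fun s _ => ?_
    simp only [φ]
    rw [← mul_assoc, ← Complex.exp_add]
    congr 2
    push_cast
    ring
  have h3 : ∀ u, HasDerivAt (fun u => ∫ s in (0 : ℝ)..u, φ s) (φ u) u := fun u =>
    intervalIntegral.integral_hasDerivAt_right (hφ.intervalIntegrable _ _)
      (hφ.stronglyMeasurableAtFilter _ _) hφ.continuousAt
  have h4 : HasDerivAt (fun s : ℝ => Complex.exp (-β * s)) (Complex.exp (-β * u) * -β) u := by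
    simpa using ((hasDerivAt_id u).ofReal_comp.const_mul (-β)).cexp
  have h5 := ((h4.mul (((h3 (u + P.r)).comp_add_const u P.r).sub (h3 u))).const_mul
    (Complex.exp (β * P.r) - 1)⁻¹)
  have h6 : (fun s => solve τ b f s l) = fun s : ℝ => (Complex.exp (β * P.r) - 1)⁻¹ *
      (Complex.exp (-β * s) * ((∫ s in (0 : ℝ)..(s + P.r), φ s) - ∫ s in (0 : ℝ)..s, φ s)) := by
    ext s
    rw [solve, h1]
  rw [h6, solve, h1]
  change HasDerivAt _ (f u l - β * ((Complex.exp (β * P.r) - 1)⁻¹ * _)) u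
  refine h5.congr_deriv ?_
  have h7 : f (u + P.r) l = f u l := periodic_of_v_eq hv f l u
  have h8 : Complex.exp (β * ((u + P.r : ℝ) : ℂ)) =
      Complex.exp (β * u) * Complex.exp (β * P.r) := by
    rw [← Complex.exp_add]; congr 1; push_cast; ring
  have h9 : Complex.exp (-β * u) * Complex.exp (β * u) = 1 := by
    rw [← Complex.exp_add]; simp
  have h10 := inv_mul_cancel₀ (sub_ne_zero.mpr h)
  have h11 : φ (u + P.r) - φ u =
      Complex.exp (β * u) * (Complex.exp (β * P.r) - 1) * f u l := by
    simp only [φ, h7, h8]; ring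
  rw [Pi.sub_apply, h11]
  linear_combination (Complex.exp (β * P.r) - 1)⁻¹ * (Complex.exp (β * P.r) - 1) * f u l * h9
    + f u l * h10

omit hv in
lemma norm_solve_le (f : Kernel P Q) {l : ℤ × ℤ} {K C : ℝ}
    (h : Complex.exp (expo τ b P l * P.r) ≠ 1)
    (hK : max 1 ‖Complex.exp (expo τ b P l * P.r)‖ ≤ K * ‖Complex.exp (expo τ b P l * P.r) - 1‖)
    (hC : ∀ u, ‖f u l‖ ≤ C) (u : ℝ) : ‖solve τ b f u l‖ ≤ K * P.r * C := by
  have hr := P.r_pos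
  set β := expo τ b P l
  set M := max 1 ‖Complex.exp (β * P.r)‖
  have h1 : ∀ s ∈ Set.uIoc 0 P.r, ‖Complex.exp (β * s) * f (u + s) l‖ ≤ M * C := by
    intro s hs
    rw [Set.uIoc_of_le hr.le] at hs
    rw [norm_mul]
    refine mul_le_mul ?_ (hC _) (norm_nonneg _) (le_trans zero_le_one (le_max_left _ _))
    -- The exponential takes its maximum at one of the ends of the interval `[0, r]`.
    rw [Complex.norm_exp, Complex.re_mul_ofReal]
    rcases le_total β.re 0 with h0 | h0
    · refine le_trans ?_ (le_max_left _ _)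
      rw [Real.exp_le_one_iff]
      exact mul_nonpos_of_nonpos_of_nonneg h0 hs.1.le
    · refine le_trans ?_ (le_max_right _ _)
      rw [Complex.norm_exp, Complex.re_mul_ofReal]
      exact Real.exp_le_exp.mpr (mul_le_mul_of_nonneg_left hs.2 h0)
  have h2 := intervalIntegral.norm_integral_le_of_norm_le_const h1
  have h3 : 0 < ‖Complex.exp (β * P.r) - 1‖ := norm_pos_iff.mpr (sub_ne_zero.mpr h)
  have hC0 : 0 ≤ C := (norm_nonneg _).trans (hC 0)
  rw [sub_zero, abs_of_pos hr] at h2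
  rw [solve, norm_mul, norm_inv, inv_mul_le_iff₀ h3]
  calc _ ≤ M * C * P.r := h2
    _ ≤ K * ‖Complex.exp (β * P.r) - 1‖ * C * P.r := by gcongr
    _ = _ := by ring

/-- Without trivial monodromy the operator is invertible. -/
lemma exists_D_eq_of_monodromy (hτ : τ.im ≠ 0) (h : ∀ l, Complex.exp (expo τ b P l * P.r) ≠ 1)
    (f : Kernel P Q) : ∃ g : Kernel P Q, Kernel.D τ b g = f := by
  obtain ⟨K, hK, hK'⟩ := exists_monodromy_bound hτ b P
  refine exists_D_eq (σ := solve τ b f) (fun j => ?_) (fun u l => ?_) (solve_add_left f)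
    (solve_add_right hv f)
  · obtain ⟨C, hC⟩ := f.rapid j
    refine ⟨K * P.r * C, fun u l => ?_⟩
    have h1 : ∀ u, ‖f u l‖ ≤ C / (1 + |P.dt l / P.r|) ^ j := fun u => by
      rw [le_div_iff₀ (by positivity), mul_comm]
      simpa [x_eq_of_v_eq hv] using hC u l
    have h2 := norm_solve_le f (h l) (hK' l (h l)) h1 u
    rw [x_eq_of_v_eq hv]
    calc _ ≤ (1 + |P.dt l / P.r|) ^ j * (K * P.r * (C / (1 + |P.dt l / P.r|) ^ j)) := by gcongr
      _ = _ := by field_simp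
  · refine (hasDerivAt_solve hv f (h l) u).congr_deriv ?_
    rw [x_eq_of_v_eq hv, expo]
    ring

omit hv in
lemma exp_expo_eq_one_iff (hτ : τ.im ≠ 0) (l : ℤ × ℤ) :
    Complex.exp (expo τ 0 P l * P.r) = 1 ↔ P.dt l = 0 := by
  rw [expo_mul_r, Complex.exp_eq_one_iff]
  constructor
  · rintro ⟨n, hn⟩
    have h1 : (2 * Real.pi * Complex.I : ℂ) ≠ 0 := by simp [Real.pi_ne_zero]
    have h2 : τ * P.dt l + P.r * 0 = n := by
      rw [mul_comm (n : ℂ)] at hn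
      exact mul_left_cancel₀ h1 hn
    have h3 := congrArg Complex.im h2
    simp [hτ] at h3
    exact h3
  · intro h
    exact ⟨0, by simp [h]⟩

/-- A horizontal kernel is a multiple of the identity. -/
lemma eq_smul_id (hτ : τ.im ≠ 0) {f : Kernel P Q} (hf : Kernel.D τ 0 f = 0) :
    f = f 0 0 • Kernel.id P Q hv := by
  ext u l
  rw [Kernel.smul_apply, Kernel.id_apply]
  split_ifs with h
  · obtain ⟨s, hs⟩ := P.exists_eq l
    rw [h, zero_smul, zero_add] at hs
    rw [hs, ← zero_add (s • P.v), f.add_left_smul, mul_one]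
    have h1 : ∀ u, HasDerivAt (fun s : ℝ => f s 0) 0 u := fun u => by
      have := f.hasDerivAt τ 0 u 0
      rw [hf, x_eq_of_v_eq hv] at this
      simpa using this
    exact is_const_of_deriv_eq_zero (fun v => (h1 v).differentiableAt) (fun v => (h1 v).deriv) u 0
  · rw [mul_zero]
    exact eq_zero_of_monodromy hv hf (fun h' => h ((exp_expo_eq_one_iff hτ l).mp h')) u

lemma D_id : Kernel.D τ 0 (Kernel.id P Q hv) = 0 := by
  refine Kernel.D_eq_of_hasDerivAt fun u l => (hasDerivAt_const u _).congr_deriv ?_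
  rw [Kernel.id_apply, x_eq_of_v_eq hv]
  split_ifs with h <;> simp [h]

/-- The linear functional that detects the first cohomology for equal slopes and trivial
monodromy. -/
def trace (f : Kernel P Q) : ℂ := ∫ u in (0 : ℝ)..P.r, f u 0

lemma trace_D (f : Kernel P Q) : trace (Kernel.D τ 0 f) = 0 := by
  have h1 : ∀ u, HasDerivAt (fun s : ℝ => f s 0) (Kernel.D τ 0 f u 0) u := fun u => by
    have := f.hasDerivAt τ 0 u 0
    rw [x_eq_of_v_eq hv] at this
    simpa using this
  rw [trace, intervalIntegral.integral_eq_sub_of_hasDerivAt (fun u _ => h1 u)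
    (((Kernel.D τ 0 f).continuous 0).intervalIntegrable _ _)]
  have h2 := periodic_of_v_eq hv f 0 0
  simp only [zero_add] at h2
  rw [h2, sub_self]

lemma trace_id : trace (Kernel.id P Q hv) = P.r := by
  simp [trace, Kernel.id_apply]

/-- On the lines with trivial monodromy, where `dt = 0`, the equation is that of a primitive, which
is periodic because the trace vanishes; on the other lines `solve` applies. -/
lemma exists_D_eq_of_trace_eq_zero (hτ : τ.im ≠ 0) {f : Kernel P Q} (hf : trace f = 0) :
    ∃ g : Kernel P Q, Kernel.D τ 0 g = f := by
  obtain ⟨K, hK, hK'⟩ := exists_monodromy_bound hτ 0 P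
  have h0 : ∀ l, P.dt l = 0 → ∀ u, f u l = f u 0 := fun l hl u => by
    obtain ⟨s, hs⟩ := P.exists_eq l
    rw [hl, zero_smul, zero_add] at hs
    rw [hs, ← zero_add (s • P.v), f.add_left_smul]
  have hint := fun a b => (f.continuous 0).intervalIntegrable (μ := volume) a b
  have hper : Function.Periodic (fun u => ∫ s in (0 : ℝ)..u, f s 0) P.r := fun u => by
    show ∫ s in (0 : ℝ)..(u + P.r), f s 0 = ∫ s in (0 : ℝ)..u, f s 0
    rw [← intervalIntegral.integral_add_adjacent_intervals (hint 0 u) (hint u (u + P.r)),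
      (periodic_of_v_eq hv f 0).intervalIntegral_add_eq u 0, zero_add]
    rw [trace] at hf
    rw [hf, add_zero]
  have hdt : ∀ l, P.dt (l + P.v) = P.dt l := fun l => by rw [dt_add, dt_v, add_zero]
  refine exists_D_eq (σ := fun u l => if P.dt l = 0 then ∫ s in (0 : ℝ)..u, f s 0
    else solve τ 0 f u l) (fun j => ?_) (fun u l => ?_) (fun u l => ?_) fun u l => ?_
  · obtain ⟨C, hC⟩ := f.rapid j
    refine ⟨max (P.r * C) (K * P.r * C), fun u l => ?_⟩
    have h1 : ∀ u, ‖f u l‖ ≤ C / (1 + |P.dt l / P.r|) ^ j := fun u => by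
      rw [le_div_iff₀ (by positivity), mul_comm]
      simpa [x_eq_of_v_eq hv] using hC u l
    rw [x_eq_of_v_eq hv]
    dsimp only
    split_ifs with hl
    · refine le_trans ?_ (le_max_left _ _)
      obtain ⟨y, hy, hy'⟩ := hper.exists_mem_Ico₀ P.r_pos u
      have h2 : ∀ s ∈ Set.uIoc 0 y, ‖f s 0‖ ≤ C := fun s _ => by
        have := hC s 0
        simpa [x_eq_of_v_eq hv] using this
      have h3 := intervalIntegral.norm_integral_le_of_norm_le_const h2
      have hC0 : 0 ≤ C := (norm_nonneg _).trans (by simpa [x_eq_of_v_eq hv] using hC 0 0)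
      rw [hy', hl]
      simp only [Int.cast_zero, zero_div, abs_zero, add_zero, one_pow, one_mul]
      refine h3.trans ?_
      rw [sub_zero, abs_of_nonneg hy.1, mul_comm]
      exact mul_le_mul_of_nonneg_right hy.2.le hC0
    · refine le_trans ?_ (le_max_right _ _)
      have h := mt (exp_expo_eq_one_iff hτ l).mp hl
      have h2 := norm_solve_le f h (hK' l h) h1 u
      calc _ ≤ (1 + |P.dt l / P.r|) ^ j * (K * P.r * (C / (1 + |P.dt l / P.r|) ^ j)) := by gcongr
        _ = _ := by field_simp
  · by_cases hl : P.dt l = 0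
    · simp only [hl, if_true, x_eq_of_v_eq hv]
      refine (intervalIntegral.integral_hasDerivAt_right (hint 0 u)
        ((f.continuous 0).stronglyMeasurableAtFilter _ _)
        (f.continuous 0).continuousAt).congr_deriv ?_
      rw [h0 l hl]
      simp
    · simp only [hl, if_false, x_eq_of_v_eq hv]
      refine (hasDerivAt_solve hv f (mt (exp_expo_eq_one_iff hτ l).mp hl) u).congr_deriv ?_
      rw [expo]
      ring
  · simp only [hdt, solve_add_left]
  · simp only [solve_add_right hv]
    rw [← hv, hdt, ← r_eq_of_v_eq hv, hper.sub_eq u]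

end EqualSlopes

end

section

variable {θ : ℝ} {P Q R S : Frame θ} {τ b : ℂ}

open _root_.NCTorus.Frame MeasureTheory

/-! ### Products of Gaussians -/

/-- The data of an object that do not depend on `θ` up to a simultaneous change of sign: the rows
of the matrix `g` and the number `rk(g, θ) z`. -/
@[ext] structure Datum where
  p : ℤ × ℤ
  v : ℤ × ℤ
  w : ℂ

namespace Datum

/-- The determinant of `(ℓ, v)`. -/
def dt (X : Datum) (l : ℤ × ℤ) : ℤ := l.1 * X.v.2 - l.2 * X.v.1

instance : Neg Datum := ⟨fun X => ⟨-X.p, -X.v, -X.w⟩⟩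

@[simp] lemma neg_p (X : Datum) : (-X).p = -X.p := rfl
@[simp] lemma neg_v (X : Datum) : (-X).v = -X.v := rfl
@[simp] lemma neg_w (X : Datum) : (-X).w = -X.w := rfl
@[simp] lemma neg_dt (X : Datum) (l : ℤ × ℤ) : (-X).dt l = -X.dt l := by simp [dt]; ring
@[simp] lemma dt_neg (X : Datum) (l : ℤ × ℤ) : X.dt (-l) = -X.dt l := by simp [dt]; ring

/-- The theta constant in the product of two Gaussians. -/
def coef (τ : ℂ) (X Y Z : Datum) (l l' : ℤ × ℤ) : ℂ :=
  let N : ℂ := Y.dt Z.v * X.dt l - X.dt Y.v * Z.dt l'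
  let L : ℂ := X.dt Z.v * Y.w - Y.dt Z.v * X.w - X.dt Y.v * Z.w
  Complex.exp (-(2 * Real.pi * Complex.I) * (τ * N ^ 2 / 2 + L * N)
    / (X.dt Y.v * Y.dt Z.v * X.dt Z.v))

/-- The multiplier of the composite of the Gaussians with multipliers `a` and `a'`, which is a
theta series. -/
def theta (τ : ℂ) (X Y Z : Datum) (a' a : ℤ × ℤ → ℂ) (l : ℤ × ℤ) : ℂ :=
  ∑' t : ℤ, a' (t • Y.p) * a (l - t • Y.p) * coef τ X Y Z (l - t • Y.p) (t • Y.p)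

/-- The duality between multipliers of opposite slopes. -/
def pairing (Y Z : Datum) (a' a : ℤ × ℤ → ℂ) : ℂ :=
  ∑ t ∈ Finset.range (Y.dt Z.v).natAbs, a' ((t : ℤ) • Y.p) * a (-((t : ℤ) • Y.p))

end Datum

/-- The datum of a frame and a complex number. -/
def Frame.datum (P : Frame θ) (z : ℂ) : Datum := ⟨P.p, P.v, P.r * z⟩

@[simp] lemma Frame.datum_dt (P : Frame θ) (z : ℂ) : (P.datum z).dt = P.dt := rfl
@[simp] lemma Frame.datum_v (P : Frame θ) (z : ℂ) : (P.datum z).v = P.v := rfl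
@[simp] lemma Frame.datum_w (P : Frame θ) (z : ℂ) : (P.datum z).w = P.r * z := rfl

open Datum

lemma x_eq_right (u : ℝ) (l : ℤ × ℤ) :
    x Q R u l = R.dt l / R.r + (R.m - Q.m) * (u + proj θ l) := by
  have h : (R.dt l : ℝ) = R.r * l.1 - R.c * proj θ l := by
    simp [Frame.dt, r_def, proj]; ring
  rw [x, h, Frame.m, Frame.m]
  field_simp [Q.r_ne, R.r_ne]
  ring

/-- The relation between the determinants and the ranks of three frames. -/
lemma dt_mul_r (P Q R : Frame θ) :
    (Q.dt R.v : ℝ) * P.r + P.dt Q.v * R.r = P.dt R.v * Q.r := by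
  simp [Frame.dt, Frame.v, r_def]; ring

/-- The product of two Gaussians along composable arrows is a Gaussian up to a constant. -/
lemma gauss_mul_gauss {z z' z'' : ℂ} (hPQ : P.dt Q.v ≠ 0) (hQR : Q.dt R.v ≠ 0)
    (hPR : P.dt R.v ≠ 0) (u : ℝ) (l l' : ℤ × ℤ) :
    gauss P Q τ (z' - z) (u + proj θ l') l * gauss Q R τ (z'' - z') u l' =
      coef τ (P.datum z) (Q.datum z') (R.datum z'') l l' * gauss P R τ (z'' - z) u (l + l') := by
  have hr1 : (P.r : ℂ) ≠ 0 := by exact_mod_cast P.r_ne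
  have hr2 : (Q.r : ℂ) ≠ 0 := by exact_mod_cast Q.r_ne
  have hr3 : (R.r : ℂ) ≠ 0 := by exact_mod_cast R.r_ne
  have c1 : (P.dt Q.v : ℂ) ≠ 0 := by exact_mod_cast hPQ
  have c2 : (Q.dt R.v : ℂ) ≠ 0 := by exact_mod_cast hQR
  have c3 : (P.dt R.v : ℂ) ≠ 0 := by exact_mod_cast hPR
  have hrel : (P.dt R.v : ℂ) * Q.r = Q.dt R.v * P.r + P.dt Q.v * R.r := by
    exact_mod_cast (dt_mul_r P Q R).symm
  have hx := x_add P Q R u (l + l') l'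
  rw [add_sub_cancel_right] at hx
  have hX := x_eq P Q (u + proj θ l') l
  have hY := x_eq_right (Q := Q) (R := R) u l'
  rw [gauss, gauss, gauss, coef, hx, ← Complex.exp_add, ← Complex.exp_add]
  set X := x P Q (u + proj θ l') l
  set Y := x Q R u l'
  rw [slope_sub] at hX hY
  -- The combination of the coordinates that remains after the square is completed.
  have hN : (Q.dt R.v * P.dt l - P.dt Q.v * R.dt l' : ℂ) =
      Q.dt R.v * P.r * X - P.dt Q.v * R.r * Y := by
    have h : (Q.dt R.v * P.dt l - P.dt Q.v * R.dt l' : ℝ) =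
        Q.dt R.v * P.r * X - P.dt Q.v * R.r * Y := by
      rw [hX, hY]
      have := P.r_ne
      have := Q.r_ne
      have := R.r_ne
      field_simp
      ring
    exact_mod_cast h
  congr 1
  simp only [datum_dt, datum_v, datum_w, hN, slope_sub]
  push_cast
  field_simp
  linear_combination (-(τ * (X ^ 2 * P.r * Q.dt R.v + Y ^ 2 * R.r * P.dt Q.v) +
    2 * ((z' - z) * X * P.r * Q.dt R.v + (z'' - z') * Y * R.r * P.dt Q.v -
      z' * (Q.dt R.v * P.r * X - P.dt Q.v * R.r * Y))) : ℂ) * hrel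

/-- The Gaussians of opposite slopes are inverse to each other. -/
lemma gauss_mul_gauss_of_v_eq (hv : P.v = R.v) {z z' : ℂ} (u : ℝ) (l : ℤ × ℤ) :
    gauss P Q τ (z' - z) (u + proj θ l) (-l) * gauss Q R τ (z - z') u l = 1 := by
  have h1 : x P Q (u + proj θ l) (-l) = -x Q R u l := by
    have h := x_add P Q R u 0 l
    rw [x_eq_of_v_eq hv, Frame.dt_zero, zero_sub] at h
    simp only [Int.cast_zero, zero_div] at h
    linarith
  have h2 : Q.m - P.m = -(R.m - Q.m) := by rw [m_eq_of_v_eq hv]; ring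
  rw [gauss, gauss, ← Complex.exp_add, h1, h2, Complex.exp_eq_one_iff]
  refine ⟨0, ?_⟩
  push_cast
  rw [div_neg]
  ring

/-! ### The products in cohomology -/

lemma convTerm_mul_eq {z z' z'' : ℂ} (hPQ : P.dt Q.v ≠ 0) (hQR : Q.dt R.v ≠ 0)
    (hPR : P.dt R.v ≠ 0) (g : Kernel Q R) (f : Kernel P Q) (u : ℝ) (l m : ℤ × ℤ) :
    convTerm (θ := θ) g f u l m / gauss P R τ (z'' - z) u l =
      g u m / gauss Q R τ (z'' - z') u m * (f (u + proj θ m) (l - m) /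
        gauss P Q τ (z' - z) (u + proj θ m) (l - m)) *
        coef τ (P.datum z) (Q.datum z') (R.datum z'') (l - m) m := by
  have h := gauss_mul_gauss (τ := τ) (z := z) (z' := z') (z'' := z'') hPQ hQR hPR u (l - m) m
  rw [sub_add_cancel] at h
  have h1 := gauss_ne_zero (P := P) (Q := R) (τ := τ) (b := z'' - z) u l
  have h2 := gauss_ne_zero (P := P) (Q := Q) (τ := τ) (b := z' - z) (u + proj θ m) (l - m)
  have h3 := gauss_ne_zero (P := Q) (Q := R) (τ := τ) (b := z'' - z') u m
  rw [convTerm]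
  field_simp
  linear_combination g u m * f (u + proj θ m) (l - m) * h

lemma div_gauss_eq_multiplier {f : Kernel P Q} (hc : P.dt Q.v ≠ 0) (hf : Kernel.D τ b f = 0)
    (u : ℝ) (l : ℤ × ℤ) : f u l / gauss P Q τ b u l = multiplier τ b f l := by
  rw [eq_mul_gauss (slope_sub_ne_zero hc) hf u l, mul_div_cancel_right₀ _ (gauss_ne_zero _ _)]
  rfl

lemma multiplier_comp {z z' z'' : ℂ} (hPQ : P.dt Q.v ≠ 0) (hQR : Q.dt R.v ≠ 0)
    (hPR : P.dt R.v ≠ 0) {g : Kernel Q R} {f : Kernel P Q} (hg : Kernel.D τ (z'' - z') g = 0)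
    (hf : Kernel.D τ (z' - z) f = 0) : multiplier τ (z'' - z) (Kernel.comp g f) =
      theta τ (P.datum z) (Q.datum z') (R.datum z'') (multiplier τ (z'' - z') g)
        (multiplier τ (z' - z) f) := by
  ext l
  show conv Q g f 0 l / _ = _
  rw [conv, ← tsum_div_const]
  refine tsum_congr fun t => ?_
  rw [convTerm_mul_eq hPQ hQR hPR (z' := z'), div_gauss_eq_multiplier hQR hg,
    div_gauss_eq_multiplier hPQ hf]
  rfl

/-- Integrals of compositions against a decaying weight can be computed term by term. -/
lemma hasSum_integral_convTerm (g : Kernel Q R) (f : Kernel P Q) (l : ℤ × ℤ) {ν : Measure ℝ}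
    {ψ : ℝ → ℂ} (hψc : Continuous ψ) (hψ : Integrable (fun u => (1 + |u|) ^ 2 * ‖ψ u‖) ν) :
    HasSum (fun t : ℤ => ∫ u, convTerm (θ := θ) g f u l (t • Q.p) * ψ u ∂ν)
      (∫ u, Kernel.comp g f u l * ψ u ∂ν) := by
  obtain ⟨C, hC, h⟩ := convTerm_bound g.rapid f.rapid 0
  set κ := (1 + |R.m - Q.m|) ^ 2
  have hb : ∀ (t : ℤ) u, ‖convTerm (θ := θ) g f u l (t • Q.p) * ψ u‖ ≤
      C * κ * ((1 + |t / Q.r + 0|) ^ 2)⁻¹ * ((1 + |u|) ^ 2 * ‖ψ u‖) := fun t u => by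
    have h1 := h u l t
    rw [pow_zero, one_mul] at h1
    have h2 := inv_sq_le (t / Q.r + (R.m - Q.m) * u) (t / Q.r)
    rw [add_sub_cancel_left] at h2
    have h3 : (1 + |(R.m - Q.m) * u|) ^ 2 ≤ κ * (1 + |u|) ^ 2 := by
      rw [← mul_pow, abs_mul]
      gcongr
      nlinarith [abs_nonneg u, abs_nonneg (R.m - Q.m)]
    rw [norm_mul, add_zero]
    calc _ ≤ C * ((κ * (1 + |u|) ^ 2) * ((1 + |t / Q.r|) ^ 2)⁻¹) * ‖ψ u‖ := by
          gcongr
          refine h1.trans ?_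
          gcongr
          refine h2.trans ?_
          gcongr
      _ = _ := by ring
  have hmeas : ∀ t : ℤ, AEStronglyMeasurable
      (fun u => convTerm (θ := θ) g f u l (t • Q.p) * ψ u) ν := fun t =>
    (((g.continuous _).mul ((f.continuous _).comp
      (continuous_id.add continuous_const))).mul hψc).aestronglyMeasurable
  have hint : ∀ t : ℤ, Integrable (fun u => convTerm (θ := θ) g f u l (t • Q.p) * ψ u) ν := fun t =>
    (hψ.const_mul _).mono' (hmeas t) (Filter.Eventually.of_forall (hb t))
  obtain ⟨B, -, hB⟩ := exists_tsum_inv_sq_le Q.r_pos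
  have hsum : Summable fun t : ℤ => ∫ u, ‖convTerm (θ := θ) g f u l (t • Q.p) * ψ u‖ ∂ν := by
    refine Summable.of_nonneg_of_le (fun t => integral_nonneg fun u => norm_nonneg _) (fun t => ?_)
      ((((hB 0).1).mul_left (C * κ)).mul_right (∫ u, (1 + |u|) ^ 2 * ‖ψ u‖ ∂ν))
    rw [← integral_const_mul]
    exact integral_mono (hint t).norm (hψ.const_mul _) (hb t)
  have h4 := hasSum_integral_of_summable_integral_norm hint hsum
  rwa [integral_congr_ae (Filter.Eventually.of_forall fun u => tsum_mul_right)] at h4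

/-- For a decreasing slope, the inverse of the Gaussian decays. -/
lemma integrable_weight_gauss_inv (hτ : τ.im < 0) (hc : P.dt Q.v < 0) (b : ℂ) (l : ℤ × ℤ) :
    Integrable fun u => (1 + |u|) ^ 2 * ‖(gauss P Q τ b u l)⁻¹‖ := by
  have hμ := slope_sub_neg hc
  have h0 : ∀ u l, (gauss P Q τ b u l)⁻¹ = Complex.exp
      ((Real.pi * Complex.I * τ / (Q.m - P.m : ℝ)) * (x P Q u l : ℂ) ^ 2
      + (2 * Real.pi * Complex.I * b / (Q.m - P.m : ℝ)) * x P Q u l) := fun u l => by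
    rw [gauss_eq, ← Complex.exp_neg]; congr 1; ring
  have hS := isSchwartz_cexp (P := P) (Q := Q)
    (α := Real.pi * Complex.I * τ / (Q.m - P.m : ℝ)) (by
      have h := re_I_mul_div τ (Q.m - P.m)
      rw [Complex.neg_re] at h
      have h1 := div_pos_of_neg_of_neg (by nlinarith [Real.pi_pos] : Real.pi * τ.im < 0) hμ
      linarith) (2 * Real.pi * Complex.I * b / (Q.m - P.m : ℝ))
  obtain ⟨C, hC⟩ := hS.rapid 4
  simp only [← h0] at hC
  set ρ := root P Q l
  set μ := Q.m - P.m
  have hcont : Continuous fun u => (gauss P Q τ b u l)⁻¹ :=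
    (continuous_gauss hμ.ne l).inv₀ fun u => gauss_ne_zero _ _
  refine ((integrable_inv_one_add_sq.comp_sub_right ρ).const_mul
    ((1 + |ρ|) ^ 2 * (1 + |μ|⁻¹) ^ 4 * C)).mono'
    (((continuous_const.add continuous_abs).pow 2).mul hcont.norm).aestronglyMeasurable
    (Filter.Eventually.of_forall fun u => ?_)
  rw [Real.norm_of_nonneg (by positivity), ← div_eq_mul_inv, le_div_iff₀ (by positivity)]
  have h1 := one_add_abs_le u ρ
  have h2 : 1 + |u - ρ| ≤ (1 + |μ|⁻¹) * (1 + |x P Q u l|) := by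
    rw [x_eq_mul_sub_root hc.ne, abs_mul]
    have : 0 < |μ| := abs_pos.mpr hμ.ne
    have h3 : |μ|⁻¹ * (|μ| * |u - ρ|) = |u - ρ| := by field_simp
    have h4 : 0 ≤ |μ|⁻¹ := by positivity
    have h5 : 0 ≤ |μ| * |u - ρ| := by positivity
    nlinarith
  have h3 : 1 + (u - ρ) ^ 2 ≤ (1 + |u - ρ|) ^ 2 := by
    rw [← sq_abs (u - ρ)]; nlinarith [abs_nonneg (u - ρ)]
  have hC1 := hC u l
  have hC0 : 0 ≤ C := le_trans (by positivity) hC1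
  calc (1 + |u|) ^ 2 * ‖(gauss P Q τ b u l)⁻¹‖ * (1 + (u - ρ) ^ 2)
      ≤ ((1 + |ρ|) * (1 + |u - ρ|)) ^ 2 * ‖(gauss P Q τ b u l)⁻¹‖ * (1 + |u - ρ|) ^ 2 := by gcongr
    _ = (1 + |ρ|) ^ 2 * (1 + |u - ρ|) ^ 4 * ‖(gauss P Q τ b u l)⁻¹‖ := by ring
    _ ≤ (1 + |ρ|) ^ 2 * ((1 + |μ|⁻¹) * (1 + |x P Q u l|)) ^ 4 * ‖(gauss P Q τ b u l)⁻¹‖ := by gcongr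
    _ = (1 + |ρ|) ^ 2 * (1 + |μ|⁻¹) ^ 4 * ((1 + |x P Q u l|) ^ 4 * ‖(gauss P Q τ b u l)⁻¹‖) := by ring
    _ ≤ _ := by gcongr

/-- The period of a composite, term by term: the quotients by the Gaussians separate by
`gauss_mul_gauss`. -/
lemma hasSum_period_comp {z z' z'' : ℂ} (hτ : τ.im < 0) (hPQ : P.dt Q.v ≠ 0) (hQR : Q.dt R.v ≠ 0)
    (hPR : P.dt R.v < 0) (g : Kernel Q R) (f : Kernel P Q) (l : ℤ × ℤ) :
    HasSum (fun t : ℤ => ∫ u, g u (t • Q.p) / gauss Q R τ (z'' - z') u (t • Q.p) *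
      (f (u + proj θ (t • Q.p)) (l - t • Q.p) /
        gauss P Q τ (z' - z) (u + proj θ (t • Q.p)) (l - t • Q.p)) *
        coef τ (P.datum z) (Q.datum z') (R.datum z'') (l - t • Q.p) (t • Q.p))
      (period τ (z'' - z) (Kernel.comp g f) l) := by
  have h := hasSum_integral_convTerm g f l (ν := volume)
    (ψ := fun u => (gauss P R τ (z'' - z) u l)⁻¹)
    ((continuous_gauss (slope_sub_ne_zero hPR.ne) l).inv₀ fun u => gauss_ne_zero _ _)
    (integrable_weight_gauss_inv hτ hPR _ l)
  simp only [← div_eq_mul_inv, convTerm_mul_eq hPQ hQR hPR.ne (z' := z')] at h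
  exact h

lemma period_comp_left {z z' z'' : ℂ} (hτ : τ.im < 0) (hPQ : P.dt Q.v ≠ 0) (hQR : Q.dt R.v ≠ 0)
    (hPR : P.dt R.v < 0) (g : Kernel Q R) {f : Kernel P Q} (hf : Kernel.D τ (z' - z) f = 0) :
    period τ (z'' - z) (Kernel.comp g f) =
      theta τ (P.datum z) (Q.datum z') (R.datum z'') (period τ (z'' - z') g)
        (multiplier τ (z' - z) f) := by
  ext l
  refine (hasSum_period_comp (z' := z') hτ hPQ hQR hPR g f l).tsum_eq.symm.trans
    (tsum_congr fun t => ?_)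
  simp only [div_gauss_eq_multiplier hPQ hf]
  rw [integral_mul_const, integral_mul_const]
  rfl

lemma period_comp_right {z z' z'' : ℂ} (hτ : τ.im < 0) (hPQ : P.dt Q.v ≠ 0) (hQR : Q.dt R.v ≠ 0)
    (hPR : P.dt R.v < 0) {g : Kernel Q R} (hg : Kernel.D τ (z'' - z') g = 0) (f : Kernel P Q) :
    period τ (z'' - z) (Kernel.comp g f) =
      theta τ (P.datum z) (Q.datum z') (R.datum z'') (multiplier τ (z'' - z') g)
        (period τ (z' - z) f) := by
  ext l
  refine (hasSum_period_comp (z' := z') hτ hPQ hQR hPR g f l).tsum_eq.symm.trans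
    (tsum_congr fun t => ?_)
  simp only [div_gauss_eq_multiplier hQR hg]
  rw [integral_mul_const, integral_const_mul, integral_add_right_eq_self (μ := volume)
    (fun u => f u (l - t • Q.p) / gauss P Q τ (z' - z) u (l - t • Q.p))]
  rfl

/-- The integral over the line as a sum over the translates of a fundamental interval. -/
lemma hasSum_integral_translates {φ : ℝ → ℂ} (hφ : Integrable φ) {r : ℝ} (hr : 0 < r) :
    HasSum (fun k : ℤ => ∫ u in (0 : ℝ)..r, φ (u + k * r)) (∫ u, φ u) := by
  have h1 := (hφ.comp_mul_left' hr.ne').hasSum_intervalIntegral 0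
  rw [Measure.integral_comp_mul_left, abs_of_pos (inv_pos.mpr hr)] at h1
  have h2 := h1.const_smul r
  rw [smul_smul, mul_inv_cancel₀ hr.ne', one_smul] at h2
  refine h2.congr_fun fun k => ?_
  rw [intervalIntegral.integral_comp_mul_left _ hr.ne', smul_smul, mul_inv_cancel₀ hr.ne', one_smul,
    intervalIntegral.integral_comp_add_right]
  congr 1 <;> ring

/-- Unfolding of a sum over `ℤ` of integrals over a period. -/
lemma unfold_hasSum {c : ℤ} (hc : c ≠ 0) {r : ℝ} (hr : 0 < r) {φ : ℝ → ℤ → ℂ} {α : ℤ → ℂ} {T : ℂ}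
    (hφ : ∀ t, Integrable fun u => φ u t) (hφc : ∀ u t (k : ℤ), φ u (t + k * c) = φ (u + k * r) t)
    (hα : ∀ t k : ℤ, α (t + k * c) = α t)
    (hT : HasSum (fun t => α t * ∫ u in (0 : ℝ)..r, φ u t) T) :
    T = ∑ t ∈ Finset.range c.natAbs, α t * ∫ u, φ u t := by
  have hn : NeZero c.natAbs := ⟨Int.natAbs_ne_zero.mpr hc⟩
  -- Division with remainder by `c`.
  let E : Fin c.natAbs × ℤ ≃ ℤ :=
    { toFun := fun i => i.1 + i.2 * c
      invFun := fun t => (⟨(t % c).toNat, by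
        have h1 := Int.emod_nonneg t hc
        have h2 := Int.emod_lt_abs t hc
        rw [Int.abs_eq_natAbs] at h2
        omega⟩, t / c)
      left_inv := fun i => by
        obtain ⟨⟨i, hi⟩, k⟩ := i
        have h1 : (i : ℤ) < |c| := by rw [Int.abs_eq_natAbs]; omega
        have h2 : ((i : ℤ) + k * c) % c = i := by
          rw [Int.add_mul_emod_self_right, ← Int.emod_abs, Int.emod_eq_of_lt (by omega) h1]
        have h3 : ((i : ℤ) + k * c) / c = k := by
          have h4 := Int.emod_add_mul_ediv ((i : ℤ) + k * c) c
          rw [h2] at h4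
          refine mul_left_cancel₀ hc ?_
          linarith
        simp [h2, h3]
      right_inv := fun t => by
        have h1 := Int.emod_nonneg t hc
        have h2 := Int.emod_add_mul_ediv t c
        simp only [Int.toNat_of_nonneg h1]
        linarith }
  have h0 : HasSum (fun i : Fin c.natAbs × ℤ => α ((i.1 : ℕ) + i.2 * c) *
      ∫ u in (0 : ℝ)..r, φ u ((i.1 : ℕ) + i.2 * c)) T := by
    have hE : ∀ i, E i = (i.1 : ℕ) + i.2 * c := fun _ => rfl
    clear_value E
    have h := E.hasSum_iff.mpr hT
    simpa only [Function.comp_def, hE] using h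
  -- The sum over a residue class of integrals over a period is an integral over the line.
  have hi (i : Fin c.natAbs) : HasSum (fun k : ℤ => α ((i : ℕ) + k * c) *
      ∫ u in (0 : ℝ)..r, φ u ((i : ℕ) + k * c)) (α (i : ℕ) * ∫ u, φ u (i : ℕ)) := by
    have h2 := (hasSum_integral_translates (hφ (i : ℕ)) hr).mul_left (α (i : ℕ))
    refine h2.congr_fun fun k => ?_
    rw [hα]
    simp only [hφc]
  have h1 : HasSum (fun i : Fin c.natAbs => α (i : ℕ) * ∫ u, φ u (i : ℕ)) T :=
    HasSum.prod_fiberwise h0 hi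
  rw [Finset.sum_range (fun t : ℕ => α t * ∫ u, φ u t)]
  exact h1.unique (hasSum_fintype _)

/-- The trace of a composite, term by term. -/
lemma hasSum_trace_comp (g : Kernel Q R) (f : Kernel P Q) :
    HasSum (fun t : ℤ => ∫ u in (0 : ℝ)..P.r, g u (t • Q.p) * f (u + proj θ (t • Q.p)) (-(t • Q.p)))
      (trace (Kernel.comp g f)) := by
  have h := hasSum_integral_convTerm g f 0 (ν := volume.restrict (Set.Ioc 0 P.r))
    (ψ := fun _ => 1) continuous_const (by
      have hc : Continuous fun u : ℝ => (1 + |u|) ^ 2 * ‖(1 : ℂ)‖ :=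
        ((continuous_const.add continuous_abs).pow 2).mul continuous_const
      exact (hc.intervalIntegrable 0 P.r).1)
  simp only [mul_one, convTerm, zero_sub] at h
  simp only [trace, intervalIntegral.integral_of_le P.r_pos.le]
  exact h

lemma IsPeriodic.symm {v w : ℤ × ℤ} {a : ℤ × ℤ → ℂ} (h : IsPeriodic v w a) : IsPeriodic w v a :=
  ⟨h.2, h.1⟩

lemma mul_eq_of_v_eq (hv : P.v = R.v) {z z' : ℂ} (g : Kernel Q R) (f : Kernel P Q) (u : ℝ)
    (l : ℤ × ℤ) : g u l * f (u + proj θ l) (-l) =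
      g u l / gauss Q R τ (z - z') u l *
        (f (u + proj θ l) (-l) / gauss P Q τ (z' - z) (u + proj θ l) (-l)) := by
  have h1 := gauss_ne_zero (P := Q) (Q := R) (τ := τ) (b := z - z') u l
  have h2 := gauss_ne_zero (P := P) (Q := Q) (τ := τ) (b := z' - z) (u + proj θ l) (-l)
  have h := gauss_mul_gauss_of_v_eq (Q := Q) (τ := τ) hv (z := z) (z' := z') u l
  rw [div_mul_div_comm, mul_comm (gauss Q R τ (z - z') u l), h, div_one]

/-- The product `H¹ ⊗ H⁰ → H¹` between bundles of opposite slope differences: unfolding turns the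
integral over a period into the integrals over the line that define `period`. -/
lemma trace_comp_left {z z' : ℂ} (hτ : τ.im < 0) (hv : P.v = R.v) (hQR : Q.dt R.v < 0)
    (g : Kernel Q R) {f : Kernel P Q} (hf : Kernel.D τ (z' - z) f = 0) :
    trace (Kernel.comp g f) =
      pairing (Q.datum z') (R.datum z) (period τ (z - z') g) (multiplier τ (z' - z) f) := by
  have hPQ : P.dt Q.v ≠ 0 := by
    have h : P.dt Q.v = -Q.dt R.v := by rw [← hv, dt_v_symm]
    rw [h]; exact neg_ne_zero.mpr hQR.ne
  have ha := isPeriodic_multiplier hPQ hf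
  rw [hv] at ha
  have hr : P.r = R.r := r_eq_of_v_eq hv
  have hs := hasSum_trace_comp g f
  simp only [mul_eq_of_v_eq (τ := τ) hv (z := z) (z' := z'), div_gauss_eq_multiplier hPQ hf,
    intervalIntegral.integral_mul_const] at hs
  obtain ⟨s, hs'⟩ := Q.exists_eq R.v
  have hp : ∀ k : ℤ, (k * Q.dt R.v) • Q.p = k • R.v + (-(k * s)) • Q.v := fun k => by
    conv_rhs => rw [hs']
    rw [smul_add, mul_smul, neg_smul, mul_smul]
    abel
  have h := unfold_hasSum (c := Q.dt R.v) hQR.ne P.r_pos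
    (φ := fun u t => g u (t • Q.p) / gauss Q R τ (z - z') u (t • Q.p))
    (α := fun t => multiplier τ (z' - z) f (-(t • Q.p)))
    (fun t => integrable_div_gauss hτ hQR g _ _) (fun u t k => ?_) (fun t k => ?_)
    (T := trace (Kernel.comp g f)) (by simpa only [mul_comm] using hs)
  · rw [h, pairing]
    exact Finset.sum_congr rfl fun t _ => mul_comm _ _
  · have hg : ∀ l, g u (l + (k * Q.dt R.v) • Q.p) = g (u + k * R.r) l := fun l => by
      rw [hp, ← add_assoc, Kernel.add_left_smul, Kernel.add_right_smul]
    have hx : x Q R u ((t + k * Q.dt R.v) • Q.p) = x Q R (u + k * R.r) (t • Q.p) := by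
      rw [x_smul_p, x_smul_p, slope_sub]
      have := Q.r_ne
      have := R.r_ne
      push_cast
      field_simp
      ring
    simp only [add_smul] at hx ⊢
    rw [hg, gauss, gauss, hx, hr]
  · have h1 := ha.symm.add_smul_p (-k) (-(t • Q.p))
    rw [add_smul, neg_add, ← h1, neg_mul, neg_smul]

/-- The product `H⁰ ⊗ H¹ → H¹` between bundles of opposite slope differences, by the same
unfolding. -/
lemma trace_comp_right {z z' : ℂ} (hτ : τ.im < 0) (hv : P.v = R.v) (hPQ : P.dt Q.v < 0)
    {g : Kernel Q R} (hg : Kernel.D τ (z - z') g = 0) (f : Kernel P Q) :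
    trace (Kernel.comp g f) =
      pairing (Q.datum z') (R.datum z) (multiplier τ (z - z') g) (period τ (z' - z) f) := by
  have hQR : Q.dt R.v ≠ 0 := by
    have h : Q.dt R.v = -P.dt Q.v := by rw [← hv, dt_v_symm]
    rw [h]; exact neg_ne_zero.mpr hPQ.ne
  have ha := isPeriodic_multiplier hQR hg
  have hr : P.r = R.r := r_eq_of_v_eq hv
  have hs := hasSum_trace_comp g f
  simp only [mul_eq_of_v_eq (τ := τ) hv (z := z) (z' := z'), div_gauss_eq_multiplier hQR hg,
    intervalIntegral.integral_const_mul] at hs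
  obtain ⟨s, hs'⟩ := Q.exists_eq R.v
  have hp : ∀ k : ℤ, (k * Q.dt R.v) • Q.p = k • R.v + (-(k * s)) • Q.v := fun k => by
    conv_rhs => rw [hs']
    rw [smul_add, mul_smul, neg_smul, mul_smul]
    abel
  have hpr : ∀ k : ℤ, proj θ ((k * Q.dt R.v) • Q.p) = k * R.r - k * s * Q.r := fun k => by
    rw [hp, proj_add, proj_smul, proj_smul]
    show (k : ℝ) * R.r + ((-(k * s) : ℤ) : ℝ) * Q.r = _
    push_cast
    ring
  have h := unfold_hasSum (c := Q.dt R.v) hQR P.r_pos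
    (φ := fun u t => f (u + proj θ (t • Q.p)) (-(t • Q.p)) /
      gauss P Q τ (z' - z) (u + proj θ (t • Q.p)) (-(t • Q.p)))
    (α := fun t => multiplier τ (z - z') g (t • Q.p))
    (fun t => (integrable_div_gauss hτ hPQ f (z' - z) (-(t • Q.p))).comp_add_right _)
    (fun u t k => ?_) (fun t k => ?_) hs
  · rw [h, pairing]
    refine Finset.sum_congr rfl fun t _ => ?_
    rw [integral_add_right_eq_self (μ := volume) (fun u => f u (-((t : ℤ) • Q.p)) /
      gauss P Q τ (z' - z) u (-((t : ℤ) • Q.p)))]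
    rfl
  · have e1 : -((t + k * Q.dt R.v) • Q.p) = -(t • Q.p) + (k * s) • Q.v + (-k) • P.v := by
      rw [add_smul, hp, hv, neg_smul, neg_smul]; abel
    have e2 : u + proj θ ((t + k * Q.dt R.v) • Q.p) + ((k * s : ℤ) : ℝ) * Q.r
        = u + k * P.r + proj θ (t • Q.p) := by
      rw [add_smul, proj_add, hpr, hr]; push_cast; ring
    have hf : ∀ y, f y (-((t + k * Q.dt R.v) • Q.p)) = f (y + ((k * s : ℤ) : ℝ) * Q.r) (-(t • Q.p)) :=
      fun y => by rw [e1, Kernel.add_left_smul, Kernel.add_right_smul]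
    have hx : ∀ y, x P Q y (-((t + k * Q.dt R.v) • Q.p))
        = x P Q (y + ((k * s : ℤ) : ℝ) * Q.r) (-(t • Q.p)) := fun y => by
      rw [e1, x_eq, x_eq, slope_sub]
      simp only [Frame.dt_add, Frame.dt_smul, Frame.dt_v]
      have := P.r_ne
      have := Q.r_ne
      push_cast
      field_simp
      ring
    simp only [gauss, hx, hf, e2]
  · rw [add_smul, ha.add_smul_p]

lemma dt_eq_of_v_eq (hv : P.v = Q.v) (l : ℤ × ℤ) : P.dt l = Q.dt l := by
  rw [Frame.dt, Frame.dt, show P.c = Q.c from congrArg Prod.fst hv,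
    show P.d = Q.d from congrArg Prod.snd hv]

lemma comp_id_apply (hv : P.v = Q.v) (g : Kernel Q R) (u : ℝ) (l : ℤ × ℤ) :
    Kernel.comp g (Kernel.id P Q hv) u l = g u l := by
  conv_rhs => rw [← Kernel.comp_id g]
  simp only [Kernel.comp_apply, Kernel.id_apply, dt_eq_of_v_eq hv]

lemma id_comp_apply (hv : Q.v = R.v) (f : Kernel P Q) (u : ℝ) (l : ℤ × ℤ) :
    Kernel.comp (Kernel.id Q R hv) f u l = f u l := by
  conv_rhs => rw [← Kernel.id_comp f]
  rfl

end

section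

variable {θ : ℝ} {P Q R S : Frame θ} {τ b : ℂ}
open _root_.NCTorus.Frame MeasureTheory

/-! ### Translation of the parameter by the period lattice -/

/-- The kernel supported on `dt l = n`, where it is the character `exp(-2πiku/r)` of the circle. It
intertwines the holomorphic structures of parameters `z` and `z'` with `r (z' - z) = k - n τ`. -/
def twist (P : Frame θ) (n k : ℤ) : Kernel P P :=
  ⟨fun u l => if P.dt l = n then Complex.exp (-(2 * Real.pi * Complex.I * k / P.r) * u) else 0, by
    refine ⟨{f | ∃ c : ℂ, f = fun (u : ℝ) l => if P.dt l = n then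
      c * Complex.exp (-(2 * Real.pi * Complex.I * k / P.r) * u) else 0}, ⟨1, by simp⟩, ?_⟩
    rintro _ ⟨c, rfl⟩
    have hn (u : ℝ) : ‖Complex.exp (-(2 * Real.pi * Complex.I * k / P.r) * u)‖ = 1 := by
      have h : -(2 * Real.pi * Complex.I * k / P.r : ℂ) * u =
          ((-(2 * Real.pi * k / P.r) * u : ℝ) : ℂ) * Complex.I := by push_cast; ring
      rw [h, Complex.norm_exp_ofReal_mul_I]
    refine ⟨fun j => ⟨(1 + |(n : ℝ) / P.r|) ^ j * ‖c‖, fun u l => ?_⟩, _,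
      ⟨c * -(2 * Real.pi * Complex.I * k / P.r), rfl⟩, fun u l => ?_⟩
    · by_cases hl : P.dt l = n
      · rw [x_eq, hl, sub_self, zero_mul, add_zero]
        simp only [hl, if_true, norm_mul, hn, mul_one, le_refl]
      · simp only [hl, if_false, norm_zero, mul_zero]
        positivity
    · by_cases hl : P.dt l = n
      · simp only [hl, if_true]
        have h := ((hasDerivAt_id (u : ℂ)).const_mul
          (-(2 * Real.pi * Complex.I * k / P.r))).cexp.comp_ofReal.const_mul c
        simp only [id_eq, mul_one] at h
        exact h.congr_deriv (by ring)
      · simp only [hl, if_false]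
        exact hasDerivAt_const _ _,
  fun u l => by simp [dt_add],
  fun u l => by
    have h : -(2 * Real.pi * Complex.I * k / P.r : ℂ) * ((u - P.r : ℝ) : ℂ) =
        -(2 * Real.pi * Complex.I * k / P.r) * u + k * (2 * Real.pi * Complex.I) := by
      have := Complex.ofReal_ne_zero.mpr P.r_ne
      push_cast
      field_simp
      ring
    simp only [dt_add, dt_v, add_zero, h, Complex.exp_add, Complex.exp_int_mul_two_pi_mul_I,
      mul_one]⟩

lemma twist_apply (n k : ℤ) (u : ℝ) (l : ℤ × ℤ) : twist P n k u l =
    if P.dt l = n then Complex.exp (-(2 * Real.pi * Complex.I * k / P.r) * u) else 0 := rfl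

lemma D_twist {n k : ℤ} (h : P.r * b = k - n * τ) : Kernel.D τ b (twist P n k) = 0 := by
  refine Kernel.D_eq_of_hasDerivAt fun u l => ?_
  show HasDerivAt _ (0 - _) u
  by_cases hl : P.dt l = n
  · simp only [twist_apply, hl, if_true, x_eq, sub_self, zero_mul, add_zero]
    have h1 := ((hasDerivAt_id (u : ℂ)).const_mul
      (-(2 * Real.pi * Complex.I * k / P.r))).cexp.comp_ofReal
    simp only [id_eq, mul_one] at h1
    refine h1.congr_deriv ?_
    have hr := Complex.ofReal_ne_zero.mpr P.r_ne
    have hb : b = (k - n * τ) / P.r := by rw [← h]; field_simp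
    rw [hb]
    push_cast
    field_simp
    ring
  · simp only [twist_apply, hl, if_false, mul_zero, sub_zero]
    exact hasDerivAt_const _ _

lemma exists_twist_comp_twist (P : Frame θ) (n k : ℤ) : ∃ c : ℂ, c ≠ 0 ∧
    Kernel.comp (twist P (-n) (-k)) (twist P n k) = c • Kernel.id P P rfl := by
  refine ⟨Complex.exp (2 * Real.pi * Complex.I * k / P.r * (n * proj θ P.p : ℝ)),
    Complex.exp_ne_zero _, ?_⟩
  ext u l
  have hp : ∀ t : ℤ, P.dt (t • P.p) = t := fun t => by rw [dt_smul, dt_p, mul_one]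
  rw [Kernel.comp_apply, tsum_eq_single (-n)]
  · show _ = Complex.exp _ * _
    rw [Kernel.id_apply, twist_apply, twist_apply, dt_sub, hp, if_pos rfl]
    by_cases hl : P.dt l = 0
    · rw [if_pos (by rw [hl]; ring), if_pos hl, mul_one, ← Complex.exp_add, proj_smul]
      congr 1
      push_cast
      ring
    · rw [if_neg (by intro h; apply hl; linarith), if_neg hl, mul_zero, mul_zero]
  · intro t ht
    rw [twist_apply, hp, if_neg ht, zero_mul]

/-- Composition with a twist translates the parameter of the holomorphic structure by the lattice
`r⁻¹(ℤτ + ℤ)`. -/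
lemma Model.translate {E : HolModule θ τ} {z z' : ℂ} (M : Model E P z) {n k : ℤ}
    (h : P.r * (z' - z) = k - n * τ) : Nonempty (Model E P z') := by
  let L (n k : ℤ) : Kernel (O θ) P →ₗ[ℂ] Kernel (O θ) P :=
    { toFun := fun f => Kernel.comp (twist P n k) f
      map_add' := fun f g => Kernel.comp_add _ f g
      map_smul' := fun c f => Kernel.comp_smul c _ f }
  have hL (n k : ℤ) : ∃ c : ℂ, c ≠ 0 ∧ ∀ f, L (-n) (-k) (L n k f) = c • f := by
    obtain ⟨c, hc, h⟩ := exists_twist_comp_twist P n k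
    refine ⟨c, hc, fun f => ?_⟩
    show Kernel.comp _ (Kernel.comp _ f) = _
    rw [← Kernel.comp_assoc, h, Kernel.smul_comp, Kernel.id_comp]
  have hbij : Function.Bijective (L n k) := by
    constructor
    · intro f g hfg
      obtain ⟨c, hc, h⟩ := hL n k
      have h1 := congrArg (L (-n) (-k)) hfg
      rw [h, h] at h1
      exact smul_right_injective _ hc h1
    · intro f
      obtain ⟨c, hc, h⟩ := hL (-n) (-k)
      rw [neg_neg, neg_neg] at h
      exact ⟨c⁻¹ • L (-n) (-k) f, by rw [map_smul, h, smul_smul, inv_mul_cancel₀ hc, one_smul]⟩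
  refine ⟨⟨M.β.trans (LinearEquiv.ofBijective (L n k) hbij), fun f a => ?_, fun f => ?_⟩⟩
  · show Kernel.comp _ (M.β _) = Kernel.comp (Kernel.comp _ (M.β f)) _
    rw [M.smul, Kernel.comp_assoc]
  · show Kernel.comp _ (M.β _) = Kernel.D τ z' (Kernel.comp _ (M.β f))
    have h1 := Kernel.D_comp (τ := τ) z (z' - z) (twist P n k) (M.β f)
    rw [add_sub_cancel, D_twist h] at h1
    rw [M.nabla, h1]
    have h2 := Kernel.smul_comp 0 (twist P n k) (M.β f)
    rw [zero_smul, zero_smul] at h2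
    rw [h2, zero_add]

end

section

variable {θ : ℝ} {P Q R S : Frame θ} {τ b : ℂ}
open _root_.NCTorus.Frame MeasureTheory

/-! ### The structure constants of the cohomology category -/

/-- The coordinates of a morphism of the cohomology category. Between bundles of different slopes
this is a periodic function on `ℤ²`; between isomorphic bundles it is the pair of the components in
`H⁰ = ℂ` and in `H¹ = ℂ`. -/
abbrev Val : Type := (ℤ × ℤ → ℂ) × ℂ × ℂ

namespace Datum

/-- The data of isomorphic bundles, up to the sign of each of the data. -/
def Same (X Y : Datum) : Prop := X.v = Y.v ∧ X.w = Y.w ∨ X.v = -Y.v ∧ X.w = -Y.w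

/-- The coordinates which occur for the morphisms between the bundles with data `X` and `Y`. -/
def Admissible (X Y : Datum) (f : Val) : Prop :=
  (X.dt Y.v ≠ 0 → IsPeriodic X.v Y.v f.1 ∧ f.2 = 0) ∧
    (X.dt Y.v = 0 → f.1 = 0 ∧ (¬ Same X Y → f.2 = 0))

/-- The coordinates of the morphisms of degree `k` between the bundles with data `X` and `Y`, the
second shifted by `δ` with respect to the first. The cohomology is in `H¹` if `X.dt Y.v < 0`. -/
def HasDegree (X Y : Datum) (δ k : ℤ) (f : Val) : Prop :=
  (X.dt Y.v ≠ 0 → (k ≠ δ + if X.dt Y.v < 0 then 1 else 0) → f = 0) ∧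
    (X.dt Y.v = 0 → (k ≠ δ → f.2.1 = 0) ∧ (k ≠ δ + 1 → f.2.2 = 0))

open Classical in
/-- The coordinates of the composite of the morphisms with coordinates `f` (from `X` to `Y`) and
`g` (from `Y` to `Z`). Everything here depends on the lattice data only, and not on `θ`. -/
def mulVal (τ : ℂ) (X Y Z : Datum) (f g : Val) : Val :=
  if X.dt Y.v = 0 then
    if Y.dt Z.v = 0 then (0, f.2.1 * g.2.1, f.2.1 * g.2.2 + f.2.2 * g.2.1) else (f.2.1 • g.1, 0, 0)
  else if Y.dt Z.v = 0 then (g.2.1 • f.1, 0, 0)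
  else if X.dt Z.v = 0 then if Same X Z then (0, 0, pairing Y Z g.1 f.1) else 0
  else if 0 < X.dt Y.v * Y.dt Z.v * X.dt Z.v then (theta τ X Y Z g.1 f.1, 0, 0) else 0

lemma same_neg_left {X Y : Datum} : Same (-X) Y ↔ Same X Y := by
  simp only [Same, neg_v, neg_w, neg_eq_iff_eq_neg, _root_.neg_neg]
  exact or_comm

lemma same_neg_right {X Y : Datum} : Same X (-Y) ↔ Same X Y := by
  simp only [Same, neg_v, neg_w, _root_.neg_neg]
  exact or_comm

end Datum

namespace IsPeriodic

lemma neg_left {v w : ℤ × ℤ} {a : ℤ × ℤ → ℂ} : IsPeriodic (-v) w a ↔ IsPeriodic v w a := by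
  refine and_congr_left fun _ => ⟨fun h l => ?_, fun h l => ?_⟩
  · rw [← h (l + v), add_neg_cancel_right]
  · rw [← h (l + -v), neg_add_cancel_right]

lemma neg_right {v w : ℤ × ℤ} {a : ℤ × ℤ → ℂ} : IsPeriodic v (-w) a ↔ IsPeriodic v w a :=
  ⟨fun h => (neg_left.mp h.symm).symm, fun h => (neg_left.mpr h.symm).symm⟩

end IsPeriodic

namespace Datum

lemma admissible_neg_left {X Y : Datum} {f : Val} : Admissible (-X) Y f ↔ Admissible X Y f := by
  simp only [Admissible, same_neg_left, neg_dt, neg_v, IsPeriodic.neg_left, neg_ne_zero,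
    neg_eq_zero]

lemma admissible_neg_right {X Y : Datum} {f : Val} : Admissible X (-Y) f ↔ Admissible X Y f := by
  simp only [Admissible, same_neg_right, dt_neg, neg_v, IsPeriodic.neg_right, neg_ne_zero,
    neg_eq_zero]

lemma coef_neg_left (τ : ℂ) (X Y Z : Datum) : coef τ (-X) Y Z = coef τ X Y Z := by
  funext l l'
  simp only [coef, neg_dt, neg_w, Int.cast_neg]
  congr 1
  ring

lemma coef_neg_middle (τ : ℂ) (X Y Z : Datum) : coef τ X (-Y) Z = coef τ X Y Z := by
  funext l l'
  simp only [coef, neg_dt, neg_w, neg_v, dt_neg, Int.cast_neg]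
  congr 1
  ring

lemma coef_neg_right (τ : ℂ) (X Y Z : Datum) : coef τ X Y (-Z) = coef τ X Y Z := by
  funext l l'
  simp only [coef, neg_dt, neg_w, neg_v, dt_neg, Int.cast_neg]
  congr 1
  ring

lemma theta_neg_middle (τ : ℂ) (X Y Z : Datum) : theta τ X (-Y) Z = theta τ X Y Z := by
  funext a' a l
  simp only [theta, coef_neg_middle, neg_p]
  rw [← (Equiv.neg ℤ).tsum_eq]
  simp only [Equiv.neg_apply, smul_neg, neg_smul, _root_.neg_neg]

open Classical in
lemma mulVal_neg_left (τ : ℂ) (X Y Z : Datum) : mulVal τ (-X) Y Z = mulVal τ X Y Z := by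
  funext f g
  have h : theta τ (-X) Y Z g.1 f.1 = theta τ X Y Z g.1 f.1 := by
    funext l
    simp only [theta, coef_neg_left]
  simp only [mulVal, neg_dt, neg_eq_zero, h, neg_mul, mul_neg, _root_.neg_neg,
    if_congr (same_neg_left (X := X) (Y := Z)) rfl rfl]

open Classical in
lemma mulVal_neg_right (τ : ℂ) (X Y Z : Datum) : mulVal τ X Y (-Z) = mulVal τ X Y Z := by
  funext f g
  have h : theta τ X Y (-Z) g.1 f.1 = theta τ X Y Z g.1 f.1 := by
    funext l
    simp only [theta, coef_neg_right]
  have h' : pairing Y (-Z) g.1 f.1 = pairing Y Z g.1 f.1 := by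
    simp only [pairing, neg_v, dt_neg, Int.natAbs_neg]
  simp only [mulVal, neg_v, dt_neg, neg_eq_zero, h, h', neg_mul, mul_neg,
    _root_.neg_neg, if_congr (same_neg_right (X := X) (Y := Z)) rfl rfl]

end Datum

lemma sum_range_neg {h : ℤ → ℂ} {n : ℕ} (hn : ∀ t, h (t + n) = h t) :
    ∑ t ∈ Finset.range n, h (-(t : ℤ)) = ∑ t ∈ Finset.range n, h t := by
  rw [← Finset.sum_range_reflect (fun t : ℕ => h t)]
  have h1 := (Finset.sum_range_succ (fun t : ℕ => h (-(t : ℤ))) n).symm.trans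
    (Finset.sum_range_succ' (fun t : ℕ => h (-(t : ℤ))) n)
  have h2 : h (-(n : ℤ)) = h 0 := by rw [← hn, neg_add_cancel]
  rw [h2, Nat.cast_zero, neg_zero, add_left_inj] at h1
  rw [h1]
  refine Finset.sum_congr rfl fun t ht => ?_
  rw [Finset.mem_range] at ht
  rw [← hn]
  congr 1
  omega

/-- Changing the sign of the middle datum reverses the order of summation in the pairing, which is
harmless for periodic arguments. -/
lemma pairing_neg {z : ℂ} {Z : Datum} {a' a : ℤ × ℤ → ℂ} (ha' : IsPeriodic Q.v Z.v a')
    (ha : IsPeriodic Q.v Z.v a) : (-(Q.datum z)).pairing Z a' a =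
      (Q.datum z).pairing Z a' a := by
  obtain ⟨s, hs⟩ := Q.exists_eq Z.v
  have hp {a : ℤ × ℤ → ℂ} (ha : IsPeriodic Q.v Z.v a) (l : ℤ × ℤ) (k : ℤ) :
      a (l + (k * Q.dt Z.v) • Q.p) = a l := by
    have h1 : (k * Q.dt Z.v) • Q.p = k • Z.v + (-(k * s)) • Q.v := by
      conv_rhs => rw [hs]
      rw [smul_add, mul_smul, neg_smul, mul_smul]
      abel
    rw [h1, ← add_assoc, add_smul_of_add ha.1, add_smul_of_add ha.2]
  have hdt : (Q.datum z).dt Z.v = Q.dt Z.v := rfl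
  have h := sum_range_neg (h := fun t => a' (t • Q.p) * a (-(t • Q.p))) (n := (Q.dt Z.v).natAbs)
    fun t => by
      obtain ⟨k, hk⟩ : ∃ k : ℤ, ((Q.dt Z.v).natAbs : ℤ) = k * Q.dt Z.v := by
        rcases Int.natAbs_eq (Q.dt Z.v) with h | h
        · exact ⟨1, by omega⟩
        · exact ⟨-1, by omega⟩
      show a' _ * a _ = a' _ * a _
      rw [hk, add_smul, hp ha', neg_add, ← neg_smul (k * _), ← neg_mul, hp ha]
  simp only [Datum.pairing, Datum.neg_dt, Datum.neg_p, Int.natAbs_neg, hdt]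
  refine Eq.trans (Finset.sum_congr rfl fun t _ => ?_) h
  show a' ((t : ℤ) • -Q.p) * a (-((t : ℤ) • -Q.p)) = _
  rw [smul_neg, neg_smul]

lemma mulVal_neg_middle {X Z : Datum} {z : ℂ} {f g : Val} (hf : X.Admissible (Q.datum z) f)
    (hg : (Q.datum z).Admissible Z g) :
    X.mulVal τ (-(Q.datum z)) Z f g = X.mulVal τ (Q.datum z) Z f g := by
  simp only [Datum.mulVal, Datum.neg_v, Datum.neg_dt, Datum.dt_neg, neg_eq_zero, neg_mul, mul_neg,
    neg_neg, Datum.theta_neg_middle]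
  by_cases h1 : X.dt (Q.datum z).v = 0
  · simp only [h1, if_true]
  by_cases h2 : (Q.datum z).dt Z.v = 0
  · simp only [h2, if_true]
  -- The pairing is used only if `X` and `Z` agree up to sign; then `f` and `g` have the same
  -- periods.
  by_cases h3 : X.Same Z
  · have hf' := (hf.1 h1).1
    have hX : IsPeriodic Q.v Z.v f.1 := by
      rcases h3 with ⟨h3, -⟩ | ⟨h3, -⟩
      · rw [h3] at hf'; exact hf'.symm
      · rw [h3, IsPeriodic.neg_left] at hf'; exact hf'.symm
    rw [pairing_neg (hg.1 h2).1 hX]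
  · simp only [h3, if_false]

end

section

variable {θ : ℝ} {P Q R S : Frame θ} {τ b : ℂ}
open _root_.NCTorus.Frame MeasureTheory

/-! ### Coordinates on the cohomology of the complex of kernels -/

lemma dt_v_eq_zero_iff : P.dt Q.v = 0 ↔ P.v = Q.v := by
  refine ⟨fun h => ?_, fun h => by rw [← h, dt_v]⟩
  obtain ⟨s, hs⟩ := P.exists_eq Q.v
  obtain ⟨t, ht⟩ := Q.exists_eq P.v
  rw [h, zero_smul, zero_add] at hs
  rw [dt_v_symm, h, neg_zero, zero_smul, zero_add] at ht
  have h1 : Q.r = s * P.r := by rw [Frame.r, hs, proj_smul]; rfl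
  have h2 : P.r = t * Q.r := by rw [Frame.r, ht, proj_smul]; rfl
  have hP := P.r_pos
  have hQ := Q.r_pos
  have h3 : ((t * s : ℤ) : ℝ) = 1 := by
    have h4 : P.r * (t * s - 1) = 0 := by rw [h1] at h2; linarith
    push_cast
    rcases mul_eq_zero.mp h4 with h4 | h4
    · exact absurd h4 hP.ne'
    · linarith
  have hs0 : 0 < s := by
    have : (0 : ℝ) < s := (mul_pos_iff_of_pos_right hP).mp (h1 ▸ hQ)
    exact_mod_cast this
  -- Proportional primitive vectors agree up to sign, and the ranks are positive.
  have h5 : s = 1 := Int.eq_one_of_dvd_one hs0.le ⟨t, by rw [mul_comm]; exact_mod_cast h3.symm⟩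
  rw [hs, h5, one_smul]

lemma trichotomy (P Q : Frame θ) : 0 < P.dt Q.v ∨ P.dt Q.v < 0 ∨ P.v = Q.v := by
  rw [← dt_v_eq_zero_iff]
  omega

lemma same_datum_iff {z z' : ℂ} :
    Datum.Same (P.datum z) (Q.datum z') ↔ P.v = Q.v ∧ z = z' := by
  have hr : (P.r : ℂ) ≠ 0 := Complex.ofReal_ne_zero.mpr P.r_ne
  constructor
  · rintro (⟨h1, h2⟩ | ⟨h1, -⟩)
    · change P.v = Q.v at h1
      change P.r * z = Q.r * z' at h2
      rw [← r_eq_of_v_eq h1] at h2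
      exact ⟨h1, mul_left_cancel₀ hr h2⟩
    · change P.v = -Q.v at h1
      have h3 : P.r = -Q.r := by
        rw [Frame.r, h1, show -Q.v = (-1 : ℤ) • Q.v by simp, proj_smul]
        simp [Frame.r]
      linarith [P.r_pos, Q.r_pos]
  · rintro ⟨h1, rfl⟩
    refine Or.inl ⟨h1, ?_⟩
    show P.r * z = Q.r * z
    rw [r_eq_of_v_eq h1]

/-- Bundles of the same slope with parameters `z` and `z'` are equal or have no morphisms. -/
def Separated (τ : ℂ) (P Q : Frame θ) (z z' : ℂ) : Prop :=
  P.v = Q.v → z ≠ z' → ∀ l, Complex.exp (expo τ (z' - z) P l * P.r) ≠ 1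

open Classical in
/-- The coordinates of a closed kernel as a class in `H⁰`. -/
def coord0 (τ : ℂ) (P Q : Frame θ) (z z' : ℂ) : Kernel P Q →ₗ[ℂ] Val where
  toFun f :=
    if 0 < P.dt Q.v then (multiplier τ (z' - z) f, 0, 0)
    else if P.v = Q.v ∧ z = z' then (0, f 0 0, 0) else 0
  map_add' f g := by
    have h : multiplier τ (z' - z) (f + g) = multiplier τ (z' - z) f + multiplier τ (z' - z) g :=
      funext fun l => add_div (f 0 l) (g 0 l) _
    split_ifs
    · rw [h]; simp
    · exact Prod.ext (add_zero 0).symm (Prod.ext rfl (add_zero 0).symm)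
    · simp
  map_smul' c f := by
    have h : multiplier τ (z' - z) (c • f) = c • multiplier τ (z' - z) f :=
      funext fun l => mul_div_assoc c (f 0 l) _
    split_ifs
    · rw [h]; simp
    · exact Prod.ext (smul_zero c).symm (Prod.ext rfl (smul_zero c).symm)
    · simp

open Classical in
/-- The coordinates of a kernel as a class in `H¹`. -/
def coord1 (hτ : τ.im < 0) (P Q : Frame θ) (z z' : ℂ) : Kernel P Q →ₗ[ℂ] Val where
  toFun f :=
    if P.dt Q.v < 0 then (period τ (z' - z) f, 0, 0)
    else if P.v = Q.v ∧ z = z' then (0, 0, trace f) else 0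
  map_add' f g := by
    split_ifs with h1 h2
    · have h : period τ (z' - z) (f + g) = period τ (z' - z) f + period τ (z' - z) g := by
        funext l
        show ∫ s, (f s l + g s l) / _ = _
        simp only [add_div]
        exact integral_add (integrable_div_gauss hτ h1 f _ l) (integrable_div_gauss hτ h1 g _ l)
      rw [h]; simp
    · have h : trace (f + g) = trace f + trace g :=
        intervalIntegral.integral_add ((f.continuous 0).intervalIntegrable _ _)
          ((g.continuous 0).intervalIntegrable _ _)
      rw [h]; simp
    · simp
  map_smul' c f := by
    split_ifs with h1 h2
    · have h : period τ (z' - z) (c • f) = c • period τ (z' - z) f := by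
        funext l
        show ∫ s, c * f s l / _ = c * ∫ s, _
        simp only [mul_div_assoc]
        exact integral_const_mul _ _
      rw [h]; simp
    · have h : trace (c • f) = c * trace f := intervalIntegral.integral_const_mul _ _
      rw [h]; simp
    · simp

section coord

variable {z z' z'' : ℂ} {f : Kernel P Q}

lemma coord0_of_pos (h : 0 < P.dt Q.v) (f : Kernel P Q) :
    coord0 τ P Q z z' f = (multiplier τ (z' - z) f, 0, 0) := if_pos h

lemma coord0_of_neg (h : P.dt Q.v < 0) (f : Kernel P Q) : coord0 τ P Q z z' f = 0 := by
  refine (if_neg h.not_gt).trans (if_neg fun h' => ?_)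
  rw [dt_v_eq_zero_iff.mpr h'.1] at h
  exact h.false

lemma coord0_of_eq (h : P.v = Q.v) (f : Kernel P Q) : coord0 τ P Q z z f = (0, f 0 0, 0) :=
  (if_neg (dt_v_eq_zero_iff.mpr h).not_gt).trans (if_pos ⟨h, rfl⟩)

lemma coord0_of_ne (h : P.v = Q.v) (hz : z ≠ z') (f : Kernel P Q) : coord0 τ P Q z z' f = 0 :=
  (if_neg (dt_v_eq_zero_iff.mpr h).not_gt).trans (if_neg fun h => hz h.2)

variable (hτ : τ.im < 0)
include hτ

lemma coord1_of_neg (h : P.dt Q.v < 0) (f : Kernel P Q) :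
    coord1 hτ P Q z z' f = (period τ (z' - z) f, 0, 0) := if_pos h

lemma coord1_of_pos (h : 0 < P.dt Q.v) (f : Kernel P Q) : coord1 hτ P Q z z' f = 0 := by
  refine (if_neg h.not_gt).trans (if_neg fun h' => ?_)
  rw [dt_v_eq_zero_iff.mpr h'.1] at h
  exact h.false

lemma coord1_of_eq (h : P.v = Q.v) (f : Kernel P Q) : coord1 hτ P Q z z f = (0, 0, trace f) :=
  (if_neg (dt_v_eq_zero_iff.mpr h).not_lt).trans (if_pos ⟨h, rfl⟩)

lemma coord1_of_ne (h : P.v = Q.v) (hz : z ≠ z') (f : Kernel P Q) : coord1 hτ P Q z z' f = 0 :=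
  (if_neg (dt_v_eq_zero_iff.mpr h).not_lt).trans (if_neg fun h => hz h.2)

lemma coord1_D (f : Kernel P Q) : coord1 hτ P Q z z' (Kernel.D τ (z' - z) f) = 0 := by
  rcases trichotomy P Q with h | h | h
  · exact coord1_of_pos hτ h _
  · rw [coord1_of_neg hτ h, period_D hτ h]; rfl
  · by_cases hz : z = z'
    · subst hz
      rw [coord1_of_eq hτ h, sub_self, trace_D h]; rfl
    · exact coord1_of_ne hτ h hz _

lemma eq_zero_of_coord0_eq_zero (hs : Separated τ P Q z z') (hf : Kernel.D τ (z' - z) f = 0)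
    (h0 : coord0 τ P Q z z' f = 0) : f = 0 := by
  rcases trichotomy P Q with h | h | h
  · rw [coord0_of_pos h] at h0
    have h1 : multiplier τ (z' - z) f = 0 := (Prod.ext_iff.mp h0).1
    ext u l
    have h2 := div_gauss_eq_multiplier h.ne' hf u l
    rw [h1, Pi.zero_apply, div_eq_zero_iff, or_iff_left (gauss_ne_zero u l)] at h2
    exact h2
  · exact eq_zero_of_D_eq_zero hτ h hf
  · by_cases hz : z = z'
    · subst hz
      rw [coord0_of_eq h] at h0
      have h1 : f 0 0 = 0 := (Prod.ext_iff.mp (Prod.ext_iff.mp h0).2).1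
      rw [sub_self] at hf
      rw [eq_smul_id h hτ.ne hf, h1, zero_smul]
    · ext u l
      exact eq_zero_of_monodromy h hf (hs h hz l) u

lemma exists_D_eq_of_coord1_eq_zero (hs : Separated τ P Q z z') (h0 : coord1 hτ P Q z z' f = 0) :
    ∃ g : Kernel P Q, Kernel.D τ (z' - z) g = f := by
  rcases trichotomy P Q with h | h | h
  · exact D_surjective hτ h _ f
  · rw [coord1_of_neg hτ h] at h0
    exact exists_D_eq_of_period_eq_zero hτ h (Prod.ext_iff.mp h0).1
  · by_cases hz : z = z'
    · subst hz
      rw [coord1_of_eq hτ h] at h0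
      rw [sub_self]
      exact exists_D_eq_of_trace_eq_zero h hτ.ne (Prod.ext_iff.mp (Prod.ext_iff.mp h0).2).2
    · exact exists_D_eq_of_monodromy h hτ.ne (hs h hz) f

omit hτ in
lemma admissible_iff_of_ne (h : P.dt Q.v ≠ 0) {v : Val} :
    Datum.Admissible (P.datum z) (Q.datum z') v ↔ IsPeriodic P.v Q.v v.1 ∧ v.2 = 0 :=
  ⟨fun H => H.1 h, fun H => ⟨fun _ => H, fun h' => absurd h' h⟩⟩

lemma admissible_coord (hf : Kernel.D τ (z' - z) f = 0) (g : Kernel P Q) :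
    Datum.Admissible (P.datum z) (Q.datum z') (coord0 τ P Q z z' f + coord1 hτ P Q z z' g) := by
  rcases trichotomy P Q with h | h | h
  · rw [coord0_of_pos h, coord1_of_pos hτ h, add_zero, admissible_iff_of_ne h.ne']
    exact ⟨isPeriodic_multiplier h.ne' hf, rfl⟩
  · rw [coord0_of_neg h, coord1_of_neg hτ h, zero_add, admissible_iff_of_ne h.ne]
    exact ⟨isPeriodic_period g, rfl⟩
  · refine ⟨fun h' => absurd (dt_v_eq_zero_iff.mpr h) h', fun _ => ?_⟩
    by_cases hz : z = z'
    · subst hz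
      rw [coord0_of_eq h, coord1_of_eq hτ h]
      exact ⟨add_zero 0, fun h' => absurd (same_datum_iff.mpr ⟨h, rfl⟩) h'⟩
    · rw [coord0_of_ne h hz, coord1_of_ne hτ h hz]
      exact ⟨add_zero 0, fun _ => add_zero 0⟩

/-- The cohomology attains all admissible coordinates. -/
lemma exists_coord_eq {v : Val} (hv : Datum.Admissible (P.datum z) (Q.datum z') v) :
    ∃ f g : Kernel P Q, Kernel.D τ (z' - z) f = 0 ∧
      coord0 τ P Q z z' f + coord1 hτ P Q z z' g = v := by
  rcases trichotomy P Q with h | h | h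
  · rw [admissible_iff_of_ne h.ne'] at hv
    refine ⟨ofPeriodic (b := z' - z) hτ h hv.1, 0, D_ofPeriodic hτ h hv.1, ?_⟩
    rw [coord0_of_pos h, coord1_of_pos hτ h, add_zero]
    refine Prod.ext (funext fun l => ?_) hv.2.symm
    exact mul_div_cancel_right₀ (v.1 l) (gauss_ne_zero 0 l)
  · rw [admissible_iff_of_ne h.ne] at hv
    obtain ⟨g, hg⟩ := exists_period_eq (b := z' - z) hτ h hv.1
    refine ⟨0, g, map_zero _, ?_⟩
    rw [coord0_of_neg h, coord1_of_neg hτ h, zero_add, hg]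
    exact Prod.ext rfl hv.2.symm
  · have hv' := hv.2 (dt_v_eq_zero_iff.mpr h)
    by_cases hz : z = z'
    · subst hz
      refine ⟨v.2.1 • Kernel.id P Q h, (v.2.2 / P.r) • Kernel.id P Q h, ?_, ?_⟩
      · rw [map_smul, sub_self, D_id, smul_zero]
      · rw [map_smul, map_smul, coord0_of_eq h, coord1_of_eq hτ h, trace_id, Kernel.id_apply,
          if_pos (by simp [Frame.dt])]
        have hr : (P.r : ℂ) ≠ 0 := Complex.ofReal_ne_zero.mpr P.r_ne
        refine Prod.ext ?_ (Prod.ext ?_ ?_)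
        · simp [hv'.1]
        · simp
        · simp [hr]
    · refine ⟨0, 0, map_zero _, ?_⟩
      rw [map_zero, map_zero, add_zero]
      refine Prod.ext hv'.1.symm (hv'.2 fun h' => hz ?_).symm
      exact (same_datum_iff.mp h').2

end coord

end

section

variable {θ : ℝ} {P Q R S : Frame θ} {τ b : ℂ}
open _root_.NCTorus.Frame MeasureTheory

/-! ### Multiplicativity of the coordinates -/

section

variable {z z' z'' : ℂ}

lemma Kernel.comp_zero' (g : Kernel Q R) : Kernel.comp g (0 : Kernel P Q) = 0 := by
  simpa using Kernel.comp_smul 0 g (0 : Kernel P Q)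

lemma Kernel.zero_comp' (f : Kernel P Q) : Kernel.comp (0 : Kernel Q R) f = 0 := by
  simpa using Kernel.smul_comp 0 (0 : Kernel Q R) f

lemma D_comp_of_left {g : Kernel Q R} (hg : Kernel.D τ (z'' - z') g = 0) (f : Kernel P Q) :
    Kernel.D τ (z'' - z) (Kernel.comp g f) = Kernel.comp g (Kernel.D τ (z' - z) f) := by
  have h := Kernel.D_comp (τ := τ) (z' - z) (z'' - z') g f
  rwa [sub_add_sub_cancel', hg, Kernel.zero_comp', zero_add] at h

lemma D_comp_of_right (g : Kernel Q R) {f : Kernel P Q} (hf : Kernel.D τ (z' - z) f = 0) :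
    Kernel.D τ (z'' - z) (Kernel.comp g f) = Kernel.comp (Kernel.D τ (z'' - z') g) f := by
  have h := Kernel.D_comp (τ := τ) (z' - z) (z'' - z') g f
  rwa [sub_add_sub_cancel', hf, Kernel.comp_zero', add_zero] at h

lemma gauss_congr {P' Q' : Frame θ} (hP : P.v = P'.v) (hQ : Q.v = Q'.v) (u : ℝ) (l : ℤ × ℤ) :
    gauss P Q τ b u l = gauss P' Q' τ b u l := by
  rw [gauss_congr_left hP, gauss_congr_right hQ]

lemma coord0_congr {P' Q' : Frame θ} (hP : P.v = P'.v) (hQ : Q.v = Q'.v) {f : Kernel P Q}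
    {f' : Kernel P' Q'} (h : ∀ u l, f u l = f' u l) :
    coord0 τ P Q z z' f = coord0 τ P' Q' z z' f' := by
  have h1 : multiplier τ (z' - z) f = multiplier τ (z' - z) f' := funext fun l => by
    rw [multiplier, multiplier, h, gauss_congr hP hQ]
  simp only [coord0, LinearMap.coe_mk, AddHom.coe_mk, dt_eq_of_v_eq hP, hP, hQ, h, h1]

lemma coord1_congr (hτ : τ.im < 0) {P' Q' : Frame θ} (hP : P.v = P'.v) (hQ : Q.v = Q'.v)
    {f : Kernel P Q} {f' : Kernel P' Q'} (h : ∀ u l, f u l = f' u l) :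
    coord1 hτ P Q z z' f = coord1 hτ P' Q' z z' f' := by
  have h1 : period τ (z' - z) f = period τ (z' - z) f' := funext fun l => by
    simp only [period, h, gauss_congr hP hQ]
  have h2 : trace f = trace f' := by simp only [trace, h, r_eq_of_v_eq hP]
  simp only [coord1, LinearMap.coe_mk, AddHom.coe_mk, dt_eq_of_v_eq hP, hP, hQ, h1, h2]

variable (hτ : τ.im < 0)
include hτ

omit hτ in
lemma trace_smul (c : ℂ) (f : Kernel P Q) : trace (c • f) = c * trace f :=
  intervalIntegral.integral_const_mul _ _

/-- A class in `H¹` between bundles with the same datum is a multiple of that of the identity. -/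
lemma exists_eq_D_add_smul_id (hv : P.v = Q.v) (f : Kernel P Q) :
    ∃ h : Kernel P Q, f = Kernel.D τ (z - z) h + (trace f / P.r) • Kernel.id P Q hv := by
  have hr : (P.r : ℂ) ≠ 0 := Complex.ofReal_ne_zero.mpr P.r_ne
  have h0 : trace (f + (-(trace f / P.r)) • Kernel.id P Q hv) = 0 := by
    have h1 : trace (f + (-(trace f / P.r)) • Kernel.id P Q hv) =
        trace f + trace ((-(trace f / P.r)) • Kernel.id P Q hv) :=
      intervalIntegral.integral_add (Continuous.intervalIntegrable (f.continuous 0) _ _)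
        (Continuous.intervalIntegrable (Kernel.continuous _ 0) _ _)
    rw [h1, trace_smul, trace_id]
    field_simp
    ring
  obtain ⟨h, hh⟩ := exists_D_eq_of_trace_eq_zero hv hτ.ne h0
  exact ⟨h, by rw [sub_self, hh, neg_smul, neg_add_cancel_right]⟩

/-- Composition with morphisms between bundles with the same datum multiplies by scalars. -/
lemma coord_comp_of_eq_left (hv : P.v = Q.v) {f₀ f₁ : Kernel P Q} {g₀ g₁ : Kernel Q R}
    (hf : Kernel.D τ (z - z) f₀ = 0) (hg : Kernel.D τ (z' - z) g₀ = 0) :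
    coord0 τ P R z z' (Kernel.comp g₀ f₀) +
        coord1 hτ P R z z' (Kernel.comp g₀ f₁ + Kernel.comp g₁ f₀) =
      Datum.mulVal τ (P.datum z) (Q.datum z) (R.datum z')
        (coord0 τ P Q z z f₀ + coord1 hτ P Q z z f₁)
        (coord0 τ Q R z z' g₀ + coord1 hτ Q R z z' g₁) := by
  rw [sub_self] at hf
  have hf₀ := eq_smul_id hv hτ.ne hf
  set s := f₀ 0 0
  obtain ⟨h, hf₁⟩ := exists_eq_D_add_smul_id (z := z) hτ hv f₁
  have hc0 (g : Kernel Q R) : coord0 τ P R z z' (Kernel.comp g (Kernel.id P Q hv)) =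
      coord0 τ Q R z z' g := coord0_congr hv rfl (comp_id_apply hv g)
  have hc1 (g : Kernel Q R) : coord1 hτ P R z z' (Kernel.comp g (Kernel.id P Q hv)) =
      coord1 hτ Q R z z' g := coord1_congr hτ hv rfl (comp_id_apply hv g)
  have e0 : coord0 τ P R z z' (Kernel.comp g₀ f₀) = s • coord0 τ Q R z z' g₀ := by
    rw [hf₀, Kernel.comp_smul, map_smul, hc0]
  have e1 : coord1 hτ P R z z' (Kernel.comp g₁ f₀) = s • coord1 hτ Q R z z' g₁ := by
    rw [hf₀, Kernel.comp_smul, map_smul, hc1]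
  have e2 : coord1 hτ P R z z' (Kernel.comp g₀ f₁) =
      (trace f₁ / P.r) • coord1 hτ Q R z z' g₀ := by
    conv_lhs => rw [hf₁]
    rw [Kernel.comp_add, map_add, ← D_comp_of_left hg, coord1_D, zero_add, Kernel.comp_smul,
      map_smul, hc1]
  have hdt : (P.datum z).dt (Q.datum z).v = 0 := dt_v_eq_zero_iff.mpr hv
  rw [map_add, e0, e1, e2, coord0_of_eq hv, coord1_of_eq hτ hv, Datum.mulVal, if_pos hdt]
  rcases trichotomy Q R with hc | hc | hc
  · rw [if_neg (show ¬(Q.datum z).dt (R.datum z').v = 0 from hc.ne'), coord1_of_pos hτ hc,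
      coord1_of_pos hτ hc, coord0_of_pos hc]
    simp [s]
  · have hg₀ : g₀ = 0 := eq_zero_of_D_eq_zero hτ hc hg
    rw [if_neg (show ¬(Q.datum z).dt (R.datum z').v = 0 from hc.ne), hg₀, map_zero, map_zero,
      coord1_of_neg hτ hc]
    simp [s]
  · rw [if_pos (show (Q.datum z).dt (R.datum z').v = 0 from dt_v_eq_zero_iff.mpr hc)]
    by_cases hz : z = z'
    · subst hz
      rw [sub_self] at hg
      have hg₀ := eq_smul_id hc hτ.ne hg
      have ht : trace g₀ = g₀ 0 0 * P.r := by
        rw [r_eq_of_v_eq hv]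
        conv_lhs => rw [hg₀]
        rw [trace_smul, trace_id]
      have hr : (P.r : ℂ) ≠ 0 := Complex.ofReal_ne_zero.mpr P.r_ne
      rw [coord0_of_eq hc, coord1_of_eq hτ hc, coord1_of_eq hτ hc, ht]
      refine Prod.ext (by simp) (Prod.ext (by simp [s]) ?_)
      simp [s]
      field_simp
      ring
    · rw [coord0_of_ne hc hz, coord1_of_ne hτ hc hz, coord1_of_ne hτ hc hz]
      simp
      rfl

/-- The counterpart of `coord_comp_of_eq_left` for the second factor; the case in which all three
slopes agree is covered there. -/
lemma coord_comp_of_eq_right (hv : Q.v = R.v) (hne : P.dt Q.v ≠ 0) {f₀ f₁ : Kernel P Q}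
    {g₀ g₁ : Kernel Q R} (hf : Kernel.D τ (z' - z) f₀ = 0) (hg : Kernel.D τ (z' - z') g₀ = 0) :
    coord0 τ P R z z' (Kernel.comp g₀ f₀) +
        coord1 hτ P R z z' (Kernel.comp g₀ f₁ + Kernel.comp g₁ f₀) =
      Datum.mulVal τ (P.datum z) (Q.datum z') (R.datum z')
        (coord0 τ P Q z z' f₀ + coord1 hτ P Q z z' f₁)
        (coord0 τ Q R z' z' g₀ + coord1 hτ Q R z' z' g₁) := by
  rw [sub_self] at hg
  have hg₀ := eq_smul_id hv hτ.ne hg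
  set s := g₀ 0 0
  have hc0 (f : Kernel P Q) : coord0 τ P R z z' (Kernel.comp (Kernel.id Q R hv) f) =
      coord0 τ P Q z z' f := coord0_congr rfl hv.symm (id_comp_apply hv f)
  have hc1 (f : Kernel P Q) : coord1 hτ P R z z' (Kernel.comp (Kernel.id Q R hv) f) =
      coord1 hτ P Q z z' f := coord1_congr hτ rfl hv.symm (id_comp_apply hv f)
  have e0 : coord0 τ P R z z' (Kernel.comp g₀ f₀) = s • coord0 τ P Q z z' f₀ := by
    rw [hg₀, Kernel.smul_comp, map_smul, hc0]
  have e1 : coord1 hτ P R z z' (Kernel.comp g₀ f₁) = s • coord1 hτ P Q z z' f₁ := by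
    rw [hg₀, Kernel.smul_comp, map_smul, hc1]
  have hdt : (Q.datum z').dt (R.datum z').v = 0 := dt_v_eq_zero_iff.mpr hv
  rw [map_add, e0, e1, coord0_of_eq hv, coord1_of_eq hτ hv, Datum.mulVal,
    if_neg (show ¬(P.datum z).dt (Q.datum z').v = 0 from hne), if_pos hdt]
  rcases lt_or_gt_of_ne hne with hc | hc
  · have hf₀ : f₀ = 0 := eq_zero_of_D_eq_zero hτ hc hf
    rw [hf₀, Kernel.comp_zero', map_zero, map_zero, coord1_of_neg hτ hc]
    simp [s]
  · have hc' : 0 < P.dt R.v := by rw [← hv]; exact hc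
    rw [coord1_of_pos hτ hc, coord1_of_pos hτ hc', coord0_of_pos hc]
    simp [s]

/-- The coordinates turn the composition into `mulVal`. -/
lemma coord_comp (hs : Separated τ P Q z z') (hs' : Separated τ Q R z' z'')
    {f₀ f₁ : Kernel P Q} {g₀ g₁ : Kernel Q R} (hf : Kernel.D τ (z' - z) f₀ = 0)
    (hg : Kernel.D τ (z'' - z') g₀ = 0) :
    coord0 τ P R z z'' (Kernel.comp g₀ f₀) +
        coord1 hτ P R z z'' (Kernel.comp g₀ f₁ + Kernel.comp g₁ f₀) =
      Datum.mulVal τ (P.datum z) (Q.datum z') (R.datum z'')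
        (coord0 τ P Q z z' f₀ + coord1 hτ P Q z z' f₁)
        (coord0 τ Q R z' z'' g₀ + coord1 hτ Q R z' z'' g₁) := by
  by_cases h1 : P.v = Q.v
  · by_cases hz : z = z'
    · subst hz
      exact coord_comp_of_eq_left hτ h1 hf hg
    · have hf₀ : f₀ = 0 := eq_zero_of_coord0_eq_zero hτ hs hf (coord0_of_ne h1 hz f₀)
      obtain ⟨h, rfl⟩ := exists_D_eq_of_coord1_eq_zero hτ hs (coord1_of_ne hτ h1 hz f₁)
      have hdt : (P.datum z).dt (Q.datum z').v = 0 := dt_v_eq_zero_iff.mpr h1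
      rw [hf₀, Kernel.comp_zero', Kernel.comp_zero', map_zero, map_zero, add_zero,
        ← D_comp_of_left hg, coord1_D, coord1_D, Datum.mulVal, if_pos hdt]
      split_ifs <;> simp <;> rfl
  by_cases h2 : Q.v = R.v
  · by_cases hz : z' = z''
    · subst hz
      exact coord_comp_of_eq_right hτ h2 (mt dt_v_eq_zero_iff.mp h1) hf hg
    · have hg₀ : g₀ = 0 := eq_zero_of_coord0_eq_zero hτ hs' hg (coord0_of_ne h2 hz g₀)
      obtain ⟨h, rfl⟩ := exists_D_eq_of_coord1_eq_zero hτ hs' (coord1_of_ne hτ h2 hz g₁)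
      have hdt : (Q.datum z').dt (R.datum z'').v = 0 := dt_v_eq_zero_iff.mpr h2
      rw [hg₀, Kernel.zero_comp', Kernel.zero_comp', map_zero, map_zero, zero_add, zero_add,
        ← D_comp_of_right _ hf, coord1_D, coord1_D, Datum.mulVal,
        if_neg (show ¬(P.datum z).dt (Q.datum z').v = 0 from mt dt_v_eq_zero_iff.mp h1),
        if_pos hdt]
      simp
      rfl
  -- From now on both factors are between bundles of different slopes, so that each of them is
  -- either in `H⁰` or in `H¹`, according to the sign.
  have d1 : P.dt Q.v ≠ 0 := mt dt_v_eq_zero_iff.mp h1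
  have d2 : Q.dt R.v ≠ 0 := mt dt_v_eq_zero_iff.mp h2
  rw [Datum.mulVal, if_neg (show ¬(P.datum z).dt (Q.datum z').v = 0 from d1),
    if_neg (show ¬(Q.datum z').dt (R.datum z'').v = 0 from d2)]
  have zero_of_neg {P Q : Frame θ} {b : ℂ} (h : P.dt Q.v < 0) {f : Kernel P Q}
      (hf : Kernel.D τ b f = 0) : f = 0 := eq_zero_of_D_eq_zero hτ h hf
  by_cases h3 : P.v = R.v
  · have d3 : P.dt R.v = 0 := dt_v_eq_zero_iff.mpr h3
    have d4 : Q.dt R.v = -P.dt Q.v := by rw [← h3, dt_v_symm]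
    rw [if_pos (show (P.datum z).dt (R.datum z'').v = 0 from d3)]
    by_cases hz : z = z''
    · subst hz
      rw [if_pos (same_datum_iff.mpr ⟨h3, rfl⟩), coord0_of_eq h3, coord1_of_eq hτ h3]
      rcases lt_or_gt_of_ne d1 with hc | hc
      · have hc' : 0 < Q.dt R.v := by omega
        rw [zero_of_neg hc hf, Kernel.comp_zero', Kernel.comp_zero', add_zero, map_zero, zero_add,
          coord1_of_neg hτ hc, coord0_of_pos hc', coord1_of_pos hτ hc', add_zero,
          trace_comp_right hτ h3 hc hg f₁]
        exact Prod.ext (add_zero 0) (Prod.ext (add_zero 0) (zero_add _))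
      · have hc' : Q.dt R.v < 0 := by omega
        rw [zero_of_neg hc' hg, Kernel.zero_comp', Kernel.zero_comp', zero_add, map_zero, zero_add,
          coord0_of_pos hc, coord1_of_neg hτ hc', coord1_of_pos hτ hc, add_zero,
          trace_comp_left hτ h3 hc' g₁ hf]
        exact Prod.ext (add_zero 0) (Prod.ext (add_zero 0) (zero_add _))
    · rw [if_neg fun h => hz (same_datum_iff.mp h).2, coord0_of_ne h3 hz, coord1_of_ne hτ h3 hz,
        add_zero]
  have d3 : P.dt R.v ≠ 0 := mt dt_v_eq_zero_iff.mp h3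
  rw [if_neg (show ¬(P.datum z).dt (R.datum z'').v = 0 from d3)]
  change _ = if 0 < P.dt Q.v * Q.dt R.v * P.dt R.v then _ else _
  have hdr := dt_mul_r P Q R
  have hP := P.r_pos
  have hQ := Q.r_pos
  have hR := R.r_pos
  rcases lt_or_gt_of_ne d1 with c1 | c1 <;> rcases lt_or_gt_of_ne d2 with c2 | c2
  -- `H¹ ⊗ H¹`: the product vanishes for reasons of degree.
  · have c3 : P.dt R.v < 0 := by
      have h4 : (P.dt Q.v : ℝ) < 0 := by exact_mod_cast c1
      have h5 : (Q.dt R.v : ℝ) < 0 := by exact_mod_cast c2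
      have h6 : (P.dt R.v : ℝ) * Q.r < 0 := by nlinarith
      have h7 : (P.dt R.v : ℝ) < 0 := by nlinarith
      exact_mod_cast h7
    rw [if_neg (mul_neg_of_pos_of_neg (mul_pos_of_neg_of_neg c1 c2) c3).not_gt,
      zero_of_neg c1 hf, zero_of_neg c2 hg]
    simp only [Kernel.comp_zero', Kernel.zero_comp', add_zero, map_zero]
  -- First factor in `H¹`, second in `H⁰`: if the slope increases from `P` to `R`, then the product
  -- is in a group `H¹` that vanishes.
  · rcases lt_or_gt_of_ne d3 with c3 | c3
    · rw [if_pos (mul_pos_of_neg_of_neg (mul_neg_of_neg_of_pos c1 c2) c3), zero_of_neg c1 hf,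
        Kernel.comp_zero', Kernel.comp_zero', add_zero, map_zero, map_zero, zero_add, zero_add,
        coord1_of_neg hτ c3, coord1_of_neg hτ c1, coord0_of_pos c2, coord1_of_pos hτ c2, add_zero,
        period_comp_right hτ d1 d2 c3 hg f₁]
    · rw [if_neg (mul_neg_of_neg_of_pos (mul_neg_of_neg_of_pos c1 c2) c3).not_gt,
        coord1_of_pos hτ c3, zero_of_neg c1 hf, Kernel.comp_zero', map_zero, add_zero]
  -- First factor in `H⁰`, second in `H¹`.
  · rcases lt_or_gt_of_ne d3 with c3 | c3
    · rw [if_pos (mul_pos_of_neg_of_neg (mul_neg_of_pos_of_neg c1 c2) c3), zero_of_neg c2 hg,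
        Kernel.zero_comp', Kernel.zero_comp', zero_add, map_zero, map_zero, zero_add, zero_add,
        coord1_of_neg hτ c3, coord1_of_neg hτ c2, coord0_of_pos c1, coord1_of_pos hτ c1, add_zero,
        period_comp_left hτ d1 d2 c3 g₁ hf]
    · rw [if_neg (mul_neg_of_neg_of_pos (mul_neg_of_pos_of_neg c1 c2) c3).not_gt,
        coord1_of_pos hτ c3, zero_of_neg c2 hg, Kernel.zero_comp', map_zero, add_zero]
  -- `H⁰ ⊗ H⁰`.
  · have c3 : 0 < P.dt R.v := by
      have h4 : (0 : ℝ) < P.dt Q.v := by exact_mod_cast c1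
      have h5 : (0 : ℝ) < Q.dt R.v := by exact_mod_cast c2
      have h6 : 0 < (P.dt R.v : ℝ) * Q.r := by rw [← hdr]; positivity
      have h7 : (0 : ℝ) < P.dt R.v := (mul_pos_iff_of_pos_right hQ).mp h6
      exact_mod_cast h7
    rw [if_pos (mul_pos (mul_pos c1 c2) c3), coord1_of_pos hτ c3, coord1_of_pos hτ c1,
      coord1_of_pos hτ c2, coord0_of_pos c1, coord0_of_pos c2, coord0_of_pos c3, add_zero, add_zero,
      add_zero, multiplier_comp d1 d2 d3 hg hf]

end

end

section

variable {θ : ℝ} {P Q R S : Frame θ} {τ b : ℂ}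
open _root_.NCTorus.Frame MeasureTheory

/-! ### Coordinates on the cohomology of the morphism complexes -/

section

variable {z z' z'' : ℂ} (hτ : τ.im < 0)

lemma coord_add_eq_zero_iff {f g : Kernel P Q} :
    coord0 τ P Q z z' f + coord1 hτ P Q z z' g = 0 ↔
      coord0 τ P Q z z' f = 0 ∧ coord1 hτ P Q z z' g = 0 := by
  rcases trichotomy P Q with h | h | h
  · rw [coord1_of_pos hτ h, add_zero]; simp
  · rw [coord0_of_neg h, zero_add]; simp
  · by_cases hz : z = z'
    · subst hz
      rw [coord0_of_eq h, coord1_of_eq hτ h]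
      simp only [Prod.ext_iff, Prod.fst_add, Prod.snd_add, add_zero, zero_add, Prod.fst_zero,
        Prod.snd_zero]
      tauto
    · rw [coord0_of_ne h hz, zero_add]; simp

lemma hasDegree_coord_iff {f g : Kernel P Q} {δ k : ℤ} :
    Datum.HasDegree (P.datum z) (Q.datum z') δ k
        (coord0 τ P Q z z' f + coord1 hτ P Q z z' g) ↔
      (k ≠ δ → coord0 τ P Q z z' f = 0) ∧ (k ≠ δ + 1 → coord1 hτ P Q z z' g = 0) := by
  have hdt : (P.datum z).dt (Q.datum z').v = P.dt Q.v := rfl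
  rw [Datum.HasDegree, hdt]
  rcases trichotomy P Q with h | h | h
  · simp [coord1_of_pos hτ h, h.ne', h.not_gt]
  · simp [coord0_of_neg h, h.ne, h]
  · rw [dt_v_eq_zero_iff.mpr h]
    by_cases hz : z = z'
    · subst hz
      rw [coord0_of_eq h, coord1_of_eq hτ h]
      simp [Prod.ext_iff]
    · rw [coord0_of_ne h hz, coord1_of_ne hτ h hz]
      simp

end

namespace Model

open HolModule

variable {E E' E'' : HolModule θ τ} {z z' z'' : ℂ} (hτ : τ.im < 0)
variable (M : Model E P z) (M' : Model E' Q z') (M'' : Model E'' R z'')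

/-- The coordinates of a class in `H⁰ ⊕ H¹`. -/
def coord : (H0 E E' × H1 E E') →ₗ[ℂ] Val :=
  LinearMap.coprod
    (coord0 τ P Q z z' ∘ₗ (morEquiv M M').symm.toLinearMap ∘ₗ (H0 E E').subtype)
    ((LinearMap.range (d E E')).liftQ (coord1 hτ P Q z z' ∘ₗ (morEquiv M M').symm.toLinearMap) (by
      rintro _ ⟨φ, rfl⟩
      obtain ⟨k, rfl⟩ := toMor_bijective M M' |>.2 φ
      rw [d_toMor, LinearMap.mem_ker]
      show coord1 hτ P Q z z' ((morEquiv M M').symm (morEquiv M M' _)) = 0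
      rw [LinearEquiv.symm_apply_apply, coord1_D]))

/-- The class of a closed kernel in `H⁰` and of a kernel in `H¹`. -/
def cls (f g : Kernel P Q) (hf : Kernel.D τ (z' - z) f = 0) : H0 E E' × H1 E E' :=
  (⟨toMor M M' f, by rw [LinearMap.mem_ker, d_toMor, hf, map_zero]⟩,
    Submodule.Quotient.mk (toMor M M' g))

lemma coord_cls (f g : Kernel P Q) (hf : Kernel.D τ (z' - z) f = 0) :
    coord hτ M M' (cls M M' f g hf) = coord0 τ P Q z z' f + coord1 hτ P Q z z' g := by
  show coord0 τ P Q z z' ((morEquiv M M').symm (morEquiv M M' f)) +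
    coord1 hτ P Q z z' ((morEquiv M M').symm (morEquiv M M' g)) = _
  rw [LinearEquiv.symm_apply_apply, LinearEquiv.symm_apply_apply]

lemma exists_cls (φ : H0 E E' × H1 E E') :
    ∃ (f g : Kernel P Q) (hf : Kernel.D τ (z' - z) f = 0), cls M M' f g hf = φ := by
  obtain ⟨⟨φ₀, h₀⟩, φ₁⟩ := φ
  induction φ₁ using Submodule.Quotient.induction_on with
  | _ φ₁ =>
  obtain ⟨f, rfl⟩ := (toMor_bijective M M').2 φ₀
  obtain ⟨g, rfl⟩ := (toMor_bijective M M').2 φ₁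
  rw [LinearMap.mem_ker, d_toMor, map_eq_zero_iff _ (toMor_bijective M M').1] at h₀
  exact ⟨f, g, h₀, rfl⟩

include hτ in
lemma cls_fst_eq_zero_iff (hs : Separated τ P Q z z') {f g : Kernel P Q}
    {hf : Kernel.D τ (z' - z) f = 0} :
    (cls M M' f g hf).1 = 0 ↔ coord0 τ P Q z z' f = 0 := by
  refine Subtype.ext_iff.trans ⟨fun h => ?_, fun h => ?_⟩
  · change toMor M M' f = 0 at h
    rw [map_eq_zero_iff _ (toMor_bijective M M').1] at h
    rw [h, map_zero]
  · show toMor M M' f = 0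
    rw [eq_zero_of_coord0_eq_zero hτ hs hf h, map_zero]

lemma cls_snd_eq_zero_iff (hs : Separated τ P Q z z') {f g : Kernel P Q}
    {hf : Kernel.D τ (z' - z) f = 0} :
    (cls M M' f g hf).2 = 0 ↔ coord1 hτ P Q z z' g = 0 := by
  refine (Submodule.Quotient.mk_eq_zero _).trans ⟨?_, fun h => ?_⟩
  · rintro ⟨φ, hφ⟩
    obtain ⟨k, rfl⟩ := (toMor_bijective M M').2 φ
    rw [d_toMor] at hφ
    rw [← (toMor_bijective M M').1 hφ, coord1_D]
  · obtain ⟨k, rfl⟩ := exists_D_eq_of_coord1_eq_zero hτ hs h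
    exact ⟨toMor M M' k, d_toMor M M' k⟩

lemma coord_injective (hs : Separated τ P Q z z') : Function.Injective (coord hτ M M') := by
  rw [injective_iff_map_eq_zero]
  intro φ hφ
  obtain ⟨f, g, hf, rfl⟩ := exists_cls M M' φ
  rw [coord_cls, coord_add_eq_zero_iff] at hφ
  exact Prod.ext ((cls_fst_eq_zero_iff hτ M M' hs).mpr hφ.1)
    ((cls_snd_eq_zero_iff hτ M M' hs).mpr hφ.2)

lemma admissible_iff {v : Val} :
    Datum.Admissible (P.datum z) (Q.datum z') v ↔ ∃ φ, coord hτ M M' φ = v := by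
  constructor
  · intro hv
    obtain ⟨f, g, hf, h⟩ := exists_coord_eq hτ hv
    exact ⟨cls M M' f g hf, by rw [coord_cls, h]⟩
  · rintro ⟨φ, rfl⟩
    obtain ⟨f, g, hf, rfl⟩ := exists_cls M M' φ
    rw [coord_cls]
    exact admissible_coord hτ hf g

lemma hasDegree_iff (hs : Separated τ P Q z z') {δ k : ℤ} {φ : H0 E E' × H1 E E'} :
    Datum.HasDegree (P.datum z) (Q.datum z') δ k (coord hτ M M' φ) ↔
      (k ≠ δ → φ.1 = 0) ∧ (k ≠ δ + 1 → φ.2 = 0) := by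
  obtain ⟨f, g, hf, rfl⟩ := exists_cls M M' φ
  rw [coord_cls, hasDegree_coord_iff, cls_fst_eq_zero_iff hτ M M' hs,
    cls_snd_eq_zero_iff hτ M M' hs]

lemma coord_id : coord hτ M M (id0 E, 0) = (0, 1, 0) := by
  have h : (id0 E, 0) = cls M M (Kernel.id P P rfl) 0 (by rw [sub_self, D_id]) := by
    refine Prod.ext (Subtype.ext (toMor_id M).symm) ?_
    show 0 = Submodule.Quotient.mk (toMor M M 0)
    rw [map_zero]
    rfl
  rw [h, coord_cls, map_zero, add_zero, coord0_of_eq rfl, Kernel.id_apply,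
    if_pos (by simp [Frame.dt])]

lemma coord_comp (hs : Separated τ P Q z z') (hs' : Separated τ Q R z' z'')
    (φ : H0 E E' × H1 E E') (ψ : H0 E' E'' × H1 E' E'') :
    coord hτ M M'' (comp0 ψ.1 φ.1, postcomp ψ.1 φ.2 + precomp φ.1 ψ.2) =
      Datum.mulVal τ (P.datum z) (Q.datum z') (R.datum z'') (coord hτ M M' φ)
        (coord hτ M' M'' ψ) := by
  obtain ⟨f₀, f₁, hf, rfl⟩ := exists_cls M M' φ
  obtain ⟨g₀, g₁, hg, rfl⟩ := exists_cls M' M'' ψ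
  have h0 : Kernel.D τ (z'' - z) (Kernel.comp g₀ f₀) = 0 := by
    rw [D_comp_of_left hg, hf, Kernel.comp_zero']
  rw [coord_cls, coord_cls, ← NCTorus.coord_comp hτ hs hs' hf hg, ← coord_cls hτ M M'' _ _ h0]
  congr 1
  refine Prod.ext (Subtype.ext (toMor_comp M M' M'' g₀ f₀).symm) ?_
  show Submodule.Quotient.mk (toMor M' M'' g₀ ∘ₗ toMor M M' f₁) +
    Submodule.Quotient.mk (toMor M' M'' g₁ ∘ₗ toMor M M' f₀) = Submodule.Quotient.mk _
  rw [map_add, toMor_comp M M' M'', toMor_comp M M' M'']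
  rfl

end Model

end

section

variable {θ : ℝ} {P Q R S : Frame θ} {τ b : ℂ}
open _root_.NCTorus.Frame MeasureTheory

/-! ### Graded equivalences -/

section

variable {C D : Type*} [Category C] [Preadditive C] [Linear ℂ C] [GradedCategory C]
  [Category D] [Preadditive D] [Linear ℂ D] [GradedCategory D]

lemma eqToHom_mem {X Y : C} (h : X = Y) : eqToHom h ∈ GradedCategory.deg X Y 0 := by
  subst h
  exact GradedCategory.id_mem X

lemma eqToHom_comp_mem {X X' Y Y' : C} (h : X = X') (h' : Y = Y') {f : X' ⟶ Y} {k : ℤ}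
    (hf : f ∈ GradedCategory.deg X' Y k) :
    eqToHom h ≫ f ≫ eqToHom h' ∈ GradedCategory.deg X Y' k := by
  subst h h'
  simpa using hf

/-- A bijection on objects together with compatible linear isomorphisms on morphisms which preserve
degrees is a graded equivalence. -/
def GradedEquivalence.ofHomEquiv (obj : C → D) (obj' : D → C) (hobj : ∀ Y, obj (obj' Y) = Y)
    (E : ∀ X Y : C, (X ⟶ Y) ≃ₗ[ℂ] (obj X ⟶ obj Y))
    (hE_id : ∀ X, E X X (𝟙 X) = 𝟙 (obj X))
    (hE_comp : ∀ {X Y Z : C} (f : X ⟶ Y) (g : Y ⟶ Z), E X Z (f ≫ g) = E X Y f ≫ E Y Z g)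
    (hE_deg : ∀ {X Y : C} {k : ℤ} {f : X ⟶ Y}, E X Y f ∈ GradedCategory.deg (obj X) (obj Y) k ↔
      f ∈ GradedCategory.deg X Y k) : GradedEquivalence C D where
  functor :=
    { obj := obj
      map := fun {X Y} f => E X Y f
      map_id := hE_id
      map_comp := hE_comp }
  inverse :=
    { obj := obj'
      map := fun {Y Y'} g =>
        (E (obj' Y) (obj' Y')).symm (eqToHom (hobj Y) ≫ g ≫ eqToHom (hobj Y').symm)
      map_id := fun Y => (LinearEquiv.symm_apply_eq _).mpr (by simp [hE_id])
      map_comp := fun f g => (LinearEquiv.symm_apply_eq _).mpr (by simp [hE_comp]) }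
  unitIso := NatIso.ofComponents
    (fun X =>
      { hom := (E X (obj' (obj X))).symm (eqToHom (hobj (obj X)).symm)
        inv := (E (obj' (obj X)) X).symm (eqToHom (hobj (obj X)))
        hom_inv_id := (E X X).injective (by simp [hE_comp, hE_id])
        inv_hom_id := (E _ _).injective (by simp [hE_comp, hE_id]) })
    (fun f => (E _ _).injective (by simp [hE_comp]))
  counitIso := NatIso.ofComponents (fun Y => eqToIso (hobj Y)) (fun g => by simp)
  functor_unitIso_comp X := by
    show E X _ ((E X (obj' (obj X))).symm (eqToHom (hobj (obj X)).symm)) ≫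
      eqToHom (hobj (obj X)) = 𝟙 (obj X)
    rw [LinearEquiv.apply_symm_apply, eqToHom_trans, eqToHom_refl]
  functor_additive := ⟨fun {X Y f g} => map_add (E X Y) f g⟩
  functor_linear := ⟨fun {X Y} f c => map_smul (E X Y) c f⟩
  inverse_additive := ⟨fun {X Y f g} => by simp⟩
  inverse_linear := ⟨fun {X Y} f c => by simp⟩
  functor_map_mem h := hE_deg.mpr h
  inverse_map_mem h := hE_deg.mp (by
    simp only [LinearEquiv.apply_symm_apply]
    exact eqToHom_comp_mem _ _ h)
  unit_mem X := by
    have h := eqToHom_mem (hobj (obj X)).symm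
    rw [← (E X (obj' (obj X))).apply_symm_apply (eqToHom _)] at h
    exact hE_deg.mp h
  unitInv_mem X := by
    have h := eqToHom_mem (hobj (obj X))
    rw [← (E (obj' (obj X)) X).apply_symm_apply (eqToHom _)] at h
    exact hE_deg.mp h
  counit_mem Y := eqToHom_mem (hobj Y)
  counitInv_mem Y := eqToHom_mem (hobj Y).symm

variable (C) in
/-- A description of the morphisms of a graded category by coordinates in `Val`, with respect to a
choice of a datum and of a shift for each object. -/
structure Coordinates (τ : ℂ) (X : C → Datum) (n : C → ℤ) where
  map (A B : C) : (A ⟶ B) →ₗ[ℂ] Val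
  injective (A B : C) : Function.Injective (map A B)
  admissible_iff {A B : C} {v : Val} : (X A).Admissible (X B) v ↔ ∃ f, map A B f = v
  map_id (A : C) : map A A (𝟙 A) = (0, 1, 0)
  map_comp {A B B' : C} (f : A ⟶ B) (g : B ⟶ B') :
    map A B' (f ≫ g) = Datum.mulVal τ (X A) (X B) (X B') (map A B f) (map B B' g)
  mem_deg {A B : C} {k : ℤ} {f : A ⟶ B} :
    f ∈ GradedCategory.deg A B k ↔ (X A).HasDegree (X B) (n A - n B) k (map A B f)

/-- Graded categories with the same structure constants in coordinates are equivalent. -/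
lemma Coordinates.exists_gradedEquivalence {X : C → Datum} {n : C → ℤ} {X' : D → Datum}
    {n' : D → ℤ} (c : Coordinates C τ X n) (c' : Coordinates D τ X' n') (obj : C → D)
    (obj' : D → C) (hobj : ∀ Y, obj (obj' Y) = Y)
    (hadm : ∀ A B v, (X' (obj A)).Admissible (X' (obj B)) v ↔ (X A).Admissible (X B) v)
    (hmul : ∀ A B B' v w, (X A).Admissible (X B) v → (X B).Admissible (X B') w →
      Datum.mulVal τ (X' (obj A)) (X' (obj B)) (X' (obj B')) v w =
        Datum.mulVal τ (X A) (X B) (X B') v w)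
    (hdeg : ∀ A B k v, (X A).Admissible (X B) v →
      ((X' (obj A)).HasDegree (X' (obj B)) (n' (obj A) - n' (obj B)) k v ↔
        (X A).HasDegree (X B) (n A - n B) k v)) :
    ∃ F : GradedEquivalence C D, ∀ A, F.functor.obj A = obj A := by
  have hr (A B : C) : LinearMap.range (c.map A B) = LinearMap.range (c'.map (obj A) (obj B)) := by
    ext v
    rw [LinearMap.mem_range, LinearMap.mem_range, ← c.admissible_iff, ← c'.admissible_iff, hadm]
  let E (A B : C) : (A ⟶ B) ≃ₗ[ℂ] (obj A ⟶ obj B) :=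
    (LinearEquiv.ofInjective _ (c.injective A B)).trans
      ((LinearEquiv.ofEq _ _ (hr A B)).trans
        (LinearEquiv.ofInjective _ (c'.injective (obj A) (obj B))).symm)
  have hE {A B : C} (f : A ⟶ B) : c'.map (obj A) (obj B) (E A B f) = c.map A B f :=
    congrArg Subtype.val ((LinearEquiv.ofInjective _ (c'.injective (obj A) (obj B))).apply_symm_apply
      (LinearEquiv.ofEq _ _ (hr A B) (LinearEquiv.ofInjective _ (c.injective A B) f)))
  have ha {A B : C} (f : A ⟶ B) : (X A).Admissible (X B) (c.map A B f) :=
    c.admissible_iff.mpr ⟨f, rfl⟩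
  refine ⟨GradedEquivalence.ofHomEquiv obj obj' hobj E (fun A => ?_) (fun {A B B'} f g => ?_)
    (fun {A B k f} => ?_), fun A => rfl⟩
  · apply c'.injective
    rw [hE, c.map_id, c'.map_id]
  · apply c'.injective
    rw [hE, c.map_comp, c'.map_comp, hE, hE, hmul _ _ _ _ _ (ha f) (ha g)]
  · rw [c'.mem_deg, hE, hdeg _ _ _ _ (ha f), c.mem_deg]

end

end

section

variable {θ : ℝ} {P Q R S : Frame θ} {τ b : ℂ}
open _root_.NCTorus.Frame MeasureTheory

/-! ### Normal forms of the parameters -/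

/-- The period lattice `ℤτ + ℤ`. -/
def periodLattice (τ : ℂ) : AddSubgroup ℂ where
  carrier := {w | ∃ n k : ℤ, w = k - n * τ}
  zero_mem' := ⟨0, 0, by simp⟩
  add_mem' := by
    rintro _ _ ⟨n, k, rfl⟩ ⟨n', k', rfl⟩
    exact ⟨n + n', k + k', by push_cast; ring⟩
  neg_mem' := by
    rintro _ ⟨n, k, rfl⟩
    exact ⟨-n, -k, by push_cast; ring⟩

/-- The sign which distinguishes `v` from `-v`. -/
def sgn (v : ℤ × ℤ) : ℤ := if 0 < v.1 ∨ v.1 = 0 ∧ 0 < v.2 then 1 else -1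

lemma sgn_neg {v : ℤ × ℤ} (hv : v ≠ 0) : sgn (-v) = -sgn v := by
  have h : ¬(v.1 = 0 ∧ v.2 = 0) := fun h => hv (Prod.ext h.1 h.2)
  simp only [sgn, Prod.fst_neg, Prod.snd_neg]
  split_ifs <;> omega

lemma sgn_mul_self (v : ℤ × ℤ) : (sgn v : ℂ) * sgn v = 1 := by
  unfold sgn
  split_ifs <;> simp

lemma sgn_mul_mem_iff {v : ℤ × ℤ} {w : ℂ} :
    (sgn v : ℂ) * w ∈ periodLattice τ ↔ w ∈ periodLattice τ := by
  unfold sgn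
  split_ifs <;> simp

/-- A representative of `w` modulo the period lattice. The use of the sign makes the choice
compatible with the simultaneous change of sign of `v` and `w`. -/
def normalForm (τ : ℂ) (v : ℤ × ℤ) (w : ℂ) : ℂ :=
  sgn v * (QuotientAddGroup.mk (s := periodLattice τ) (sgn v * w)).out

lemma normalForm_neg {v : ℤ × ℤ} (hv : v ≠ 0) (w : ℂ) :
    normalForm τ (-v) (-w) = -normalForm τ v w := by
  rw [normalForm, normalForm, sgn_neg hv, Int.cast_neg, neg_mul_neg, neg_mul]

lemma normalForm_sub_mem (v : ℤ × ℤ) (w : ℂ) : normalForm τ v w - w ∈ periodLattice τ := by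
  have h : (QuotientAddGroup.mk (s := periodLattice τ) (sgn v * w)).out - sgn v * w ∈
      periodLattice τ := by
    rw [← QuotientAddGroup.eq_iff_sub_mem]
    exact Quotient.out_eq' _
  rw [← sgn_mul_mem_iff (v := v), mul_sub] at h
  rwa [← mul_assoc, sgn_mul_self, one_mul] at h

lemma normalForm_eq {v : ℤ × ℤ} {w w' : ℂ} (h : w - w' ∈ periodLattice τ) :
    normalForm τ v w = normalForm τ v w' := by
  rw [← sgn_mul_mem_iff (v := v), mul_sub, ← QuotientAddGroup.eq_iff_sub_mem] at h
  rw [normalForm, normalForm, h]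

lemma eq_of_normalForm_sub_mem {v : ℤ × ℤ} {w w' : ℂ}
    (h : normalForm τ v w - normalForm τ v w' ∈ periodLattice τ) :
    normalForm τ v w = normalForm τ v w' := by
  refine normalForm_eq ?_
  have h1 := add_mem (sub_mem h (normalForm_sub_mem v w)) (normalForm_sub_mem (τ := τ) v w')
  have h2 : normalForm τ v w - normalForm τ v w' - (normalForm τ v w - w) +
      (normalForm τ v w' - w') = w - w' := by ring
  rwa [h2] at h1

/-! ### Coordinates on the category of standard bundles -/

namespace StandardObject

/-- The frame of a standard bundle. -/
def frame (X : StandardObject θ) : Frame θ := ⟨X.g, X.rk_pos⟩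

/-- The normalized parameter of a standard bundle. -/
def param (τ : ℂ) (X : StandardObject θ) : ℂ :=
  normalForm τ X.frame.v (X.frame.r * X.z) / X.frame.r

/-- The datum of a standard bundle, with the parameter in normal form. -/
def datum (τ : ℂ) (X : StandardObject θ) : Datum := X.frame.datum (X.param τ)

lemma r_mul_param (X : StandardObject θ) :
    X.frame.r * X.param τ = normalForm τ X.frame.v (X.frame.r * X.z) :=
  mul_div_cancel₀ _ (Complex.ofReal_ne_zero.mpr X.frame.r_ne)

lemma exists_model_param (τ : ℂ) (X : StandardObject θ) :
    Nonempty (Model (X.toShifted τ).obj X.frame (X.param τ)) := by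
  obtain ⟨M⟩ := exists_model X.frame τ X.z
  obtain ⟨n, k, h⟩ := normalForm_sub_mem (τ := τ) X.frame.v (X.frame.r * X.z)
  exact M.translate (n := n) (k := k) (by rw [mul_sub, r_mul_param, h])

/-- A model of a standard bundle by kernels, with the normalized parameter. -/
def model (τ : ℂ) (X : StandardObject θ) : Model (X.toShifted τ).obj X.frame (X.param τ) :=
  (exists_model_param τ X).some

/-- The monodromies of bundles of the same slope are trivial on some line only if the parameters
are congruent modulo the lattice, and congruent parameters have the same normal form. -/
lemma separated (X Y : StandardObject θ) :
    Separated τ X.frame Y.frame (X.param τ) (Y.param τ) := by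
  intro hv hz l h
  rw [expo_mul_r, Complex.exp_eq_one_iff] at h
  obtain ⟨k, hk⟩ := h
  have hr : X.frame.r = Y.frame.r := r_eq_of_v_eq hv
  have h1 : τ * X.frame.dt l + X.frame.r * (Y.param τ - X.param τ) = k := by
    have := Complex.two_pi_I_ne_zero
    refine mul_left_cancel₀ this ?_
    rw [hk]
    ring
  have h2 : normalForm τ Y.frame.v (Y.frame.r * Y.z) - normalForm τ Y.frame.v (X.frame.r * X.z) ∈
      periodLattice τ := by
    refine ⟨X.frame.dt l, k, ?_⟩
    rw [← r_mul_param, ← hv, ← r_mul_param, ← h1, ← hr]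
    ring
  have h3 := eq_of_normalForm_sub_mem h2
  rw [← r_mul_param, ← hv, ← r_mul_param, ← hr] at h3
  exact hz (mul_left_cancel₀ (Complex.ofReal_ne_zero.mpr X.frame.r_ne) h3).symm

end StandardObject

/-- The morphisms of `H^*C^{st}(θ, τ)_{θ'}` in coordinates. -/
def HCstSub.coordinates (hτ : τ.im < 0) (θ θ' : ℝ) : Coordinates (HCstSub θ τ θ') τ
    (fun X => StandardObject.datum τ X.obj) (fun X => StandardObject.n X.obj) where
  map A B :=
    Model.coord hτ (StandardObject.model τ A.obj) (StandardObject.model τ B.obj) ∘ₗ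
      { toFun := fun f => f.hom.hom
        map_add' := fun _ _ => rfl
        map_smul' := fun _ _ => rfl }
  injective A B f g h := by
    have h1 := Model.coord_injective hτ _ _ (StandardObject.separated A.obj B.obj) h
    exact ObjectProperty.hom_ext _ (InducedCategory.hom_ext h1)
  admissible_iff {A B v} := by
    refine (Model.admissible_iff hτ (StandardObject.model τ A.obj)
      (StandardObject.model τ B.obj)).trans ⟨?_, ?_⟩
    · rintro ⟨φ, hφ⟩
      exact ⟨ObjectProperty.homMk (InducedCategory.homMk φ), hφ⟩
    · rintro ⟨f, hf⟩
      exact ⟨f.hom.hom, hf⟩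
  map_id A := Model.coord_id hτ (StandardObject.model τ A.obj)
  map_comp {A B B'} f g := Model.coord_comp hτ (StandardObject.model τ A.obj)
    (StandardObject.model τ B.obj) (StandardObject.model τ B'.obj)
    (StandardObject.separated A.obj B.obj) (StandardObject.separated B.obj B'.obj) f.hom.hom
    g.hom.hom
  mem_deg {A B k f} := (Model.hasDegree_iff hτ (StandardObject.model τ A.obj)
    (StandardObject.model τ B.obj) (StandardObject.separated A.obj B.obj)).symm

end

section

variable {θ : ℝ} {P Q R S : Frame θ} {τ b : ℂ}
open _root_.NCTorus.Frame MeasureTheory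

/-! ### The change of `θ` -/

section

variable {θ' : ℝ}

/-- The standard object which underlies an object of `H^*C^{st}(θ, τ)_{θ'}`. -/
def HCstSub.std (X : HCstSub θ τ θ') : StandardObject θ := X.obj

lemma HCstSub.ext {X Y : HCstSub θ τ θ'} (h : X.std = Y.std) : X = Y := by
  cases X
  cases Y
  cases h
  rfl

lemma std_transfer_of_pos {X : HCstSub θ τ θ'} (h : 0 < rk X.std.g θ') :
    (transfer θ τ θ' X).std =
      ⟨X.std.g, (rk X.std.g θ / rk X.std.g θ' : ℝ) * X.std.z, X.std.n, h⟩ :=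
  congrArg HCstSub.std (dif_pos h)

lemma std_transfer_of_neg {X : HCstSub θ τ θ'} (h : rk X.std.g θ' < 0) :
    (transfer θ τ θ' X).std =
      ⟨-X.std.g, (rk X.std.g θ / rk X.std.g θ' : ℝ) * X.std.z,
        if θ < θ' then X.std.n - 1 else X.std.n + 1, by rw [rk_neg]; exact neg_pos.mpr h⟩ :=
  congrArg HCstSub.std (dif_neg h.not_gt)

lemma rk_pos_or_neg (X : HCstSub θ τ θ') : 0 < rk X.std.g θ' ∨ rk X.std.g θ' < 0 :=
  (lt_or_gt_of_ne X.property).symm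

/-- The second transfer returns to the original sign of `g`, and the two shifts cancel since the
order of `θ` and `θ'` is reversed. -/
lemma transfer_transfer (X : HCstSub θ τ θ') : transfer θ' τ θ (transfer θ τ θ' X) = X := by
  refine HCstSub.ext ?_
  have hp := X.std.rk_pos
  have h1 : (rk X.std.g θ : ℂ) ≠ 0 := Complex.ofReal_ne_zero.mpr hp.ne'
  have h2 : (rk X.std.g θ' : ℂ) ≠ 0 := Complex.ofReal_ne_zero.mpr X.property
  rcases rk_pos_or_neg X with h | h
  · have e := std_transfer_of_pos h
    have eg := congrArg StandardObject.g e
    have ez := congrArg StandardObject.z e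
    have en := congrArg StandardObject.n e
    rw [std_transfer_of_pos (by rw [eg]; exact hp)]
    ext1
    · exact eg
    · show ((rk (transfer θ τ θ' X).std.g θ' / rk (transfer θ τ θ' X).std.g θ : ℝ) : ℂ) *
        (transfer θ τ θ' X).std.z = _
      rw [eg, ez]
      push_cast
      field_simp
    · exact en
  · have e := std_transfer_of_neg h
    have eg := congrArg StandardObject.g e
    have ez := congrArg StandardObject.z e
    have en := congrArg StandardObject.n e
    have hne : θ ≠ θ' := by
      rintro rfl
      exact lt_asymm h hp
    rw [std_transfer_of_neg (by rw [eg]; simpa only [rk_neg, neg_lt_zero] using hp)]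
    ext1
    · show -(transfer θ τ θ' X).std.g = _
      rw [eg, neg_neg]
    · show ((rk (transfer θ τ θ' X).std.g θ' / rk (transfer θ τ θ' X).std.g θ : ℝ) : ℂ) *
        (transfer θ τ θ' X).std.z = _
      rw [eg, ez]
      simp only [rk_neg]
      push_cast
      field_simp
    · show (if θ' < θ then (transfer θ τ θ' X).std.n - 1 else (transfer θ τ θ' X).std.n + 1) = _
      rw [en]
      rcases lt_or_gt_of_ne hne with h' | h'
      · simp [h', h'.not_gt]
      · simp [h', h'.not_gt]

lemma StandardObject.v_ne_zero (X : StandardObject θ) : X.frame.v ≠ 0 := fun h => by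
  have h1 := X.frame.r_ne
  rw [Frame.r, h] at h1
  simp [proj] at h1

lemma StandardObject.datum_eq (X : StandardObject θ) : X.datum τ =
    ⟨X.frame.p, X.frame.v, normalForm τ X.frame.v (rk X.g θ * X.z)⟩ := by
  rw [StandardObject.datum, Frame.datum, r_mul_param]
  rfl

/-- The factor `λ(g)` is such that the product of the rank and the parameter is preserved. -/
lemma datum_transfer_of_pos {X : HCstSub θ τ θ'} (h : 0 < rk X.std.g θ') :
    (transfer θ τ θ' X).std.datum τ = X.std.datum τ := by
  have h2 : (rk X.std.g θ' : ℂ) ≠ 0 := Complex.ofReal_ne_zero.mpr X.property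
  rw [std_transfer_of_pos h, StandardObject.datum_eq, StandardObject.datum_eq]
  have hw : (rk X.std.g θ' : ℂ) * ((rk X.std.g θ / rk X.std.g θ' : ℝ) * X.std.z) =
      rk X.std.g θ * X.std.z := by
    push_cast
    field_simp
  show Datum.mk X.std.frame.p X.std.frame.v (normalForm τ X.std.frame.v _) = _
  rw [hw]

lemma datum_transfer_of_neg {X : HCstSub θ τ θ'} (h : rk X.std.g θ' < 0) :
    (transfer θ τ θ' X).std.datum τ = -X.std.datum τ := by
  have h2 : (rk X.std.g θ' : ℂ) ≠ 0 := Complex.ofReal_ne_zero.mpr X.property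
  rw [std_transfer_of_neg h, StandardObject.datum_eq, StandardObject.datum_eq]
  have hw : (rk (-X.std.g) θ' : ℂ) * ((rk X.std.g θ / rk X.std.g θ' : ℝ) * X.std.z) =
      -(rk X.std.g θ * X.std.z) := by
    rw [rk_neg]
    push_cast
    field_simp
  have hv := normalForm_neg (τ := τ) X.std.v_ne_zero (rk X.std.g θ * X.std.z)
  show Datum.mk (-X.std.frame.p) (-X.std.frame.v) (normalForm τ (-X.std.frame.v) _) = _
  rw [hw, hv]
  rfl

/-- The determinant of two frames measures how the ratio of their ranks varies with `θ`. -/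
lemma rk_mul_sub (P Q : Frame θ) (θ' : ℝ) :
    rk Q.g θ' * rk P.g θ - rk Q.g θ * rk P.g θ' = (θ' - θ) * P.dt Q.v := by
  simp only [rk, Frame.dt, Frame.v, Frame.c, Frame.d]
  push_cast
  ring

namespace Datum

lemma hasDegree_neg_neg {X Y : Datum} {δ k : ℤ} {v : Val} :
    HasDegree (-X) (-Y) δ k v ↔ HasDegree X Y δ k v := by
  simp only [HasDegree, neg_v, dt_neg, neg_dt, _root_.neg_neg]

lemma hasDegree_iff_of_ne {X Y : Datum} (h : X.dt Y.v ≠ 0) {δ k : ℤ} {v : Val} :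
    HasDegree X Y δ k v ↔ (k ≠ (δ + if X.dt Y.v < 0 then 1 else 0) → v = 0) :=
  ⟨fun H => H.1 h, fun H => ⟨fun _ => H, fun h' => absurd h' h⟩⟩

/-- A change of the sign of one datum exchanges `H⁰` and `H¹`, which a shift compensates. -/
lemma hasDegree_iff_of_eq {X Y X' Y' : Datum} (h : X.dt Y.v ≠ 0) (h' : X'.dt Y'.v = -X.dt Y.v)
    {δ δ' k : ℤ} (hδ : δ' = δ + if X.dt Y.v < 0 then 1 else -1) {v : Val} :
    HasDegree X' Y' δ' k v ↔ HasDegree X Y δ k v := by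
  rw [hasDegree_iff_of_ne h, hasDegree_iff_of_ne (by rw [h']; exact neg_ne_zero.mpr h), h', hδ]
  rcases lt_or_gt_of_ne h with h | h
  · simp [h, h.not_gt]
  · simp [h, h.not_gt]

end Datum

/-- The degrees of morphisms do not depend on `θ`: if `rk` changes its sign at exactly one of two
objects, then the order of the slopes is reversed, in the direction given by `θ < θ'` or
`θ' < θ`. -/
lemma hasDegree_transfer (X Y : HCstSub θ τ θ') {k : ℤ} {v : Val} :
    ((transfer θ τ θ' X).std.datum τ).HasDegree ((transfer θ τ θ' Y).std.datum τ)
        ((transfer θ τ θ' X).std.n - (transfer θ τ θ' Y).std.n) k v ↔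
      (X.std.datum τ).HasDegree (Y.std.datum τ) (X.std.n - Y.std.n) k v := by
  have hX := X.std.rk_pos
  have hY := Y.std.rk_pos
  have hd := rk_mul_sub X.std.frame Y.std.frame θ'
  change rk Y.std.g θ' * rk X.std.g θ - rk Y.std.g θ * rk X.std.g θ' =
    (θ' - θ) * ((X.std.datum τ).dt (Y.std.datum τ).v : ℤ) at hd
  have npos {Z : HCstSub θ τ θ'} (h : 0 < rk Z.std.g θ') : (transfer θ τ θ' Z).std.n = Z.std.n :=
    congrArg StandardObject.n (std_transfer_of_pos h)
  have nneg {Z : HCstSub θ τ θ'} (h : rk Z.std.g θ' < 0) : (transfer θ τ θ' Z).std.n =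
      if θ < θ' then Z.std.n - 1 else Z.std.n + 1 :=
    congrArg StandardObject.n (std_transfer_of_neg h)
  have pos_of {c : ℤ} {s : ℝ} (hs : 0 < s) (h : 0 < s * c) : 0 < c := by
    exact_mod_cast (mul_pos_iff_of_pos_left hs).mp h
  rcases rk_pos_or_neg X with h | h <;> rcases rk_pos_or_neg Y with h' | h'
  · rw [datum_transfer_of_pos h, datum_transfer_of_pos h', npos h, npos h']
  · rw [datum_transfer_of_pos h, datum_transfer_of_neg h', npos h, nneg h']
    -- Only the rank of `Y` changes its sign; `rk_mul_sub` gives the order of the slopes.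
    have h1 : (θ' - θ) * ((X.std.datum τ).dt (Y.std.datum τ).v : ℤ) < 0 := by
      rw [← hd]
      nlinarith [mul_neg_of_neg_of_pos h' hX, mul_pos hY h]
    set c := (X.std.datum τ).dt (Y.std.datum τ).v with hc
    have hne : θ ≠ θ' := by
      rintro rfl
      simp at h1
    rcases lt_or_gt_of_ne hne with hθ | hθ
    · have h2 : 0 < -c := pos_of (sub_pos.mpr hθ) (by push_cast; linarith)
      refine Datum.hasDegree_iff_of_eq (by omega) (by simp) ?_
      rw [← hc, if_pos hθ, if_pos (by omega)]
      ring
    · have h2 : 0 < c := pos_of (sub_pos.mpr hθ) (by linarith)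
      refine Datum.hasDegree_iff_of_eq (by omega) (by simp) ?_
      rw [← hc, if_neg hθ.not_gt, if_neg (by omega)]
      ring
  · rw [datum_transfer_of_neg h, datum_transfer_of_pos h', nneg h, npos h']
    -- Only the rank of `X` changes its sign.
    have h1 : 0 < (θ' - θ) * ((X.std.datum τ).dt (Y.std.datum τ).v : ℤ) := by
      rw [← hd]
      nlinarith [mul_neg_of_pos_of_neg hY h, mul_pos h' hX]
    set c := (X.std.datum τ).dt (Y.std.datum τ).v with hc
    have hne : θ ≠ θ' := by
      rintro rfl
      simp at h1
    rcases lt_or_gt_of_ne hne with hθ | hθ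
    · have h2 : 0 < c := pos_of (sub_pos.mpr hθ) h1
      refine Datum.hasDegree_iff_of_eq (by omega) (by simp) ?_
      rw [← hc, if_pos hθ, if_neg (by omega)]
      ring
    · have h2 : 0 < -c := pos_of (sub_pos.mpr hθ) (by push_cast; linarith)
      refine Datum.hasDegree_iff_of_eq (by omega) (by simp) ?_
      rw [← hc, if_neg hθ.not_gt, if_pos (by omega)]
      ring
  · rw [datum_transfer_of_neg h, datum_transfer_of_neg h', nneg h, nneg h',
      Datum.hasDegree_neg_neg]
    have h1 : (if θ < θ' then X.std.n - 1 else X.std.n + 1) -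
        (if θ < θ' then Y.std.n - 1 else Y.std.n + 1) = X.std.n - Y.std.n := by
      split_ifs <;> ring
    rw [h1]

lemma datum_transfer (X : HCstSub θ τ θ') :
    (transfer θ τ θ' X).std.datum τ = X.std.datum τ ∨
      (transfer θ τ θ' X).std.datum τ = -X.std.datum τ :=
  (rk_pos_or_neg X).imp datum_transfer_of_pos datum_transfer_of_neg

lemma admissible_transfer (X Y : HCstSub θ τ θ') (v : Val) :
    ((transfer θ τ θ' X).std.datum τ).Admissible ((transfer θ τ θ' Y).std.datum τ) v ↔
      (X.std.datum τ).Admissible (Y.std.datum τ) v := by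
  rcases datum_transfer X with h | h <;> rcases datum_transfer Y with h' | h' <;> rw [h, h'] <;>
    simp only [Datum.admissible_neg_left, Datum.admissible_neg_right]

lemma mulVal_transfer (X Y Z : HCstSub θ τ θ') {v w : Val}
    (hv : (X.std.datum τ).Admissible (Y.std.datum τ) v)
    (hw : (Y.std.datum τ).Admissible (Z.std.datum τ) w) :
    Datum.mulVal τ ((transfer θ τ θ' X).std.datum τ) ((transfer θ τ θ' Y).std.datum τ)
        ((transfer θ τ θ' Z).std.datum τ) v w =
      Datum.mulVal τ (X.std.datum τ) (Y.std.datum τ) (Z.std.datum τ) v w := by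
  have hY := mulVal_neg_middle (τ := τ) hv hw
  change Datum.mulVal τ _ (-Y.std.datum τ) _ v w = _ at hY
  rcases datum_transfer X with h | h <;> rcases datum_transfer Y with h' | h' <;>
    rcases datum_transfer Z with h'' | h'' <;> rw [h, h', h''] <;>
    simp only [Datum.mulVal_neg_left, Datum.mulVal_neg_right, hY] <;> rfl

end

end

end NCTorus

end

theorem mainTheorem2 (τ : ℂ) (hτ : τ.im < 0) (θ θ' : ℝ) :
    ∃ F : NCTorus.GradedEquivalence (NCTorus.HCstSub θ τ θ') (NCTorus.HCstSub θ' τ θ),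
      ∀ X : NCTorus.HCstSub θ τ θ', F.functor.obj X = NCTorus.transfer θ τ θ' X := by
  exact NCTorus.Coordinates.exists_gradedEquivalence (NCTorus.HCstSub.coordinates hτ θ θ')
    (NCTorus.HCstSub.coordinates hτ θ' θ) (NCTorus.transfer θ τ θ') (NCTorus.transfer θ' τ θ)
    NCTorus.transfer_transfer NCTorus.admissible_transfer
    (fun X Y Z _ _ => NCTorus.mulVal_transfer X Y Z)
    (fun X Y _ _ _ => NCTorus.hasDegree_transfer X Y)
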